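/- Manifolds are finite-dimensional, Hausdorff, second countable, without boundary, and everything is smooth. Let $G$ be a real Lie group with Lie algebra $\mathfrak g$, and let $p\colon P\to M$ be a principal $G$-bundle with right action; for $z\in\mathfrak g$ let $Y_z$ be the fundamental vector field on $P$. Let $\hat E$ be an exact Courant algebroid over $P$, with pairing $\langle\cdot,\cdot\rangle$, Dorfman bracket $[\cdot,\cdot]$ and anchor $\pi\colon\hat E\to TP$ (normalized by $[e,e]=\tfrac12\pi^*d\langle e,e\rangle$). Let $\rho\colon\mathfrak g\to\Gamma(\hat E)$ be a lift of the $G$-action: a linear map with $\rho([z,w])=[\rho(z),\rho(w)]$ and $\pi\rho(z)=Y_z$, such that the infinitesimal action $z\mapsto[\rho(z),\cdot]$ integrates to a right $G$-action on $\hat E$ by Courant algebroid automorphisms covering the action on $P$. Assume that $\rho$ is equivariant, $\rho(\operatorname{Ad}(g)z)=g\rho(z)$ with $(g\sigma)(q)=\sigma(qg)g^{-1}$, and that there is a $G$-equivariant isotropic splitting $TP\to\hat E$ of $\pi$. Assume that $-\langle\rho(z),\rho(z)\rangle=c(z,z)$ is constant on $P$ for every $z\in\mathfrak g$, where $c$ is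 a symmetric bilinear form on $\mathfrak g$, and that $c$ is non-degenerate. Put $K=\rho(\mathfrak g)\subset\hat E$ and let $$E=\frac{K^\perp}{K\cap K^\perp}\Big/G$$ be the reduced Courant algebroid over $M$: its sections are induced by the $G$-invariant sections of $K^\perp$, and its pairing and Dorfman bracket are induced by those of $\hat E$. The anchor of $\hat E$ induces a natural projection $E\to TP/G$. Let $A$ be a connection on $P$, written as a $\mathfrak g$-valued $1$-form; let $A^\perp$ denote horizontal parts and horizontal lifts, $F(X,Y)=-A[A^\perp X,A^\perp Y]$ its curvature, and $\nabla^A_Z r=[A^\perp Z,r]$ the induced connection on $\operatorname{ad}P$ (vertical vectors being identified with elements of $\mathfrak g$ inside $c$). Consider pairs $(\Phi,H)$ consisting of an isomorphism of vector bundles $\Phi\colon TP/G\oplus T^*M\to E$ compatible with the projections to $TP/G$ and a $3$-form $H\in\Omega^3(M)$, such that, under $\Phi$, the pairing is $$\langle X+\xi,Y+\eta\rangle=\tfrac12\big(i_{pX}\eta+i_{pY}\xi\big)+c(AX,AY)$$ and the Dorfman bracket is $$[X+\xi,Y+\eta]=[X,Y]+L_{pX}\eta-i_{pY}d\xi+i_{pY}i_{pX}H+2c(\nabla^A(AX),AY)+2c(F(X,\cdot),AY)-2c(F(Y,\cdot),AX)$$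 for all sections $X,Y$ of $TP/G$ (invariant vector fields on $P$) and $\xi,\eta\in\Omega^1(M)$. Then: 1. such a pair $(\Phi,H)$ exists; 2. if $(\Phi,H)$ and $(\Phi',H')$ are two such pairs, there is $b\in\Omega^2(M)$ with $\Phi'(X+\xi)=\Phi(X+\xi+i_{pX}b)$ and $H'=H+db$; 3. conversely, if $(\Phi,H)$ is such a pair and $b\in\Omega^2(M)$, then $\Phi'(X+\xi)=\Phi(X+\xi+i_{pX}b)$ and $H'=H+db$ form such a pair. So $H$ is unique exactly up to adding $db$ with $b\in\Omega^2(M)$. -/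

import Mathlib

open Set Bundle Manifold VectorField
open scoped Manifold ContDiff Topology

noncomputable section

namespace CourantReduction

/-! ### Vector fields and differential forms on a manifold without boundary -/

section Forms

variable {E : Type*} [NormedAddCommGroup E] [NormedSpace ℝ E]
  {M : Type*} [TopologicalSpace M] [ChartedSpace E M]

/-- `X` is a smooth vector field. -/
def SmoothField [IsManifold 𝓘(ℝ, E) ∞ M] (X : ∀ x : M, TangentSpace 𝓘(ℝ, E) x) : Prop :=
  ContMDiff 𝓘(ℝ, E) 𝓘(ℝ, E).tangent ∞ (fun x => (⟨x, X x⟩ : TangentBundle 𝓘(ℝ, E) M))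

/-- The derivative `X(f)` of a function along a vector field. -/
def dirDeriv (X : ∀ x : M, TangentSpace 𝓘(ℝ, E) x) (f : M → ℝ) (x : M) : ℝ :=
  mvfderiv 𝓘(ℝ, E) f x (X x)

/-- A field of covectors (a section of the cotangent bundle) is smooth if its value on every
smooth vector field is a smooth function. -/
def SmoothCovector [IsManifold 𝓘(ℝ, E) ∞ M]
    (ξ : ∀ x : M, Module.Dual ℝ (TangentSpace 𝓘(ℝ, E) x)) : Prop :=
  ∀ X : ∀ x : M, TangentSpace 𝓘(ℝ, E) x, SmoothField X →
    ContMDiff 𝓘(ℝ, E) 𝓘(ℝ, ℝ) ∞ (fun x => ξ x (X x))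

variable (E M) in
/-- Smooth differential `k`-forms: fields of alternating `k`-linear forms whose value on
any `k` smooth vector fields is a smooth function. -/
structure SmoothForm [IsManifold 𝓘(ℝ, E) ∞ M] (k : ℕ) where
  toFun : ∀ x : M, (TangentSpace 𝓘(ℝ, E) x) [⋀^Fin k]→ₗ[ℝ] ℝ
  smooth : ∀ X : Fin k → ∀ x : M, TangentSpace 𝓘(ℝ, E) x, (∀ i, SmoothField (X i)) →
    ContMDiff 𝓘(ℝ, E) 𝓘(ℝ, ℝ) ∞ (fun x => toFun x (fun i => X i x))

/-- `dξ(X,Y) = X(ξ(Y)) - Y(ξ(X)) - ξ([X,Y])`. -/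
def extDerivOne (ξ : ∀ x : M, Module.Dual ℝ (TangentSpace 𝓘(ℝ, E) x))
    (X Y : ∀ x : M, TangentSpace 𝓘(ℝ, E) x) (x : M) : ℝ :=
  dirDeriv X (fun y => ξ y (Y y)) x - dirDeriv Y (fun y => ξ y (X y)) x
    - ξ x (mlieBracket 𝓘(ℝ, E) X Y x)

/-- `(L_X η)(Z) = X(η(Z)) - η([X,Z])`. -/
def lieDerivOne (X : ∀ x : M, TangentSpace 𝓘(ℝ, E) x)
    (η : ∀ x : M, Module.Dual ℝ (TangentSpace 𝓘(ℝ, E) x))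
    (Z : ∀ x : M, TangentSpace 𝓘(ℝ, E) x) (x : M) : ℝ :=
  dirDeriv X (fun y => η y (Z y)) x - η x (mlieBracket 𝓘(ℝ, E) X Z x)

/-- `db(X,Y,Z)` for a `2`-form `b`, by the invariant formula. -/
def extDerivTwo [IsManifold 𝓘(ℝ, E) ∞ M] (b : SmoothForm E M 2)
    (X Y Z : ∀ x : M, TangentSpace 𝓘(ℝ, E) x) (x : M) : ℝ :=
  dirDeriv X (fun y => b.toFun y ![Y y, Z y]) x
    - dirDeriv Y (fun y => b.toFun y ![X y, Z y]) x
    + dirDeriv Z (fun y => b.toFun y ![X y, Y y]) x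
    - b.toFun x ![mlieBracket 𝓘(ℝ, E) X Y x, Z x]
    + b.toFun x ![mlieBracket 𝓘(ℝ, E) X Z x, Y x]
    - b.toFun x ![mlieBracket 𝓘(ℝ, E) Y Z x, X x]

/-- `H' = H + db`. -/
def EqAddExact [IsManifold 𝓘(ℝ, E) ∞ M] (H' H : SmoothForm E M 3) (b : SmoothForm E M 2) : Prop :=
  ∀ X Y Z : ∀ x : M, TangentSpace 𝓘(ℝ, E) x, SmoothField X → SmoothField Y → SmoothField Z →
    ∀ x, H'.toFun x ![X x, Y x, Z x] = H.toFun x ![X x, Y x, Z x] + extDerivTwo b X Y Z x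

end Forms

/-! ### Courant algebroids -/

section Courant

variable (EP : Type*) [NormedAddCommGroup EP] [NormedSpace ℝ EP]
  {P : Type*} [TopologicalSpace P] [ChartedSpace EP P] [IsManifold 𝓘(ℝ, EP) ∞ P]
  (F : Type*) [NormedAddCommGroup F] [NormedSpace ℝ F]
  (V : P → Type*) [TopologicalSpace (TotalSpace F V)]
  [∀ q, AddCommGroup (V q)] [∀ q, Module ℝ (V q)] [∀ q, TopologicalSpace (V q)]
  [FiberBundle F V] [VectorBundle ℝ F V]

/-- A Courant algebroid structure, with its Dorfman bracket, on a smooth vector bundle `V → P`. -/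
structure CourantAlgebroid where
  pairing : ∀ q, LinearMap.BilinForm ℝ (V q)
  anchor : ∀ q, V q →ₗ[ℝ] TangentSpace 𝓘(ℝ, EP) q
  bracket : Cₛ^∞⟮𝓘(ℝ, EP); F, V⟯ →ₗ[ℝ] Cₛ^∞⟮𝓘(ℝ, EP); F, V⟯ →ₗ[ℝ] Cₛ^∞⟮𝓘(ℝ, EP); F, V⟯
  pairing_symm : ∀ q v w, pairing q v w = pairing q w v
  pairing_nondegenerate : ∀ q v, (∀ w, pairing q v w = 0) → v = 0
  pairing_smooth : ∀ σ τ : Cₛ^∞⟮𝓘(ℝ, EP); F, V⟯,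
    ContMDiff 𝓘(ℝ, EP) 𝓘(ℝ, ℝ) ∞ (fun q => pairing q (σ q) (τ q))
  anchor_smooth : ∀ σ : Cₛ^∞⟮𝓘(ℝ, EP); F, V⟯, SmoothField (fun q => anchor q (σ q))
  jacobi : ∀ σ τ υ, bracket σ (bracket τ υ) = bracket (bracket σ τ) υ + bracket τ (bracket σ υ)
  anchor_bracket : ∀ (σ τ : Cₛ^∞⟮𝓘(ℝ, EP); F, V⟯) (q : P), anchor q (bracket σ τ q) =
    mlieBracket 𝓘(ℝ, EP) (fun q' => anchor q' (σ q')) (fun q' => anchor q' (τ q')) q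
  leibniz : ∀ (f : P → ℝ) (σ τ τ' : Cₛ^∞⟮𝓘(ℝ, EP); F, V⟯), ContMDiff 𝓘(ℝ, EP) 𝓘(ℝ, ℝ) ∞ f →
    (∀ q, τ' q = f q • τ q) → ∀ q, bracket σ τ' q =
      f q • bracket σ τ q + dirDeriv (fun q' => anchor q' (σ q')) f q • τ q
  bracket_pairing : ∀ (σ τ υ : Cₛ^∞⟮𝓘(ℝ, EP); F, V⟯) (q : P),
    dirDeriv (fun q' => anchor q' (σ q')) (fun q' => pairing q' (τ q') (υ q')) q =
      pairing q (bracket σ τ q) (υ q) + pairing q (τ q) (bracket σ υ q)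
  /-- `[σ,σ] = ½ π^* d⟨σ,σ⟩`. -/
  bracket_self : ∀ (σ υ : Cₛ^∞⟮𝓘(ℝ, EP); F, V⟯) (q : P), pairing q (bracket σ σ q) (υ q) =
    (1 / 2 : ℝ) * dirDeriv (fun q' => anchor q' (υ q')) (fun q' => pairing q' (σ q') (σ q')) q

variable {EP F V}

/-- Exactness of `0 → T^*P → V → TP → 0`, where the first map `π^*` is the dual of the
anchor `π` followed by the identification of `V` with its dual: `⟨π^*α, w⟩ = α(π w)`. (Injectivity
of `π^*` is the surjectivity of `π`, and `π ∘ π^* = 0` holds in every Courant algebroid.) -/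
def CourantAlgebroid.IsExact (C : CourantAlgebroid EP F V) : Prop :=
  ∀ q, Function.Surjective (C.anchor q) ∧
    ∀ v, C.anchor q v = 0 → ∃ α : Module.Dual ℝ (TangentSpace 𝓘(ℝ, EP) q),
      ∀ w, C.pairing q v w = α (C.anchor q w)

end Courant

/-! ### Principal bundles, connections and the Atiyah bundle `TP/G` -/

section Principal

variable {EG : Type*} [NormedAddCommGroup EG] [NormedSpace ℝ EG]
  {G : Type*} [TopologicalSpace G] [ChartedSpace EG G] [Group G]
  {EP : Type*} [NormedAddCommGroup EP] [NormedSpace ℝ EP]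
  {P : Type*} [TopologicalSpace P] [ChartedSpace EP P]
  {EM : Type*} [NormedAddCommGroup EM] [NormedSpace ℝ EM]
  {M : Type*} [TopologicalSpace M] [ChartedSpace EM M]

variable (EG G EP P EM M) in
/-- A smooth principal `G`-bundle `proj : P → M` with right action `act`. -/
structure PrincipalBundle where
  act : P → G → P
  proj : P → M
  act_one : ∀ q, act q 1 = q
  act_mul : ∀ q g h, act (act q g) h = act q (g * h)
  contMDiff_act :
    ContMDiff (𝓘(ℝ, EP).prod 𝓘(ℝ, EG)) 𝓘(ℝ, EP) ∞ (fun a : P × G => act a.1 a.2)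
  contMDiff_proj : ContMDiff 𝓘(ℝ, EP) 𝓘(ℝ, EM) ∞ proj
  proj_act : ∀ q g, proj (act q g) = proj q
  locally_trivial : ∀ x : M, ∃ (U : Set M) (φ : OpenPartialHomeomorph P (M × G)),
    IsOpen U ∧ x ∈ U ∧ φ.source = proj ⁻¹' U ∧ φ.target = U ×ˢ univ ∧
    ContMDiffOn 𝓘(ℝ, EP) (𝓘(ℝ, EM).prod 𝓘(ℝ, EG)) ∞ φ φ.source ∧
    ContMDiffOn (𝓘(ℝ, EM).prod 𝓘(ℝ, EG)) 𝓘(ℝ, EP) ∞ φ.symm φ.target ∧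
    ∀ q ∈ φ.source, (φ q).1 = proj q ∧ ∀ g, (φ (act q g)).2 = (φ q).2 * g

variable (EG) in
/-- The adjoint action of a Lie group on its Lie algebra. -/
def Ad (g : G) : GroupLieAlgebra 𝓘(ℝ, EG) G →L[ℝ] GroupLieAlgebra 𝓘(ℝ, EG) G :=
  mfderiv 𝓘(ℝ, EG) 𝓘(ℝ, EG) (fun h : G => g * h * g⁻¹) 1

namespace PrincipalBundle

variable (B : PrincipalBundle EG G EP P EM M)

/-- The differential of `R_g : q ↦ q g`. -/
def dAct (g : G) (q : P) : TangentSpace 𝓘(ℝ, EP) q →L[ℝ] TangentSpace 𝓘(ℝ, EP) (B.act q g) :=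
  mfderiv 𝓘(ℝ, EP) 𝓘(ℝ, EP) (fun q' => B.act q' g) q

/-- The differential of the projection. -/
def dProj (q : P) : TangentSpace 𝓘(ℝ, EP) q →L[ℝ] TangentSpace 𝓘(ℝ, EM) (B.proj q) :=
  mfderiv 𝓘(ℝ, EP) 𝓘(ℝ, EM) B.proj q

/-- The infinitesimal action `ψ(z)`, that is, the fundamental vector field `Y_z`. -/
def fundamental (q : P) (z : GroupLieAlgebra 𝓘(ℝ, EG) G) : TangentSpace 𝓘(ℝ, EP) q :=
  (mfderiv 𝓘(ℝ, EG) 𝓘(ℝ, EP) (fun g => B.act q g) 1 z : EP)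

/-- The fibre of `P` over `x`. -/
abbrev Fib (x : M) : Type _ := {q : P // B.proj q = x}

/-- The action of `G` on a fibre. -/
def actFib {x : M} (q : B.Fib x) (g : G) : B.Fib x :=
  ⟨B.act q.1 g, (B.proj_act q.1 g).trans q.2⟩

/-- The fibre of `TP/G` over `x`: `G`-equivariant families of tangent vectors of `P` along the
fibre of `P` over `x`. Evaluation at a point `q` of the fibre identifies it with `T_q P`. -/
def AtiyahFiber (x : M) : Submodule ℝ (∀ q : B.Fib x, TangentSpace 𝓘(ℝ, EP) q.1) where
  carrier := {X | ∀ (q : B.Fib x) (g : G), X (B.actFib q g) = B.dAct g q.1 (X q)}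
  add_mem' := by
    intro X Y hX hY q g
    simp only [Pi.add_apply, hX q g, hY q g, map_add]
    rfl
  zero_mem' := by
    intro q g
    simp only [Pi.zero_apply, map_zero]
    rfl
  smul_mem' := by
    intro r X hX q g
    simp only [Pi.smul_apply, hX q g, map_smul]
    rfl

/-- The `G`-invariant vector field on `P` that corresponds to a section of `TP/G`. -/
def field (X : ∀ x, B.AtiyahFiber x) (q : P) : TangentSpace 𝓘(ℝ, EP) q :=
  (X (B.proj q)).1 ⟨q, rfl⟩

/-- The vector field `Z` on `M` is the image `pX` of the vector field `X` on `P`. -/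
def Projects (X : ∀ q : P, TangentSpace 𝓘(ℝ, EP) q)
    (Z : ∀ x : M, TangentSpace 𝓘(ℝ, EM) x) : Prop :=
  ∀ q, B.dProj q (X q) = Z (B.proj q)

/-- A connection on `P`, as an equivariant `𝔤`-valued `1`-form reproducing the generators of
the action; composed with `𝔤 ≅ V_q P` it is the projection of `TP` to the vertical bundle. -/
structure Connection [IsManifold 𝓘(ℝ, EP) ∞ P] where
  form : ∀ q : P, TangentSpace 𝓘(ℝ, EP) q →ₗ[ℝ] GroupLieAlgebra 𝓘(ℝ, EG) G
  smooth : ∀ X : ∀ q : P, TangentSpace 𝓘(ℝ, EP) q, SmoothField X →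
    ContMDiff 𝓘(ℝ, EP) 𝓘(ℝ, EG) ∞ (M' := EG) (fun q => form q (X q))
  form_fundamental : ∀ q z, form q (B.fundamental q z) = z
  equivariant : ∀ g q v, form (B.act q g) (B.dAct g q v) = Ad EG g⁻¹ (form q v)

namespace Connection

variable {B} [IsManifold 𝓘(ℝ, EP) ∞ P] (A : B.Connection)

/-- The vertical part `AX` of a vector field, as a vector field. -/
def ver (X : ∀ q : P, TangentSpace 𝓘(ℝ, EP) q) (q : P) : TangentSpace 𝓘(ℝ, EP) q :=
  B.fundamental q (A.form q (X q))

/-- The horizontal part `A^⊥X` of a vector field. -/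
def hor (X : ∀ q : P, TangentSpace 𝓘(ℝ, EP) q) (q : P) : TangentSpace 𝓘(ℝ, EP) q :=
  X q - A.ver X q

/-- The curvature `F(X,Y) = -A[A^⊥X, A^⊥Y]`, with values in `𝔤`. -/
def curv (X Y : ∀ q : P, TangentSpace 𝓘(ℝ, EP) q) (q : P) : GroupLieAlgebra 𝓘(ℝ, EG) G :=
  -A.form q (mlieBracket 𝓘(ℝ, EP) (A.hor X) (A.hor Y) q)

/-- `Zh` is the horizontal lift `A^⊥Z` of the vector field `Z` on `M`. -/
def IsHorLift (Z : ∀ x : M, TangentSpace 𝓘(ℝ, EM) x)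
    (Zh : ∀ q : P, TangentSpace 𝓘(ℝ, EP) q) : Prop :=
  B.Projects Zh Z ∧ ∀ q, A.form q (Zh q) = 0

/-- `∇^A_Z(AX) = [A^⊥Z, AX]`, as a function with values in `𝔤`, where `Zh = A^⊥Z`. -/
def covDeriv (Zh X : ∀ q : P, TangentSpace 𝓘(ℝ, EP) q) (q : P) : GroupLieAlgebra 𝓘(ℝ, EG) G :=
  A.form q (mlieBracket 𝓘(ℝ, EP) Zh (A.ver X) q)

end Connection

end PrincipalBundle

end Principal

/-! ### Lifted actions and the reduced Courant algebroid -/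

section Lift

variable {EG : Type*} [NormedAddCommGroup EG] [NormedSpace ℝ EG]
  {G : Type*} [TopologicalSpace G] [ChartedSpace EG G] [Group G]
  {EP : Type*} [NormedAddCommGroup EP] [NormedSpace ℝ EP]
  {P : Type*} [TopologicalSpace P] [ChartedSpace EP P] [IsManifold 𝓘(ℝ, EP) ∞ P]
  {EM : Type*} [NormedAddCommGroup EM] [NormedSpace ℝ EM]
  {M : Type*} [TopologicalSpace M] [ChartedSpace EM M]
  {F : Type*} [NormedAddCommGroup F] [NormedSpace ℝ F]
  {V : P → Type*} [TopologicalSpace (TotalSpace F V)]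
  [∀ q, AddCommGroup (V q)] [∀ q, Module ℝ (V q)] [∀ q, TopologicalSpace (V q)]
  [FiberBundle F V] [VectorBundle ℝ F V]

/-- A lift of the `G`-action on `P` to the Courant algebroid `V`: an algebra morphism
`ρ : 𝔤 → Γ(V)` over the infinitesimal action, such that the infinitesimal action
`z ↦ [ρ(z), ·]` of `𝔤` integrates to a smooth right action `lift` of `G` on `V` by automorphisms of
the Courant algebroid that cover the action on `P`. -/
structure LiftedAction (B : PrincipalBundle EG G EP P EM M) (C : CourantAlgebroid EP F V) where
  rho : GroupLieAlgebra 𝓘(ℝ, EG) G →ₗ[ℝ] Cₛ^∞⟮𝓘(ℝ, EP); F, V⟯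
  rho_lie : ∀ z w, rho ⁅z, w⁆ = C.bracket (rho z) (rho w)
  anchor_rho : ∀ z q, C.anchor q (rho z q) = B.fundamental q z
  lift : ∀ (g : G) (q : P), V q ≃ₗ[ℝ] V (B.act q g)
  lift_one : ∀ q (v : V q),
    (⟨B.act q 1, lift 1 q v⟩ : TotalSpace F V) = ⟨q, v⟩
  lift_mul : ∀ g h q (v : V q),
    (⟨B.act (B.act q g) h, lift h (B.act q g) (lift g q v)⟩ : TotalSpace F V) =
      ⟨B.act q (g * h), lift (g * h) q v⟩
  lift_smooth : ContMDiff ((𝓘(ℝ, EP).prod 𝓘(ℝ, F)).prod 𝓘(ℝ, EG)) (𝓘(ℝ, EP).prod 𝓘(ℝ, F)) ∞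
    (fun a : TotalSpace F V × G => (⟨B.act a.1.1 a.2, lift a.2 a.1.1 a.1.2⟩ : TotalSpace F V))
  lift_anchor : ∀ g q v, C.anchor (B.act q g) (lift g q v) = B.dAct g q (C.anchor q v)
  lift_pairing : ∀ g q v w, C.pairing (B.act q g) (lift g q v) (lift g q w) = C.pairing q v w
  lift_bracket : ∀ g (σ σ' τ τ' : Cₛ^∞⟮𝓘(ℝ, EP); F, V⟯),
    (∀ q, lift g q (σ q) = σ' (B.act q g)) → (∀ q, lift g q (τ q) = τ' (B.act q g)) →
    ∀ q, lift g q (C.bracket σ τ q) = C.bracket σ' τ' (B.act q g)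
  /-- The derivative at `g = 1`, in the direction `z`, of `g ↦ g⁻¹ · σ(q g) ∈ V q` is
  `[ρ(z), σ](q)`; it is tested against all linear forms on the finite-dimensional space `V q`. -/
  integrates : ∀ (z : GroupLieAlgebra 𝓘(ℝ, EG) G) (σ : Cₛ^∞⟮𝓘(ℝ, EP); F, V⟯) (q : P)
    (ℓ : Module.Dual ℝ (V q)),
    mvfderiv 𝓘(ℝ, EG) (fun g : G => ℓ ((lift g q).symm (σ (B.act q g)))) 1 z =
      ℓ (C.bracket (rho z) σ q)

namespace LiftedAction

variable {B : PrincipalBundle EG G EP P EM M} {C : CourantAlgebroid EP F V}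
  (L : LiftedAction B C)

/-- `ρ(Ad(g) z) = g ρ(z)`, where `(g σ)(q) = g⁻¹ · σ(q g)` is the action of `G` on sections. -/
def IsEquivariant : Prop :=
  ∀ (g : G) (z : GroupLieAlgebra 𝓘(ℝ, EG) G) (q : P),
    L.rho (Ad EG g z) q = (L.lift g q).symm (L.rho z (B.act q g))

/-- `s` is a smooth equivariant isotropic splitting `TP → V` of the anchor. -/
def IsEquivariantIsotropicSplitting (s : ∀ q, TangentSpace 𝓘(ℝ, EP) q →ₗ[ℝ] V q) : Prop :=
  (∀ X : ∀ q : P, TangentSpace 𝓘(ℝ, EP) q, SmoothField X →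
    ContMDiff 𝓘(ℝ, EP) (𝓘(ℝ, EP).prod 𝓘(ℝ, F)) ∞
      (fun q => (⟨q, s q (X q)⟩ : TotalSpace F V))) ∧
  (∀ q v, C.anchor q (s q v) = v) ∧
  (∀ q v w, C.pairing q (s q v) (s q w) = 0) ∧
  ∀ g q v, L.lift g q (s q v) = s (B.act q g) (B.dAct g q v)

/-- `c` is the symmetric bilinear form on `𝔤` of the quadratic form `c(z) = -⟨ρ(z), ρ(z)⟩`. -/
def IsQuadraticForm (c : LinearMap.BilinForm ℝ (GroupLieAlgebra 𝓘(ℝ, EG) G)) : Prop :=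
  (∀ z w, c z w = c w z) ∧ ∀ z q, c z z = -C.pairing q (L.rho z q) (L.rho z q)

/-- The fibre at `q` of `K = ρ(𝔤)`. -/
def K (q : P) : Submodule ℝ (V q) where
  carrier := {v | ∃ z, L.rho z q = v}
  add_mem' := by
    rintro _ _ ⟨z, rfl⟩ ⟨w, rfl⟩
    exact ⟨z + w, by simp⟩
  zero_mem' := ⟨0, by simp⟩
  smul_mem' := by
    rintro r _ ⟨z, rfl⟩
    exact ⟨r • z, by simp⟩

/-- The fibre at `q` of the orthogonal `K^⊥` of `K`. -/
def Kperp (q : P) : Submodule ℝ (V q) where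
  carrier := {v | ∀ w ∈ L.K q, C.pairing q v w = 0}
  add_mem' := by
    intro u v hu hv w hw
    simp [hu w hw, hv w hw]
  zero_mem' := by
    intro w _
    simp
  smul_mem' := by
    intro r v hv w hw
    simp [hv w hw]

/-- The fibre over `x` of `S/G`, for a family `S` of subspaces of the fibres of `V`: equivariant
families of elements of `S` along the fibre of `P` over `x`. If `S` is an invariant subbundle,
evaluation at a point `q` of the fibre identifies it with `S q`. -/
def quot (S : ∀ q, Submodule ℝ (V q)) (x : M) : Submodule ℝ (∀ q : B.Fib x, V q.1) where
  carrier := {u | (∀ q, u q ∈ S q.1) ∧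
    ∀ (q : B.Fib x) (g : G), u (B.actFib q g) = L.lift g q.1 (u q)}
  add_mem' := by
    rintro u v ⟨hu, hu'⟩ ⟨hv, hv'⟩
    refine ⟨fun q => (S q.1).add_mem (hu q) (hv q), fun q g => ?_⟩
    simp only [Pi.add_apply, hu' q g, hv' q g, map_add]
    rfl
  zero_mem' := by
    refine ⟨fun q => (S q.1).zero_mem, fun q g => ?_⟩
    simp only [Pi.zero_apply, map_zero]
    rfl
  smul_mem' := by
    rintro r u ⟨hu, hu'⟩
    refine ⟨fun q => (S q.1).smul_mem r (hu q), fun q g => ?_⟩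
    simp only [Pi.smul_apply, hu' q g, map_smul]
    rfl

/-- The fibre over `x` of the reduced bundle `E = (K^⊥ / (K ∩ K^⊥)) / G`, written as
`(K^⊥/G) / ((K ∩ K^⊥)/G)`. -/
abbrev RedFiber (x : M) : Type _ :=
  L.quot L.Kperp x ⧸ (L.quot (fun q => L.K q ⊓ L.Kperp q) x).submoduleOf (L.quot L.Kperp x)

/-- The class in `E` of an element of `K^⊥/G`. -/
abbrev cls {x : M} (u : L.quot L.Kperp x) : L.RedFiber x := Submodule.Quotient.mk u

/-- The smooth section `σ` of `V` is a `G`-invariant section of `K^⊥`, and it induces the section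
`s` of `E`. -/
def Represents (σ : Cₛ^∞⟮𝓘(ℝ, EP); F, V⟯) (s : ∀ x, L.RedFiber x) : Prop :=
  ∀ x, ∃ h : (fun q : B.Fib x => σ q.1) ∈ L.quot L.Kperp x, s x = L.cls ⟨_, h⟩

/-- The smooth sections of `E` are those induced by the smooth `G`-invariant sections of `K^⊥`. -/
def SmoothSection (s : ∀ x, L.RedFiber x) : Prop :=
  ∃ σ, L.Represents σ s

/-- The pairing of `K^⊥`, evaluated at a point `q` of the fibre over `x`. -/
def pairingAux {x : M} (q : B.Fib x) :
    L.quot L.Kperp x →ₗ[ℝ] L.quot L.Kperp x →ₗ[ℝ] ℝ :=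
  LinearMap.mk₂ ℝ (fun u v => C.pairing q.1 (u.1 q) (v.1 q))
    (by intro u u' v; simp) (by intro r u v; simp) (by intro u v v'; simp)
    (by intro r u v; simp)

/-- The pairing of `E` induced by that of `V`, computed at a point `q` of the fibre over `x`. -/
def pairing {x : M} (q : B.Fib x) : L.RedFiber x →ₗ[ℝ] L.RedFiber x →ₗ[ℝ] ℝ :=
  (L.pairingAux q).liftQ₂ _ _
    (by
      intro u hu
      refine LinearMap.mem_ker.2 (LinearMap.ext fun v => ?_)
      have h1 : u.1 q ∈ L.K q.1 ⊓ L.Kperp q.1 := hu.1 q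
      have h2 : v.1 q ∈ L.Kperp q.1 := v.2.1 q
      exact (C.pairing_symm _ _ _).trans (h2 _ h1.1))
    (by
      intro u hu
      refine LinearMap.mem_ker.2 (LinearMap.ext fun v => ?_)
      have h1 : u.1 q ∈ L.K q.1 ⊓ L.Kperp q.1 := hu.1 q
      have h2 : v.1 q ∈ L.Kperp q.1 := v.2.1 q
      exact h2 _ h1.1)

/-- The Dorfman bracket of the smooth sections `s` and `t` of `E` is well defined and equal to `r`:
it is induced by the bracket in `V` of any invariant sections of `K^⊥` that represent `s` and
`t`. -/
def IsBracket (s t r : ∀ x, L.RedFiber x) : Prop :=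
  L.SmoothSection s ∧ L.SmoothSection t ∧
    ∀ σ τ, L.Represents σ s → L.Represents τ t → L.Represents (C.bracket σ τ) r

variable [IsManifold 𝓘(ℝ, EM) ∞ M]

/-- The value at `Z`, at the point `q`, of the `1`-form
`L_{pX}η - i_{pY}dξ + i_{pY}i_{pX}H + 2c(∇^A(AX),AY) + 2c(F(X,·),AY) - 2c(F(Y,·),AX)`,
where `Xm = pX`, `Ym = pY` and `Zh = A^⊥Z`. -/
def dorfmanForm (c : LinearMap.BilinForm ℝ (GroupLieAlgebra 𝓘(ℝ, EG) G)) (A : B.Connection)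
    (H : SmoothForm EM M 3) (X Y Zh : ∀ q : P, TangentSpace 𝓘(ℝ, EP) q)
    (Xm Ym Z : ∀ x : M, TangentSpace 𝓘(ℝ, EM) x)
    (ξ η : ∀ x : M, Module.Dual ℝ (TangentSpace 𝓘(ℝ, EM) x)) (q : P) : ℝ :=
  lieDerivOne Xm η Z (B.proj q) - extDerivOne ξ Ym Z (B.proj q)
    + H.toFun (B.proj q) ![Xm (B.proj q), Ym (B.proj q), Z (B.proj q)]
    + 2 * c (A.covDeriv Zh X q) (A.form q (Y q))
    + 2 * c (A.curv X Zh q) (A.form q (Y q))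
    - 2 * c (A.curv Y Zh q) (A.form q (X q))

/-- The fibrewise linear isomorphism `Φ : TP/G ⊕ T^*M → E` and the `3`-form `H` present the reduced
Courant algebroid in terms of the connection `A`. -/
structure IsPresentation (c : LinearMap.BilinForm ℝ (GroupLieAlgebra 𝓘(ℝ, EG) G))
    (A : B.Connection)
    (Φ : ∀ x, (B.AtiyahFiber x × Module.Dual ℝ (TangentSpace 𝓘(ℝ, EM) x)) ≃ₗ[ℝ] L.RedFiber x)
    (H : SmoothForm EM M 3) : Prop where
  /-- `Φ` is an isomorphism of smooth vector bundles. -/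
  smooth_iff : ∀ (X : ∀ x, B.AtiyahFiber x)
    (ξ : ∀ x : M, Module.Dual ℝ (TangentSpace 𝓘(ℝ, EM) x)),
    L.SmoothSection (fun x => Φ x (X x, ξ x)) ↔ SmoothField (B.field X) ∧ SmoothCovector ξ
  /-- `Φ` is compatible with the natural projection `E → TP/G` induced by the anchor of `V`. -/
  proj : ∀ x X ξ (u : L.quot L.Kperp x), Φ x (X, ξ) = L.cls u →
    ∀ q : B.Fib x, C.anchor q.1 (u.1 q) = X.1 q
  /-- `⟨X + ξ, Y + η⟩ = ½(i_{pX}η + i_{pY}ξ) + c(AX, AY)`. -/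
  pairing_eq : ∀ (q : P) (X Y : B.AtiyahFiber (B.proj q))
    (ξ η : Module.Dual ℝ (TangentSpace 𝓘(ℝ, EM) (B.proj q))),
    L.pairing ⟨q, rfl⟩ (Φ (B.proj q) (X, ξ)) (Φ (B.proj q) (Y, η)) =
      (1 / 2 : ℝ) * (η (B.dProj q (X.1 ⟨q, rfl⟩)) + ξ (B.dProj q (Y.1 ⟨q, rfl⟩)))
        + c (A.form q (X.1 ⟨q, rfl⟩)) (A.form q (Y.1 ⟨q, rfl⟩))
  /-- `[X + ξ, Y + η] = W + ζ`, where `W = [X, Y]` and `ζ` is the `1`-form of `dorfmanForm`. -/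
  bracket_eq : ∀ (X Y : ∀ x, B.AtiyahFiber x)
    (ξ η : ∀ x : M, Module.Dual ℝ (TangentSpace 𝓘(ℝ, EM) x)),
    SmoothField (B.field X) → SmoothField (B.field Y) → SmoothCovector ξ → SmoothCovector η →
    ∃ (W : ∀ x, B.AtiyahFiber x) (ζ : ∀ x : M, Module.Dual ℝ (TangentSpace 𝓘(ℝ, EM) x)),
      (∀ q, B.field W q = mlieBracket 𝓘(ℝ, EP) (B.field X) (B.field Y) q) ∧
      (∀ (Xm Ym Z : ∀ x : M, TangentSpace 𝓘(ℝ, EM) x) (Zh : ∀ q : P, TangentSpace 𝓘(ℝ, EP) q),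
        B.Projects (B.field X) Xm → B.Projects (B.field Y) Ym → SmoothField Z →
        A.IsHorLift Z Zh → ∀ q, ζ (B.proj q) (Z (B.proj q)) =
          dorfmanForm c A H (B.field X) (B.field Y) Zh Xm Ym Z ξ η q) ∧
      L.IsBracket (fun x => Φ x (X x, ξ x)) (fun x => Φ x (Y x, η x))
        (fun x => Φ x (W x, ζ x))

/-- `Φ'` is the composition of `Φ` with the transformation `X + ξ ↦ X + ξ + i_{pX}b`. -/
def IsBTransform
    (Φ' Φ : ∀ x, (B.AtiyahFiber x × Module.Dual ℝ (TangentSpace 𝓘(ℝ, EM) x)) ≃ₗ[ℝ] L.RedFiber x)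
    (b : SmoothForm EM M 2) : Prop :=
  ∀ (q : P) (X : B.AtiyahFiber (B.proj q))
    (ξ ξ' : Module.Dual ℝ (TangentSpace 𝓘(ℝ, EM) (B.proj q))),
    (∀ v, ξ' v = ξ v + b.toFun (B.proj q) ![B.dProj q (X.1 ⟨q, rfl⟩), v]) →
    Φ' (B.proj q) (X, ξ) = Φ (B.proj q) (X, ξ')

end LiftedAction

end Lift

end CourantReduction

end

open CourantReduction

/-! On `K` the pairing is `-c`, which is non-degenerate, so `K ∩ K^⊥ = 0` (`inf_Kperp_eq_bot`). A
section of `E` is therefore the same thing as an invariant section of `K^⊥`, and everything can be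
computed upstairs on `P`.

Existence. The central object is a splitting `λ : TP → K^⊥` of the anchor that is equivariant and
satisfies `⟨λv, λw⟩ = c(Av, Aw)` (`IsAdapted`). It comes from the isotropic splitting `s`: put `u =
s` on horizontal vectors and `u = ρ` on vertical ones, then subtract from `u v` the image under
`π^*` of the covector `⟨u v, ρ(A ·)⟩` (`exists_isAdapted`). An element of `K^⊥` with zero anchor is
`π^*α` with `α` killing vertical vectors, so `X + ξ ↦ λX + ½π^*p^*ξ` identifies `TP/G ⊕ T^*M` with
`K^⊥/G` (`toKperp_bijective`).

For the bracket, an invariant section `σ` satisfies `[ρ(z), σ] = 0`, so invariant sections of `K^⊥`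
are closed under the bracket (`IsInvariantPerp.bracket`), and the covector part of a bracket is read
off by pairing with `λ(A^⊥Z)`. Terms containing a 1-form follow from the Courant axioms alone. In
`⟨[λX, λY], λZ⟩` with `Z` horizontal, split `X` and `Y` into horizontal and vertical parts. If a
vertical field occurs, skew-symmetry moves it to the last slot, where only the Lie bracket of the
other two fields is seen (`pairing_bracket_sec_vertical`); this produces the curvature and covariant
derivative terms. The purely horizontal term defines `H`: it is totally skew and depends pointwise
on its last argument, hence on all three, and it is `G`-invariant, so it descends to `M`
(`tri_congr`, `tri_act`).

Uniqueness and the converse. `Φ⁻¹Φ'` preserves the component in `TP/G`. Preservation of the pairing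
forces its cotangent component to be `ξ + i_{pX}b` with `b` skew (`apply_eq_contract`). The effect
of such a shear on the bracket is governed by `L_X i_Y b - i_Y d i_X b = i_Y i_X db + i_{[X,Y]}b`
(`lieDerivOne_contract_sub`), which gives `H' = H + db` when read on horizontal lifts, and the
converse when read on arbitrary sections. -/

noncomputable section

namespace CourantReduction

open Filter

set_option linter.unusedSectionVars false

/-! ### Extending local sections and frames to global ones -/

section Sections

variable {E : Type*} [NormedAddCommGroup E] [NormedSpace ℝ E] [FiniteDimensional ℝ E]
  {M : Type*} [TopologicalSpace M] [ChartedSpace E M] [IsManifold 𝓘(ℝ, E) ∞ M] [T2Space M]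
  {F : Type*} [NormedAddCommGroup F] [NormedSpace ℝ F]
  {V : M → Type*} [TopologicalSpace (TotalSpace F V)]
  [∀ q, AddCommGroup (V q)] [∀ q, Module ℝ (V q)] [∀ q, TopologicalSpace (V q)]
  [FiberBundle F V] [VectorBundle ℝ F V]

/-- A local smooth section agrees near any given point with a global one. -/
theorem exists_section_eventuallyEq [ContMDiffVectorBundle ∞ F V 𝓘(ℝ, E)] {U : Set M}
    (hU : IsOpen U) {x : M} (hx : x ∈ U) {t : ∀ x, V x}
    (ht : ContMDiffOn 𝓘(ℝ, E) (𝓘(ℝ, E).prod 𝓘(ℝ, F)) ∞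
      (fun x => (⟨x, t x⟩ : TotalSpace F V)) U) :
    ∃ σ : Cₛ^∞⟮𝓘(ℝ, E); F, V⟯, ∀ᶠ y in 𝓝 x, σ y = t y := by
  obtain ⟨ψ, -, hψ⟩ := (SmoothBumpFunction.nhds_basis_tsupport (I := 𝓘(ℝ, E)) x).mem_iff.1
    (hU.mem_nhds hx)
  refine ⟨⟨(ψ : M → ℝ) • t, ContMDiffOn.smul_section_of_tsupport ψ.contMDiff.contMDiffOn hU hψ ht⟩, ?_⟩
  filter_upwards [ψ.eventuallyEq_one] with y hy
  change ψ y • t y = t y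
  rw [hy]
  simp

theorem exists_section_apply_eq [ContMDiffVectorBundle ∞ F V 𝓘(ℝ, E)] {x : M} (v : V x) :
    ∃ σ : Cₛ^∞⟮𝓘(ℝ, E); F, V⟯, σ x = v := by
  obtain ⟨s, hs, h⟩ := FiberBundle.exists_contMDiffOn_extend 𝓘(ℝ, E) F (k := ∞) v
  obtain ⟨U, hUs, hU, hx⟩ := mem_nhds_iff.1 hs
  obtain ⟨σ, hσ⟩ := exists_section_eventuallyEq hU hx (h.mono hUs)
  exact ⟨σ, hσ.self_of_nhds.trans (by simp)⟩

/-- Near every point there is a frame of global smooth sections, in which the coordinates of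
a section are those of a local trivialization. -/
theorem exists_frame [FiniteDimensional ℝ F] [ContMDiffVectorBundle ∞ F V 𝓘(ℝ, E)] (x : M) :
    ∃ τ : Fin (Module.finrank ℝ F) → Cₛ^∞⟮𝓘(ℝ, E); F, V⟯,
      (∀ᶠ y in 𝓝 x, ∀ v : V y,
        v = ∑ i, (Module.finBasis ℝ F).repr (trivializationAt F V x ⟨y, v⟩).2 i • τ i y) ∧
      ∀ᶠ y in 𝓝 x, LinearIndependent ℝ (fun i => τ i y) := by
  set e := trivializationAt F V x
  set b := Module.finBasis ℝ F
  have hx : x ∈ e.baseSet := FiberBundle.mem_baseSet_trivializationAt' x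
  have hfr := e.isLocalFrameOn_localFrame_baseSet 𝓘(ℝ, E) ∞ b
  choose τ hτ using fun i => exists_section_eventuallyEq e.open_baseSet hx (hfr.contMDiffOn i)
  refine ⟨τ, ?_, ?_⟩
  · filter_upwards [eventually_all.2 hτ, e.open_baseSet.mem_nhds hx] with y hy hye v
    simp only [hy]
    have h := (e.basisAt b hye).sum_repr v
    conv_lhs => rw [← h]
    refine Finset.sum_congr rfl fun i _ => ?_
    simp [hye, Trivialization.basisAt, e]
  · filter_upwards [eventually_all.2 hτ, e.open_baseSet.mem_nhds hx] with y hy hye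
    simp only [hy]
    exact hfr.linearIndependent hye

end Sections

/-! ### Vector fields as derivations -/

section Fields

variable {E : Type*} [NormedAddCommGroup E] [NormedSpace ℝ E]
  {M : Type*} [TopologicalSpace M] [ChartedSpace E M]

theorem dirDeriv_const (X : ∀ x : M, TangentSpace 𝓘(ℝ, E) x) (r : ℝ) (x : M) :
    dirDeriv X (fun _ => r) x = 0 := by
  simp [dirDeriv, mvfderiv_const]

theorem dirDeriv_add (X : ∀ x : M, TangentSpace 𝓘(ℝ, E) x) {f g : M → ℝ}
    (hf : ContMDiff 𝓘(ℝ, E) 𝓘(ℝ, ℝ) ∞ f) (hg : ContMDiff 𝓘(ℝ, E) 𝓘(ℝ, ℝ) ∞ g) (x : M) :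
    dirDeriv X (fun y => f y + g y) x = dirDeriv X f x + dirDeriv X g x := by
  have h := mvfderiv_add ((hf x).mdifferentiableAt (by simp)) ((hg x).mdifferentiableAt (by simp))
  exact congrArg (fun T => T (X x)) h

theorem dirDeriv_const_mul (X : ∀ x : M, TangentSpace 𝓘(ℝ, E) x) (r : ℝ) {f : M → ℝ}
    (hf : ContMDiff 𝓘(ℝ, E) 𝓘(ℝ, ℝ) ∞ f) (x : M) :
    dirDeriv X (fun y => r * f y) x = r * dirDeriv X f x := by
  have h := mvfderiv_mul (mdifferentiableAt_const (c := r)) ((hf x).mdifferentiableAt (by simp))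
  have h' := congrArg (fun T => T (X x)) h
  simp only [mvfderiv_const] at h'
  have h'' : dirDeriv X (fun y => r * f y) x = _ := h'
  simpa [dirDeriv] using h''

variable [IsManifold 𝓘(ℝ, E) ∞ M]

theorem SmoothField.contMDiff_dirDeriv {X : ∀ x : M, TangentSpace 𝓘(ℝ, E) x} {f : M → ℝ}
    (hX : SmoothField X) (hf : ContMDiff 𝓘(ℝ, E) 𝓘(ℝ, ℝ) ∞ f) :
    ContMDiff 𝓘(ℝ, E) 𝓘(ℝ, ℝ) ∞ (dirDeriv X f) :=
  (contMDiff_snd_tangentBundle_modelSpace ℝ 𝓘(ℝ, ℝ)).comp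
    ((hf.contMDiff_tangentMap (m := ∞) (by simp)).comp hX)

theorem SmoothField.mlieBracket [FiniteDimensional ℝ E] {X Y : ∀ x : M, TangentSpace 𝓘(ℝ, E) x}
    (hX : SmoothField X) (hY : SmoothField Y) :
    SmoothField (mlieBracket 𝓘(ℝ, E) X Y) := by
  have : CompleteSpace E := FiniteDimensional.complete ℝ E
  have : IsManifold 𝓘(ℝ, E) (minSmoothness ℝ 2) M := by
    simp only [minSmoothness_of_isRCLikeNormedField]
    infer_instance
  have : IsManifold 𝓘(ℝ, E) (((⊤ : ℕ∞) : WithTop ℕ∞) + 1) M :=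
    inferInstanceAs (IsManifold 𝓘(ℝ, E) ∞ M)
  exact fun x => ContMDiffAt.mlieBracket_vectorField (n := ⊤) (m := ⊤) (hX x) (hY x) (by simp)

variable [FiniteDimensional ℝ E] [T2Space M]

theorem exists_smoothField_apply_eq {x : M} (v : TangentSpace 𝓘(ℝ, E) x) :
    ∃ X : ∀ x : M, TangentSpace 𝓘(ℝ, E) x, SmoothField X ∧ X x = v := by
  obtain ⟨σ, hσ⟩ := exists_section_apply_eq (E := E) (F := E) v
  exact ⟨σ, σ.contMDiff, hσ⟩

/-- The Lie bracket of vector fields is their commutator as derivations. -/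
theorem dirDeriv_mlieBracket {X Y : ∀ x : M, TangentSpace 𝓘(ℝ, E) x} {f : M → ℝ}
    (hX : SmoothField X) (hY : SmoothField Y) (hf : ContMDiff 𝓘(ℝ, E) 𝓘(ℝ, ℝ) ∞ f) (x : M) :
    dirDeriv (mlieBracket 𝓘(ℝ, E) X Y) f x =
      dirDeriv X (dirDeriv Y f) x - dirDeriv Y (dirDeriv X f) x := by
  have : CompleteSpace E := FiniteDimensional.complete ℝ E
  have h2 : IsManifold 𝓘(ℝ, E) (minSmoothness ℝ 3) M := by
    simp only [minSmoothness_of_isRCLikeNormedField]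
    infer_instance
  -- The argument below needs a field that does not vanish at `x`, so the zero-dimensional case is
  -- separate.
  rcases subsingleton_or_nontrivial (TangentSpace 𝓘(ℝ, E) x) with hs | hs
  · have hz : ∀ v : TangentSpace 𝓘(ℝ, E) x, v = 0 := fun v => Subsingleton.elim _ _
    simp only [dirDeriv]
    rw [hz (X x), hz (Y x), hz (VectorField.mlieBracket _ X Y x)]
    simp
  obtain ⟨w, hw⟩ := exists_ne (0 : TangentSpace 𝓘(ℝ, E) x)
  obtain ⟨Z, hZ, hZx⟩ := exists_smoothField_apply_eq w
  have hd : ∀ {T : ∀ x : M, TangentSpace 𝓘(ℝ, E) x}, SmoothField T → ∀ y,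
      MDifferentiableAt 𝓘(ℝ, E) 𝓘(ℝ, E).tangent
        (fun x => (⟨x, T x⟩ : TangentBundle 𝓘(ℝ, E) M)) y :=
    fun hT y => (hT y).mdifferentiableAt (by simp)
  have hdf : ∀ {g : M → ℝ}, ContMDiff 𝓘(ℝ, E) 𝓘(ℝ, ℝ) ∞ g → ∀ y,
      MDifferentiableAt 𝓘(ℝ, E) 𝓘(ℝ, ℝ) g y := fun hg y => (hg y).mdifferentiableAt (by simp)
  have hsm : ∀ {g : M → ℝ} {T : ∀ x : M, TangentSpace 𝓘(ℝ, E) x},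
      ContMDiff 𝓘(ℝ, E) 𝓘(ℝ, ℝ) ∞ g → SmoothField T → SmoothField (g • T) :=
    fun hg hT => ContMDiff.smul_section hg hT
  have hfZ := hsm hf hZ
  have hc : ∀ {T : ∀ x : M, TangentSpace 𝓘(ℝ, E) x}, SmoothField T →
      ContMDiffAt 𝓘(ℝ, E) 𝓘(ℝ, E).tangent (minSmoothness ℝ 2)
        (fun x => (⟨x, T x⟩ : TangentBundle 𝓘(ℝ, E) M)) x := fun hT => by
    simp only [minSmoothness_of_isRCLikeNormedField]
    exact (hT x).of_le (WithTop.coe_le_coe.2 le_top)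
  -- Expand the Jacobi identity for `X`, `Y`, `f • Z` and subtract `f` times the one for `X`, `Y`,
  -- `Z`: all that survives is the desired identity of derivatives of `f`, multiplied by `Z x ≠ 0`.
  have key : ∀ {S T : ∀ x : M, TangentSpace 𝓘(ℝ, E) x}, SmoothField S → SmoothField T →
      VectorField.mlieBracket 𝓘(ℝ, E) S (VectorField.mlieBracket 𝓘(ℝ, E) T (f • Z)) x =
        dirDeriv S (dirDeriv T f) x • Z x
        + dirDeriv T f x • VectorField.mlieBracket 𝓘(ℝ, E) S Z x
        + (dirDeriv S f x • VectorField.mlieBracket 𝓘(ℝ, E) T Z x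
          + f x • VectorField.mlieBracket 𝓘(ℝ, E) S (VectorField.mlieBracket 𝓘(ℝ, E) T Z) x) := by
    intro S T hS hT
    have h1 : VectorField.mlieBracket 𝓘(ℝ, E) T (f • Z) =
        dirDeriv T f • Z + f • VectorField.mlieBracket 𝓘(ℝ, E) T Z := by
      funext y
      exact mlieBracket_smul_right (hdf hf y) (hd hZ y)
    rw [h1, mlieBracket_add_right (hd (hsm (hT.contMDiff_dirDeriv hf) hZ) x)
      (hd (hsm hf (hT.mlieBracket hZ)) x),
      mlieBracket_smul_right (hdf (hT.contMDiff_dirDeriv hf) x) (hd hZ x),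
      mlieBracket_smul_right (hdf hf x) (hd (hT.mlieBracket hZ) x)]
    rfl
  have hJ := leibniz_identity_mlieBracket_apply (hc hX) (hc hY) (hc hfZ)
  have hJ' := leibniz_identity_mlieBracket_apply (hc hX) (hc hY) (hc hZ)
  rw [key hX hY, key hY hX, hJ', mlieBracket_smul_right (hdf hf x) (hd hZ x)] at hJ
  change _ = dirDeriv (VectorField.mlieBracket 𝓘(ℝ, E) X Y) f x • Z x + _ + _ at hJ
  have h0 : (dirDeriv (VectorField.mlieBracket 𝓘(ℝ, E) X Y) f x -
      (dirDeriv X (dirDeriv Y f) x - dirDeriv Y (dirDeriv X f) x)) • Z x = 0 := by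
    linear_combination (norm := module) (-1 : ℝ) • hJ
  rcases smul_eq_zero.1 h0 with h | h
  · linarith
  · exact absurd (hZx.symm.trans h) hw

/-- Tangent vectors are separated by the derivatives of smooth functions. -/
theorem eq_of_forall_mvfderiv_eq {x : M} {v w : TangentSpace 𝓘(ℝ, E) x}
    (h : ∀ f : M → ℝ, ContMDiff 𝓘(ℝ, E) 𝓘(ℝ, ℝ) ∞ f →
      mvfderiv 𝓘(ℝ, E) f x v = mvfderiv 𝓘(ℝ, E) f x w) : v = w := by
  obtain ⟨ψ, -, -⟩ := (SmoothBumpFunction.nhds_basis_tsupport (I := 𝓘(ℝ, E)) x).mem_iff.1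
    univ_mem
  have hinv := isInvertible_mfderiv_extChartAt (I := 𝓘(ℝ, E)) (mem_extChartAt_source (I := 𝓘(ℝ, E)) x)
  refine hinv.injective ?_
  refine (Module.finBasis ℝ E).ext_elem fun i => ?_
  -- The test functions are chart coordinates, made global by a bump function equal to `1` near `x`,
  -- which does not affect the derivative at `x`.
  let ℓ : E →L[ℝ] ℝ := ((Module.finBasis ℝ E).coord i).toContinuousLinearMap
  have hχ : ContMDiffOn 𝓘(ℝ, E) 𝓘(ℝ, ℝ) ∞ (fun y => ℓ (extChartAt 𝓘(ℝ, E) x y))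
      (chartAt E x).source :=
    ℓ.contDiff.contMDiff.comp_contMDiffOn contMDiffOn_extChartAt
  have hsm := ψ.contMDiff_smul hχ
  have hev : (fun y => ψ y • ℓ (extChartAt 𝓘(ℝ, E) x y)) =ᶠ[𝓝 x]
      (ℓ ∘ extChartAt 𝓘(ℝ, E) x) := by
    filter_upwards [ψ.eventuallyEq_one] with y hy
    simp [hy]
  have hd : ∀ u : TangentSpace 𝓘(ℝ, E) x,
      mvfderiv 𝓘(ℝ, E) (fun y => ψ y • ℓ (extChartAt 𝓘(ℝ, E) x y)) x u =
      ℓ (mfderiv 𝓘(ℝ, E) 𝓘(ℝ, E) (extChartAt 𝓘(ℝ, E) x) x u) := by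
    intro u
    have h1 : mfderiv 𝓘(ℝ, E) 𝓘(ℝ, ℝ) (ℓ ∘ extChartAt 𝓘(ℝ, E) x) x u =
        ℓ (mfderiv 𝓘(ℝ, E) 𝓘(ℝ, E) (extChartAt 𝓘(ℝ, E) x) x u) := by
      rw [mfderiv_comp_apply x (ℓ.mdifferentiableAt)
        (mdifferentiableAt_extChartAt (ChartedSpace.mem_chart_source x)), ℓ.mfderiv_eq]
      rfl
    rw [← h1, ← hev.mfderiv_eq]
    rfl
  have := h _ hsm
  rw [hd, hd] at this
  exact this

end Fields

/-! ### Vector fields related by a smooth map -/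

section Related

variable {E : Type*} [NormedAddCommGroup E] [NormedSpace ℝ E]
  {M : Type*} [TopologicalSpace M] [ChartedSpace E M]
  {E' : Type*} [NormedAddCommGroup E'] [NormedSpace ℝ E']
  {N : Type*} [TopologicalSpace N] [ChartedSpace E' N]

theorem dirDeriv_comp {p : M → N} (hp : ContMDiff 𝓘(ℝ, E) 𝓘(ℝ, E') ∞ p)
    {X : ∀ x : M, TangentSpace 𝓘(ℝ, E) x} {X' : ∀ x : N, TangentSpace 𝓘(ℝ, E') x}
    {f : N → ℝ} (hf : ContMDiff 𝓘(ℝ, E') 𝓘(ℝ, ℝ) ∞ f) {x : M}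
    (h : mfderiv 𝓘(ℝ, E) 𝓘(ℝ, E') p x (X x) = X' (p x)) :
    dirDeriv X (fun y => f (p y)) x = dirDeriv X' f (p x) := by
  have := mvfderiv_comp_apply x ((hf (p x)).mdifferentiableAt (by simp))
    ((hp x).mdifferentiableAt (by simp)) (X x)
  rw [h] at this
  exact this

variable [FiniteDimensional ℝ E] [IsManifold 𝓘(ℝ, E) ∞ M] [T2Space M]
  [FiniteDimensional ℝ E'] [IsManifold 𝓘(ℝ, E') ∞ N] [T2Space N]

/-- The Lie brackets of related vector fields are related. -/
theorem mfderiv_mlieBracket_of_related {p : M → N} (hp : ContMDiff 𝓘(ℝ, E) 𝓘(ℝ, E') ∞ p)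
    {X Y : ∀ x : M, TangentSpace 𝓘(ℝ, E) x} {X' Y' : ∀ x : N, TangentSpace 𝓘(ℝ, E') x}
    (hX : SmoothField X) (hY : SmoothField Y) (hX' : SmoothField X') (hY' : SmoothField Y')
    (hXX' : ∀ x, mfderiv 𝓘(ℝ, E) 𝓘(ℝ, E') p x (X x) = X' (p x))
    (hYY' : ∀ x, mfderiv 𝓘(ℝ, E) 𝓘(ℝ, E') p x (Y x) = Y' (p x)) (x : M) :
    mfderiv 𝓘(ℝ, E) 𝓘(ℝ, E') p x (mlieBracket 𝓘(ℝ, E) X Y x) =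
      mlieBracket 𝓘(ℝ, E') X' Y' (p x) := by
  -- Tested on functions, the claim becomes the chain rule applied to the commutator of derivations.
  refine eq_of_forall_mvfderiv_eq fun f hf => ?_
  have h1 : mvfderiv 𝓘(ℝ, E') f (p x)
      (mfderiv 𝓘(ℝ, E) 𝓘(ℝ, E') p x (mlieBracket 𝓘(ℝ, E) X Y x)) =
      dirDeriv (mlieBracket 𝓘(ℝ, E) X Y) (fun y => f (p y)) x :=
    (mvfderiv_comp_apply x ((hf (p x)).mdifferentiableAt (by simp))
      ((hp x).mdifferentiableAt (by simp)) _).symm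
  have h2 := dirDeriv_mlieBracket hX hY (hf.comp hp) x
  have eX : dirDeriv X (f ∘ p) = fun y => dirDeriv X' f (p y) :=
    funext fun y => dirDeriv_comp hp hf (hXX' y)
  have eY : dirDeriv Y (f ∘ p) = fun y => dirDeriv Y' f (p y) :=
    funext fun y => dirDeriv_comp hp hf (hYY' y)
  rw [eX, eY, dirDeriv_comp hp (hY'.contMDiff_dirDeriv hf) (hXX' x),
    dirDeriv_comp hp (hX'.contMDiff_dirDeriv hf) (hYY' x),
    ← dirDeriv_mlieBracket hX' hY' hf] at h2
  exact h1.trans h2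

end Related

/-! ### Smoothness tested by the pairing -/

section Gram

variable {E : Type*} [NormedAddCommGroup E] [NormedSpace ℝ E]
  {M : Type*} [TopologicalSpace M] [ChartedSpace E M]

theorem contMDiffAt_det {n : Type*} [Fintype n] [DecidableEq n] {A : M → Matrix n n ℝ} {x : M}
    (hA : ∀ i j, ContMDiffAt 𝓘(ℝ, E) 𝓘(ℝ, ℝ) ∞ (fun y => A y i j) x) :
    ContMDiffAt 𝓘(ℝ, E) 𝓘(ℝ, ℝ) ∞ (fun y => (A y).det) x := by
  simp only [Matrix.det_apply']
  exact ContMDiffAt.sum fun σ _ => contMDiffAt_const.mul (ContMDiffAt.prod fun i _ => hA _ _)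

/-- Cramer's rule: the entries are minors divided by a determinant that does not vanish at `x`. -/
theorem contMDiffAt_nonsing_inv {n : Type*} [Fintype n] [DecidableEq n] {A : M → Matrix n n ℝ}
    {x : M} (hA : ∀ i j, ContMDiffAt 𝓘(ℝ, E) 𝓘(ℝ, ℝ) ∞ (fun y => A y i j) x)
    (hx : (A x).det ≠ 0) (i j : n) :
    ContMDiffAt 𝓘(ℝ, E) 𝓘(ℝ, ℝ) ∞ (fun y => (A y)⁻¹ i j) x := by
  simp only [Matrix.inv_def, Matrix.smul_apply, Ring.inverse_eq_inv', Matrix.adjugate_apply,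
    smul_eq_mul]
  refine ((contMDiffAt_det hA).inv₀ hx).mul (contMDiffAt_det fun k l => ?_)
  by_cases hk : k = j
  · subst hk
    simpa using contMDiffAt_const
  · simpa [Matrix.updateRow_ne hk] using hA k l

variable [FiniteDimensional ℝ E] [IsManifold 𝓘(ℝ, E) ∞ M] [T2Space M]
  {F : Type*} [NormedAddCommGroup F] [NormedSpace ℝ F] [FiniteDimensional ℝ F]
  {V : M → Type*} [TopologicalSpace (TotalSpace F V)]
  [∀ q, AddCommGroup (V q)] [∀ q, Module ℝ (V q)] [∀ q, TopologicalSpace (V q)]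
  [FiberBundle F V] [VectorBundle ℝ F V] [ContMDiffVectorBundle ∞ F V 𝓘(ℝ, E)]

/-- A section whose pairing with every smooth section is smooth is smooth. -/
theorem CourantAlgebroid.contMDiff_of_pairing (C : CourantAlgebroid E F V) {s : ∀ q, V q}
    (hs : ∀ τ : Cₛ^∞⟮𝓘(ℝ, E); F, V⟯,
      ContMDiff 𝓘(ℝ, E) 𝓘(ℝ, ℝ) ∞ (fun q => C.pairing q (s q) (τ q))) :
    ContMDiff 𝓘(ℝ, E) (𝓘(ℝ, E).prod 𝓘(ℝ, F)) ∞ (fun q => (⟨q, s q⟩ : TotalSpace F V)) := by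
  intro x
  obtain ⟨τ, hτ, hli⟩ := exists_frame (E := E) (F := F) (V := V) x
  -- `A` is the Gram matrix of a local frame and `r` the row of pairings of `s` with it.
  -- Non-degeneracy makes `A` invertible near `x`, so the coordinates of `s` are `r A⁻¹`, which is
  -- smooth.
  let A : M → Matrix _ _ ℝ := fun q => Matrix.of fun i j => C.pairing q (τ i q) (τ j q)
  let r : M → _ → ℝ := fun q j => C.pairing q (s q) (τ j q)
  have hA : ∀ i j, ContMDiffAt 𝓘(ℝ, E) 𝓘(ℝ, ℝ) ∞ (fun y => A y i j) x :=
    fun i j => C.pairing_smooth (τ i) (τ j) x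
  have hdet : (A x).det ≠ 0 := by
    intro h0
    obtain ⟨v, hv, hvA⟩ := Matrix.exists_vecMul_eq_zero_iff.2 h0
    refine hv (funext fun i => ?_)
    refine Fintype.linearIndependent_iff.1 hli.self_of_nhds v ?_ i
    refine C.pairing_nondegenerate x _ fun w => ?_
    rw [hτ.self_of_nhds w, map_sum]
    refine Finset.sum_eq_zero fun j _ => ?_
    have h := congrFun hvA j
    simp only [Matrix.vecMul, dotProduct, A, Matrix.of_apply, Pi.zero_apply] at h
    rw [map_smul, map_sum, LinearMap.sum_apply]
    simp only [map_smul, LinearMap.smul_apply, smul_eq_mul]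
    rw [h, mul_zero]
  have hev : ∀ᶠ y in 𝓝 x, (A y).det ≠ 0 :=
    (contMDiffAt_det hA).continuousAt.eventually_ne hdet
  have hco : ContMDiffAt 𝓘(ℝ, E) (𝓘(ℝ, E).prod 𝓘(ℝ, F)) ∞
      (fun q => (⟨q, ∑ i, (Matrix.vecMul (r q) (A q)⁻¹) i • τ i q⟩ : TotalSpace F V)) x := by
    refine ContMDiffAt.sum_section fun i _ => ContMDiffAt.smul_section ?_ (τ i).contMDiff.contMDiffAt
    simp only [Matrix.vecMul, dotProduct]
    exact ContMDiffAt.sum fun j _ => (hs (τ j) x).mul (contMDiffAt_nonsing_inv hA hdet j i)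
  refine hco.congr_of_eventuallyEq ?_
  filter_upwards [hτ, hev] with y hy hyd
  have h1 : r y = Matrix.vecMul
      (fun i => (Module.finBasis ℝ F).repr (trivializationAt F V x ⟨y, s y⟩).2 i) (A y) := by
    funext j
    simp only [Matrix.vecMul, dotProduct, A, Matrix.of_apply, r]
    conv_lhs => rw [hy (s y)]
    rw [map_sum, LinearMap.sum_apply]
    simp
  rw [h1, Matrix.vecMul_vecMul, Matrix.mul_nonsing_inv _ (Ne.isUnit hyd), Matrix.vecMul_one]
  exact congrArg (TotalSpace.mk y) (hy (s y))

end Gram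

/-! ### Geometry of the principal bundle -/

section Principal

variable {EG : Type*} [NormedAddCommGroup EG] [NormedSpace ℝ EG]
  {G : Type*} [TopologicalSpace G] [ChartedSpace EG G] [Group G] [LieGroup 𝓘(ℝ, EG) ∞ G]
  {EP : Type*} [NormedAddCommGroup EP] [NormedSpace ℝ EP]
  {P : Type*} [TopologicalSpace P] [ChartedSpace EP P] [IsManifold 𝓘(ℝ, EP) ∞ P]
  {EM : Type*} [NormedAddCommGroup EM] [NormedSpace ℝ EM]
  {M : Type*} [TopologicalSpace M] [ChartedSpace EM M] [IsManifold 𝓘(ℝ, EM) ∞ M]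

theorem Ad_Ad_inv (g : G) (z : GroupLieAlgebra 𝓘(ℝ, EG) G) : Ad EG g (Ad EG g⁻¹ z) = z := by
  have hd : ∀ (g : G) (h : G), MDifferentiableAt 𝓘(ℝ, EG) 𝓘(ℝ, EG) (fun h : G => g * h * g⁻¹) h :=
    fun g h => (((contMDiff_mul_left (I := 𝓘(ℝ, EG)) (n := ∞) (a := g)).mul
      contMDiff_const) h).mdifferentiableAt (by simp)
  have h := mfderiv_comp_apply_of_eq (I := 𝓘(ℝ, EG)) (I' := 𝓘(ℝ, EG)) (I'' := 𝓘(ℝ, EG))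
    (1 : G) (hd g 1) (hd g⁻¹ 1) (by simp) z
  have e : (fun h : G => g * h * g⁻¹) ∘ (fun h : G => g⁻¹ * h * g⁻¹⁻¹) = id := by
    funext h
    simp [mul_assoc]
  rw [e, mfderiv_id] at h
  exact h.symm

namespace PrincipalBundle

variable (B : PrincipalBundle EG G EP P EM M)

theorem proj_surjective : Function.Surjective B.proj := by
  intro x
  obtain ⟨U, φ, -, hx, hs, ht, -, -, h⟩ := B.locally_trivial x
  have hm : (x, (1 : G)) ∈ φ.target := by simp [ht, hx]
  exact ⟨φ.symm (x, 1), by rw [← (h _ (φ.map_target hm)).1, φ.right_inv hm]⟩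

theorem nonempty_fib (x : M) : Nonempty (B.Fib x) :=
  let ⟨q, hq⟩ := B.proj_surjective x
  ⟨⟨q, hq⟩⟩

theorem exists_act_eq {q q' : P} (hq : B.proj q = B.proj q') : ∃ g, B.act q g = q' := by
  obtain ⟨U, φ, -, hx, hs, ht, -, -, h⟩ := B.locally_trivial (B.proj q)
  have h1 : q ∈ φ.source := by simpa [hs] using hx
  have h2 : q' ∈ φ.source := by simpa [hs, ← hq] using hx
  refine ⟨(φ q).2⁻¹ * (φ q').2, ?_⟩
  have h3 : B.act q ((φ q).2⁻¹ * (φ q').2) ∈ φ.source := by simpa [hs, B.proj_act] using hx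
  refine φ.injOn h3 h2 (Prod.ext ?_ ?_)
  · rw [(h _ h3).1, (h _ h2).1, B.proj_act, hq]
  · rw [(h _ h1).2]
    simp

theorem contMDiff_act_right (g : G) : ContMDiff 𝓘(ℝ, EP) 𝓘(ℝ, EP) ∞ (fun q => B.act q g) :=
  B.contMDiff_act.comp (contMDiff_id.prodMk contMDiff_const)

theorem contMDiff_act_left (q : P) : ContMDiff 𝓘(ℝ, EG) 𝓘(ℝ, EP) ∞ (fun g => B.act q g) :=
  B.contMDiff_act.comp (contMDiff_const.prodMk contMDiff_id)

theorem mdifferentiableAt_proj (q : P) : MDifferentiableAt 𝓘(ℝ, EP) 𝓘(ℝ, EM) B.proj q :=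
  (B.contMDiff_proj q).mdifferentiableAt (by simp)

theorem dProj_dAct (g : G) (q : P) (v : TangentSpace 𝓘(ℝ, EP) q) :
    (B.dProj (B.act q g) (B.dAct g q v) : EM) = B.dProj q v := by
  have h := mfderiv_comp_apply (I := 𝓘(ℝ, EP)) (I' := 𝓘(ℝ, EP)) (I'' := 𝓘(ℝ, EM)) q
    (B.mdifferentiableAt_proj (B.act q g))
    ((B.contMDiff_act_right g q).mdifferentiableAt (by simp)) v
  have e : B.proj ∘ (fun q => B.act q g) = B.proj := funext fun q => B.proj_act q g
  rw [e] at h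
  exact h.symm

theorem dProj_fundamental (q : P) (z : GroupLieAlgebra 𝓘(ℝ, EG) G) :
    B.dProj q (B.fundamental q z) = 0 := by
  have h := mfderiv_comp_apply_of_eq (I := 𝓘(ℝ, EG)) (I' := 𝓘(ℝ, EP)) (I'' := 𝓘(ℝ, EM)) (1 : G)
    (B.mdifferentiableAt_proj q)
    ((B.contMDiff_act_left q 1).mdifferentiableAt (by simp)) (B.act_one q) z
  have e : B.proj ∘ (fun g => B.act q g) = fun _ => B.proj q := funext fun g => B.proj_act q g
  rw [e, mfderiv_const] at h
  exact h.symm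

/-- The vertical vectors are the values of the fundamental vector fields. -/
theorem exists_fundamental_eq {q : P} {v : TangentSpace 𝓘(ℝ, EP) q} (hv : B.dProj q v = 0) :
    ∃ z, B.fundamental q z = v := by
  obtain ⟨U, φ, hU, hx, hs, ht, hφ, hφ', h⟩ := B.locally_trivial (B.proj q)
  have hq : q ∈ φ.source := by simpa [hs] using hx
  have hdφ : MDifferentiableAt 𝓘(ℝ, EP) (𝓘(ℝ, EM).prod 𝓘(ℝ, EG)) φ q :=
    (hφ.contMDiffAt (φ.open_source.mem_nhds hq)).mdifferentiableAt (by simp)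
  have hd2 : MDifferentiableAt 𝓘(ℝ, EP) 𝓘(ℝ, EG) (fun q' => (φ q').2) q :=
    mdifferentiableAt_snd.comp q hdφ
  have hdφ' : MDifferentiableAt (𝓘(ℝ, EM).prod 𝓘(ℝ, EG)) 𝓘(ℝ, EP) φ.symm
      (B.proj q, (φ q).2) := by
    refine (hφ'.contMDiffAt (φ.open_target.mem_nhds ?_)).mdifferentiableAt (by simp)
    simp [ht, hx]
  have hdm : MDifferentiableAt 𝓘(ℝ, EP) 𝓘(ℝ, EG) (fun q' => (φ q).2⁻¹ * (φ q').2) q :=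
    ((contMDiff_mul_left (I := 𝓘(ℝ, EG)) (n := ∞) (a := (φ q).2⁻¹)
      (φ q).2).mdifferentiableAt (by simp)).comp q hd2
  -- In a trivialization the base coordinate does not move along `v`, so it may be frozen. With `f =
  -- B.proj` the composite is the identity near `q`, and with `f` constant it is `q' ↦ q · (φ(q)₂⁻¹
  -- φ(q')₂)`. Equal derivatives along `v` exhibit `v` as a fundamental vector.
  have key : ∀ f : P → M, MDifferentiableAt 𝓘(ℝ, EP) 𝓘(ℝ, EM) f q → (hf : f q = B.proj q) →
      (mfderiv 𝓘(ℝ, EP) 𝓘(ℝ, EM) f q v : EM) = 0 →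
      (mfderiv 𝓘(ℝ, EP) 𝓘(ℝ, EP) (φ.symm ∘ fun q' => (f q', (φ q').2)) q v : EP) =
      mfderiv (𝓘(ℝ, EM).prod 𝓘(ℝ, EG)) 𝓘(ℝ, EP) φ.symm (B.proj q, (φ q).2)
        ((0 : EM), (mfderiv 𝓘(ℝ, EP) 𝓘(ℝ, EG) (fun q' => (φ q').2) q v : EG)) := by
    intro f hf hfq hfv
    have h1 := mfderiv_comp_apply_of_eq (I := 𝓘(ℝ, EP)) (I' := 𝓘(ℝ, EM).prod 𝓘(ℝ, EG))
      (I'' := 𝓘(ℝ, EP)) q hdφ' (hf.prodMk hd2) (Prod.ext hfq rfl) v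
    refine h1.trans ?_
    rw [mfderiv_prodMk hf hd2]
    refine congrArg _ ?_
    exact Prod.ext hfv rfl
  have k1 := key B.proj (B.mdifferentiableAt_proj q) rfl hv
  have k2 := key (fun _ => B.proj q) mdifferentiableAt_const rfl
    (by rw [mfderiv_const]; rfl)
  have e1 : (φ.symm ∘ fun q' => (B.proj q', (φ q').2)) =ᶠ[𝓝 q] id := by
    filter_upwards [φ.open_source.mem_nhds hq] with q' hq'
    have : (B.proj q', (φ q').2) = φ q' := Prod.ext (h q' hq').1.symm rfl
    simp [this, φ.left_inv hq']
  have e2 : (φ.symm ∘ fun q' => (B.proj q, (φ q').2)) =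
      (fun g => B.act q g) ∘ fun q' => (φ q).2⁻¹ * (φ q').2 := by
    funext q'
    have hm : B.act q ((φ q).2⁻¹ * (φ q').2) ∈ φ.source := by simpa [hs, B.proj_act] using hx
    have : (B.proj q, (φ q').2) = φ (B.act q ((φ q).2⁻¹ * (φ q').2)) := by
      refine Prod.ext ?_ ?_
      · rw [(h _ hm).1, B.proj_act]
      · rw [(h _ hq).2]
        simp
    simp [this, φ.left_inv hm]
  refine ⟨mfderiv 𝓘(ℝ, EP) 𝓘(ℝ, EG) (fun q' => (φ q).2⁻¹ * (φ q').2) q v, ?_⟩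
  have k3 := mfderiv_comp_apply_of_eq (I := 𝓘(ℝ, EP)) (I' := 𝓘(ℝ, EG))
      (I'' := 𝓘(ℝ, EP)) q ((B.contMDiff_act_left q 1).mdifferentiableAt (by simp)) hdm
      (by simp) v
  rw [e2] at k2
  rw [e1.mfderiv_eq, mfderiv_id] at k1
  exact k3.symm.trans (k2.trans k1.symm)

/-- Every smooth vector field on the base has local smooth lifts. -/
theorem exists_local_lift {Z : ∀ x : M, TangentSpace 𝓘(ℝ, EM) x} (hZ : SmoothField Z) (q : P) :
    ∃ (W : Set P) (T : ∀ q : P, TangentSpace 𝓘(ℝ, EP) q), IsOpen W ∧ q ∈ W ∧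
      ContMDiffOn 𝓘(ℝ, EP) 𝓘(ℝ, EP).tangent ∞
        (fun q => (⟨q, T q⟩ : TangentBundle 𝓘(ℝ, EP) P)) W ∧
      ∀ q ∈ W, B.dProj q (T q) = Z (B.proj q) := by
  obtain ⟨U, φ, hU, hx, hs, ht, hφ, hφ', h⟩ := B.locally_trivial (B.proj q)
  -- The lift is the field `(Z, 0)` on `M × G`, transported by the trivialization.
  let w : ∀ q : P, TangentSpace (𝓘(ℝ, EM).prod 𝓘(ℝ, EG)) (φ q) :=
    fun q => ((Z (B.proj q) : EM), (0 : EG))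
  refine ⟨φ.source, fun q => (mfderiv (𝓘(ℝ, EM).prod 𝓘(ℝ, EG)) 𝓘(ℝ, EP) φ.symm (φ q) (w q) : EP),
    φ.open_source, by simpa [hs] using hx, ?_, ?_⟩
  · have h1 : ContMDiffOn 𝓘(ℝ, EP) (𝓘(ℝ, EM).prod 𝓘(ℝ, EG)).tangent ∞
        (fun q => (⟨φ q, w q⟩ : TangentBundle (𝓘(ℝ, EM).prod 𝓘(ℝ, EG)) (M × G))) φ.source := by
      have hz : ContMDiff 𝓘(ℝ, EG) 𝓘(ℝ, EG).tangent ∞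
          (zeroSection EG (TangentSpace 𝓘(ℝ, EG) : G → Type _)) := contMDiff_zeroSection ℝ _
      have h2 := (contMDiff_equivTangentBundleProd_symm (I := 𝓘(ℝ, EM)) (M := M)
        (I' := 𝓘(ℝ, EG)) (M' := G) (n := ∞)).comp_contMDiffOn
        (((hZ.comp B.contMDiff_proj).contMDiffOn (s := φ.source)).prodMk
          (hz.comp_contMDiffOn (contMDiff_snd.comp_contMDiffOn hφ)))
      refine h2.congr fun q' hq' => ?_
      have : φ q' = (B.proj q', (φ q').2) := Prod.ext (h q' hq').1 rfl
      change (⟨φ q', (Z (B.proj q'), 0)⟩ : TotalSpace (EM × EG) fun _ : M × G => EM × EG) =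
        ⟨(B.proj q', (φ q').2), (Z (B.proj q'), 0)⟩
      rw [← this]
    have h3 := (hφ'.contMDiffOn_tangentMapWithin (m := ∞) (by simp)
      φ.open_target.uniqueMDiffOn).comp h1 (fun q' hq' => φ.map_source hq')
    refine h3.congr fun q' hq' => ?_
    change (⟨q', (mfderiv (𝓘(ℝ, EM).prod 𝓘(ℝ, EG)) 𝓘(ℝ, EP) φ.symm (φ q') (w q') : EP)⟩ :
      TotalSpace EP fun _ : P => EP) = ⟨φ.symm (φ q'), (mfderivWithin (𝓘(ℝ, EM).prod 𝓘(ℝ, EG))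
        𝓘(ℝ, EP) φ.symm φ.target (φ q') (w q') : EP)⟩
    rw [mfderivWithin_of_isOpen φ.open_target (φ.map_source hq')]
    rw [φ.left_inv hq']
  · intro q' hq'
    have hd : MDifferentiableAt (𝓘(ℝ, EM).prod 𝓘(ℝ, EG)) 𝓘(ℝ, EP) φ.symm (φ q') :=
      (hφ'.contMDiffAt (φ.open_target.mem_nhds (φ.map_source hq'))).mdifferentiableAt (by simp)
    have h1 := mfderiv_comp_apply_of_eq (I := 𝓘(ℝ, EM).prod 𝓘(ℝ, EG)) (I' := 𝓘(ℝ, EP))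
      (I'' := 𝓘(ℝ, EM)) (φ q') (B.mdifferentiableAt_proj q') hd (φ.left_inv hq') (w q')
    have e : B.proj ∘ φ.symm =ᶠ[𝓝 (φ q')] Prod.fst := by
      filter_upwards [φ.open_target.mem_nhds (φ.map_source hq')] with a ha
      rw [Function.comp_apply, ← (h _ (φ.map_target ha)).1, φ.right_inv ha]
    rw [e.mfderiv_eq, mfderiv_fst] at h1
    exact h1.symm

/-- Through every point of a fibre passes a local smooth section. -/
theorem exists_local_section (x : M) : ∃ (U : Set M) (s : M → P), IsOpen U ∧ x ∈ U ∧
    ContMDiffOn 𝓘(ℝ, EM) 𝓘(ℝ, EP) ∞ s U ∧ ∀ y ∈ U, B.proj (s y) = y := by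
  obtain ⟨U, φ, hU, hx, hs, ht, hφ, hφ', h⟩ := B.locally_trivial x
  refine ⟨U, fun y => φ.symm (y, 1), hU, hx, ?_, fun y hy => ?_⟩
  · exact hφ'.comp (contMDiff_id.prodMk contMDiff_const).contMDiffOn fun y hy => by simpa [ht] using hy
  · have hm : (y, (1 : G)) ∈ φ.target := by simp [ht, hy]
    rw [← (h _ (φ.map_target hm)).1, φ.right_inv hm]

/-- A function on the base is smooth if its pull-back is. -/
theorem contMDiff_of_comp_proj {f : M → ℝ}
    (hf : ContMDiff 𝓘(ℝ, EP) 𝓘(ℝ, ℝ) ∞ (fun q => f (B.proj q))) :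
    ContMDiff 𝓘(ℝ, EM) 𝓘(ℝ, ℝ) ∞ f := by
  intro x
  obtain ⟨U, s, hU, hx, hs, h⟩ := B.exists_local_section x
  refine ((hf.comp_contMDiffOn hs).contMDiffAt (hU.mem_nhds hx)).congr_of_eventuallyEq ?_
  filter_upwards [hU.mem_nhds hx] with y hy
  simp [h y hy]

/-- A vector field on the base is smooth if it is the image of a smooth one. -/
theorem Projects.smoothField {X : ∀ q : P, TangentSpace 𝓘(ℝ, EP) q}
    {Z : ∀ x : M, TangentSpace 𝓘(ℝ, EM) x} (h : B.Projects X Z) (hX : SmoothField X) :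
    SmoothField Z := by
  intro x
  obtain ⟨U, s, hU, hx, hs, hsp⟩ := B.exists_local_section x
  have h1 := ((B.contMDiff_proj.contMDiff_tangentMap (m := ∞) (by simp)).comp hX).comp_contMDiffOn hs
  refine (h1.contMDiffAt (hU.mem_nhds hx)).congr_of_eventuallyEq ?_
  filter_upwards [hU.mem_nhds hx] with y hy
  change (⟨y, Z y⟩ : TangentBundle 𝓘(ℝ, EM) M) = ⟨B.proj (s y), B.dProj (s y) (X (s y))⟩
  rw [h (s y), hsp y hy]

/-- The pull-back of a smooth covector field is smooth. -/
theorem contMDiff_pullback [FiniteDimensional ℝ EM] [T2Space M]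
    {ξ : ∀ x : M, Module.Dual ℝ (TangentSpace 𝓘(ℝ, EM) x)} (hξ : SmoothCovector ξ)
    {X : ∀ q : P, TangentSpace 𝓘(ℝ, EP) q} (hX : SmoothField X) :
    ContMDiff 𝓘(ℝ, EP) 𝓘(ℝ, ℝ) ∞ (fun q => ξ (B.proj q) (B.dProj q (X q))) := by
  intro q
  -- The vectors `dp(X)` need not form a vector field on `M`, so smoothness of `ξ` cannot be applied
  -- to them directly; they are expanded in a local frame with coefficients that are smooth on `P`.
  obtain ⟨τ, hτ, -⟩ := exists_frame (E := EM) (F := EM)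
    (V := (TangentSpace 𝓘(ℝ, EM) : M → Type _)) (B.proj q)
  have h1 : ContMDiff 𝓘(ℝ, EP) 𝓘(ℝ, EM).tangent ∞
      (fun q => (⟨B.proj q, B.dProj q (X q)⟩ : TangentBundle 𝓘(ℝ, EM) M)) :=
    (B.contMDiff_proj.contMDiff_tangentMap (m := ∞) (by simp)).comp hX
  have h2 := (contMDiffAt_totalSpace.1 (h1 q)).2
  have h3 : ∀ i, ContMDiffAt 𝓘(ℝ, EP) 𝓘(ℝ, ℝ) ∞ (fun q' => (Module.finBasis ℝ EM).repr
      (trivializationAt EM (TangentSpace 𝓘(ℝ, EM)) (B.proj q)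
        ⟨B.proj q', B.dProj q' (X q')⟩).2 i) q := fun i =>
    (((Module.finBasis ℝ EM).coord i).toContinuousLinearMap.contDiff.contMDiff.contMDiffAt).comp
      q h2
  have h4 : ContMDiffAt 𝓘(ℝ, EP) 𝓘(ℝ, ℝ) ∞ (fun q' => ∑ i, (Module.finBasis ℝ EM).repr
      (trivializationAt EM (TangentSpace 𝓘(ℝ, EM)) (B.proj q)
        ⟨B.proj q', B.dProj q' (X q')⟩).2 i * ξ (B.proj q') (τ i (B.proj q'))) q :=
    ContMDiffAt.sum fun i _ =>
      (h3 i).mul (((hξ (τ i) (τ i).contMDiff).comp B.contMDiff_proj) q)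
  refine h4.congr_of_eventuallyEq ?_
  filter_upwards [B.contMDiff_proj.continuous.continuousAt.eventually hτ] with q' hq'
  conv_lhs => rw [hq' (B.dProj q' (X q'))]
  simp

end PrincipalBundle

end Principal

/-! ### The Atiyah bundle and horizontal lifts -/

section Horizontal

variable {EG : Type*} [NormedAddCommGroup EG] [NormedSpace ℝ EG]
  {G : Type*} [TopologicalSpace G] [ChartedSpace EG G] [Group G] [LieGroup 𝓘(ℝ, EG) ∞ G]
  {EP : Type*} [NormedAddCommGroup EP] [NormedSpace ℝ EP]
  {P : Type*} [TopologicalSpace P] [ChartedSpace EP P] [IsManifold 𝓘(ℝ, EP) ∞ P]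
  {EM : Type*} [NormedAddCommGroup EM] [NormedSpace ℝ EM]
  {M : Type*} [TopologicalSpace M] [ChartedSpace EM M] [IsManifold 𝓘(ℝ, EM) ∞ M]

theorem SmoothField.sub {X Y : ∀ x : P, TangentSpace 𝓘(ℝ, EP) x} (hX : SmoothField X)
    (hY : SmoothField Y) : SmoothField (fun q => X q - Y q) :=
  ContMDiff.sub_section hX hY

namespace PrincipalBundle

variable (B : PrincipalBundle EG G EP P EM M)

/-- The field is the tangent map of the action evaluated on the smooth field `(0, z)` along `P ×
{1}`. -/
theorem smoothField_fundamental (z : GroupLieAlgebra 𝓘(ℝ, EG) G) :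
    SmoothField (fun q => B.fundamental q z) := by
  have hz : ContMDiff 𝓘(ℝ, EP) 𝓘(ℝ, EP).tangent ∞
      (zeroSection EP (TangentSpace 𝓘(ℝ, EP) : P → Type _)) := contMDiff_zeroSection ℝ _
  have h1 := (contMDiff_equivTangentBundleProd_symm (I := 𝓘(ℝ, EP)) (M := P)
    (I' := 𝓘(ℝ, EG)) (M' := G) (n := ∞)).comp
    (hz.prodMk (contMDiff_const (c := (⟨1, z⟩ : TangentBundle 𝓘(ℝ, EG) G))))
  have h2 := (B.contMDiff_act.contMDiff_tangentMap (m := ∞) (by simp)).comp h1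
  refine h2.congr fun q => ?_
  have h3 := mfderiv_prod_eq_add_apply (I := 𝓘(ℝ, EP)) (I' := 𝓘(ℝ, EG)) (I'' := 𝓘(ℝ, EP))
    (p := (q, (1 : G))) (v := ((0 : EP), (z : EG)))
    ((B.contMDiff_act (q, 1)).mdifferentiableAt (by simp))
  have h4 : (mfderiv (𝓘(ℝ, EP).prod 𝓘(ℝ, EG)) 𝓘(ℝ, EP) (fun a : P × G => B.act a.1 a.2) (q, 1)
      ((0 : EP), (z : EG)) : EP) = B.fundamental q z :=
    h3.trans ((congrArg (· + B.fundamental q z)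
      (map_zero (mfderiv 𝓘(ℝ, EP) 𝓘(ℝ, EP) (fun q' => B.act q' 1) q))).trans (zero_add _))
  change (⟨q, B.fundamental q z⟩ : TotalSpace EP fun _ : P => EP) = ⟨B.act q 1,
    (mfderiv (𝓘(ℝ, EP).prod 𝓘(ℝ, EG)) 𝓘(ℝ, EP) (fun a : P × G => B.act a.1 a.2) (q, 1)
      ((0 : EP), (z : EG)) : EP)⟩
  rw [h4, B.act_one]

/-- The infinitesimal action at a point, as a linear map. -/
def fundamentalₗ (q : P) : GroupLieAlgebra 𝓘(ℝ, EG) G →ₗ[ℝ] TangentSpace 𝓘(ℝ, EP) q where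
  toFun := B.fundamental q
  map_add' z w := map_add (mfderiv 𝓘(ℝ, EG) 𝓘(ℝ, EP) (fun g => B.act q g) 1) z w
  map_smul' r z := map_smul (mfderiv 𝓘(ℝ, EG) 𝓘(ℝ, EP) (fun g => B.act q g) 1) r z

@[simp]
theorem fundamentalₗ_apply (q : P) (z : GroupLieAlgebra 𝓘(ℝ, EG) G) :
    B.fundamentalₗ q z = B.fundamental q z := rfl

/-- The projection `TP/G → TM`, computed at a chosen point of the fibre. -/
def atiyahProj (x : M) : B.AtiyahFiber x →ₗ[ℝ] TangentSpace 𝓘(ℝ, EM) x where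
  toFun X := (B.dProj (B.nonempty_fib x).some.1 (X.1 (B.nonempty_fib x).some) : EM)
  map_add' _ _ := map_add (B.dProj _) _ _
  map_smul' _ _ := map_smul (B.dProj _) _ _

theorem dProj_eq_of_atiyah {x : M} (X : B.AtiyahFiber x) (q q' : B.Fib x) :
    (B.dProj q.1 (X.1 q) : EM) = B.dProj q'.1 (X.1 q') := by
  obtain ⟨g, hg⟩ := B.exists_act_eq (q.2.trans q'.2.symm)
  obtain rfl : B.actFib q g = q' := Subtype.ext hg
  rw [X.2 q g]
  exact (B.dProj_dAct g q.1 _).symm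

theorem dProj_eq_atiyahProj {x : M} (X : B.AtiyahFiber x) (q : B.Fib x) :
    (B.dProj q.1 (X.1 q) : EM) = B.atiyahProj x X :=
  B.dProj_eq_of_atiyah X q _

theorem projects_atiyahProj (X : ∀ x, B.AtiyahFiber x) :
    B.Projects (B.field X) (fun x => B.atiyahProj x (X x)) :=
  fun q => B.dProj_eq_atiyahProj (X (B.proj q)) ⟨q, rfl⟩

theorem Projects.eq {X : ∀ q : P, TangentSpace 𝓘(ℝ, EP) q} {Z Z' : ∀ x : M, TangentSpace 𝓘(ℝ, EM) x}
    (h : B.Projects X Z) (hX' : B.Projects X Z') : Z = Z' := by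
  funext x
  obtain ⟨q, rfl⟩ := B.proj_surjective x
  rw [← hX' q]
  exact (h q).symm

/-- An element of `TP/G` is determined by its value at one point of the fibre. -/
theorem atiyah_ext {x : M} {X Y : B.AtiyahFiber x} (q : B.Fib x) (h : X.1 q = Y.1 q) : X = Y := by
  refine Subtype.ext (funext fun q' => ?_)
  obtain ⟨g, hg⟩ := B.exists_act_eq (q.2.trans q'.2.symm)
  obtain rfl : B.actFib q g = q' := Subtype.ext hg
  rw [X.2 q g, Y.2 q g, h]

theorem field_act (X : ∀ x, B.AtiyahFiber x) (q : P) (g : G) :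
    B.field X (B.act q g) = B.dAct g q (B.field X q) := by
  have key : ∀ (x : M) (hx : B.proj (B.act q g) = x),
      (B.field X (B.act q g) : EP) = (X x).1 ⟨B.act q g, hx⟩ := by
    rintro _ rfl
    rfl
  exact (key _ (B.proj_act q g)).trans ((X (B.proj q)).2 ⟨q, rfl⟩ g)

variable [FiniteDimensional ℝ EG] [FiniteDimensional ℝ EM] [T2Space M]
  [FiniteDimensional ℝ EP] [T2Space P]

theorem dProj_surjective (q : P) : Function.Surjective (B.dProj q) := by
  intro u
  obtain ⟨Z, hZ, hZu⟩ := exists_smoothField_apply_eq u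
  obtain ⟨W, T, -, hq, -, h⟩ := B.exists_local_lift hZ q
  exact ⟨T q, (h q hq).trans hZu⟩

namespace Connection

variable {B} (A : B.Connection)

/-- The difference is vertical, hence some `Y_z`, and the connection form returns `z`, which is
therefore zero. Identities between lifts are checked through this criterion. -/
theorem eq_of_dProj_eq {q : P} {v w : TangentSpace 𝓘(ℝ, EP) q} (h : B.dProj q v = B.dProj q w)
    (h' : A.form q v = A.form q w) : v = w := by
  obtain ⟨z, hz⟩ := B.exists_fundamental_eq (q := q) (v := v - w) (by rw [map_sub, h, sub_self])
  have hz0 : z = 0 := by rw [← A.form_fundamental q z, hz, map_sub, h', sub_self]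
  have h0 := map_zero (B.fundamentalₗ q)
  rw [B.fundamentalₗ_apply, ← hz0, hz] at h0
  exact sub_eq_zero.1 h0

/-- The splitting `T_q P ≅ T_x M ⊕ 𝔤` defined by the connection. -/
def splitEquiv (q : P) : TangentSpace 𝓘(ℝ, EP) q ≃ₗ[ℝ]
    TangentSpace 𝓘(ℝ, EM) (B.proj q) × GroupLieAlgebra 𝓘(ℝ, EG) G :=
  LinearEquiv.ofBijective ((B.dProj q).toLinearMap.prod (A.form q)) <| by
    refine ⟨fun v w h => A.eq_of_dProj_eq (congrArg Prod.fst h) (congrArg Prod.snd h), ?_⟩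
    rintro ⟨u, z⟩
    obtain ⟨v, hv⟩ := B.dProj_surjective q u
    refine ⟨v + B.fundamental q (z - A.form q v), Prod.ext ?_ ?_⟩
    · change B.dProj q (v + B.fundamental q (z - A.form q v)) = u
      rw [map_add, B.dProj_fundamental, add_zero, hv]
    · change A.form q (v + B.fundamental q (z - A.form q v)) = z
      rw [map_add, A.form_fundamental, add_sub_cancel]

/-- The horizontal lift of tangent vectors. -/
def hlift (q : P) : TangentSpace 𝓘(ℝ, EM) (B.proj q) →ₗ[ℝ] TangentSpace 𝓘(ℝ, EP) q :=
  (A.splitEquiv q).symm.toLinearMap ∘ₗ LinearMap.inl ℝ _ _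

theorem dProj_hlift (q : P) (u : TangentSpace 𝓘(ℝ, EM) (B.proj q)) :
    B.dProj q (A.hlift q u) = u :=
  congrArg Prod.fst ((A.splitEquiv q).apply_symm_apply (u, 0))

theorem form_hlift (q : P) (u : TangentSpace 𝓘(ℝ, EM) (B.proj q)) : A.form q (A.hlift q u) = 0 :=
  congrArg Prod.snd ((A.splitEquiv q).apply_symm_apply (u, 0))

/-- Both sides have the same projection and zero connection form. The base vectors are compared in
the model space because `B.proj (B.act q g)` and `B.proj q` are equal only propositionally. -/
theorem dAct_hlift (g : G) (q : P) {u : TangentSpace 𝓘(ℝ, EM) (B.proj q)}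
    {u' : TangentSpace 𝓘(ℝ, EM) (B.proj (B.act q g))} (hu : (u' : EM) = u) :
    A.hlift (B.act q g) u' = B.dAct g q (A.hlift q u) := by
  refine A.eq_of_dProj_eq ?_ ?_
  · rw [A.dProj_hlift]
    exact hu.trans ((B.dProj_dAct g q _).trans (A.dProj_hlift q u)).symm
  · rw [A.form_hlift, A.equivariant, A.form_hlift, map_zero]

theorem IsHorLift.eq_hlift {Z : ∀ x : M, TangentSpace 𝓘(ℝ, EM) x}
    {Zh : ∀ q : P, TangentSpace 𝓘(ℝ, EP) q} (h : A.IsHorLift Z Zh) :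
    Zh = fun q => A.hlift q (Z (B.proj q)) := by
  funext q
  refine A.eq_of_dProj_eq ?_ ?_
  · rw [h.1 q, A.dProj_hlift]
  · rw [h.2 q, A.form_hlift]

theorem isHorLift_hlift (Z : ∀ x : M, TangentSpace 𝓘(ℝ, EM) x) :
    A.IsHorLift Z (fun q => A.hlift q (Z (B.proj q))) :=
  ⟨fun q => A.dProj_hlift q _, fun q => A.form_hlift q _⟩

/-- The horizontal lift `TM → TP/G`. -/
def atiyahLift (x : M) : TangentSpace 𝓘(ℝ, EM) x →ₗ[ℝ] B.AtiyahFiber x where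
  toFun u := ⟨fun q => A.hlift q.1 (u : EM), fun q g => A.dAct_hlift g q.1 rfl⟩
  map_add' u v := Subtype.ext (funext fun q => map_add (A.hlift q.1) (u : EM) (v : EM))
  map_smul' r u := Subtype.ext (funext fun q => map_smul (A.hlift q.1) r (u : EM))

theorem atiyahProj_atiyahLift (x : M) (u : TangentSpace 𝓘(ℝ, EM) x) :
    B.atiyahProj x (A.atiyahLift x u) = u :=
  A.dProj_hlift (B.nonempty_fib x).some.1 (u : EM)

theorem contMDiff_coord (A : B.Connection) {X : ∀ q : P, TangentSpace 𝓘(ℝ, EP) q}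
    (hX : SmoothField X) (i) :
    ContMDiff 𝓘(ℝ, EP) 𝓘(ℝ, ℝ) ∞ (fun q => (Module.finBasis ℝ EG).repr (A.form q (X q)) i) :=
  (((Module.finBasis ℝ EG).coord i).toContinuousLinearMap.contDiff.contMDiff).comp (A.smooth X hX)

/-- A linear function of `A X` with values in sections, written in coordinates. -/
theorem map_form_eq_sum {W : Type*} [AddCommGroup W] [Module ℝ W]
    (T : GroupLieAlgebra 𝓘(ℝ, EG) G →ₗ[ℝ] W) (q : P) (v : TangentSpace 𝓘(ℝ, EP) q) :
    T (A.form q v) = ∑ i, (Module.finBasis ℝ EG).repr (A.form q v) i •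
      T (Module.finBasis ℝ EG i : EG) := by
  let T' : EG →ₗ[ℝ] W := T
  have h := congrArg T' ((Module.finBasis ℝ EG).sum_repr (A.form q v))
  rw [map_sum] at h
  simp only [map_smul] at h
  exact h.symm

/-- In a basis of `𝔤` this is a combination of fundamental fields whose coefficients, the
coordinates of `A X`, are smooth. -/
theorem smoothField_ver {X : ∀ q : P, TangentSpace 𝓘(ℝ, EP) q} (hX : SmoothField X) :
    SmoothField (A.ver X) := by
  have h : ContMDiff 𝓘(ℝ, EP) 𝓘(ℝ, EP).tangent ∞ (fun q =>
      (⟨q, ∑ i, (Module.finBasis ℝ EG).repr (A.form q (X q)) i •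
        B.fundamental q (Module.finBasis ℝ EG i : EG)⟩ : TangentBundle 𝓘(ℝ, EP) P)) :=
    ContMDiff.sum_section fun i _ =>
      ContMDiff.smul_section (A.contMDiff_coord hX i) (B.smoothField_fundamental _)
  exact h.congr fun q => congrArg (TotalSpace.mk q) (A.map_form_eq_sum (B.fundamentalₗ q) q (X q))

theorem smoothField_hor {X : ∀ q : P, TangentSpace 𝓘(ℝ, EP) q} (hX : SmoothField X) :
    SmoothField (A.hor X) :=
  hX.sub (A.smoothField_ver hX)

theorem form_hor (X : ∀ q : P, TangentSpace 𝓘(ℝ, EP) q) (q : P) : A.form q (A.hor X q) = 0 := by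
  rw [hor, ver, map_sub, A.form_fundamental, sub_self]

theorem form_ver (X : ∀ q : P, TangentSpace 𝓘(ℝ, EP) q) (q : P) :
    A.form q (A.ver X q) = A.form q (X q) :=
  A.form_fundamental q _

theorem dProj_ver (X : ∀ q : P, TangentSpace 𝓘(ℝ, EP) q) (q : P) : B.dProj q (A.ver X q) = 0 :=
  B.dProj_fundamental q _

theorem dProj_hor (X : ∀ q : P, TangentSpace 𝓘(ℝ, EP) q) (q : P) :
    B.dProj q (A.hor X q) = B.dProj q (X q) := by
  rw [hor, map_sub, A.dProj_ver, sub_zero]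

/-- The horizontal lift of a smooth vector field is smooth. -/
theorem smoothField_hlift {Z : ∀ x : M, TangentSpace 𝓘(ℝ, EM) x} (hZ : SmoothField Z) :
    SmoothField (fun q => A.hlift q (Z (B.proj q))) := by
  intro q
  obtain ⟨W, T, hW, hq, hT, h⟩ := B.exists_local_lift hZ q
  obtain ⟨σ, hσ⟩ := exists_section_eventuallyEq hW hq hT
  -- The horizontal part of any local lift of `Z` is its horizontal lift.
  refine (A.smoothField_hor σ.contMDiff q).congr_of_eventuallyEq ?_
  filter_upwards [hσ, hW.mem_nhds hq] with q' h1 h2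
  refine congrArg (TotalSpace.mk q') (A.eq_of_dProj_eq ?_ ?_)
  · rw [A.dProj_hlift, A.dProj_hor, h1, h q' h2]
  · rw [A.form_hlift, A.form_hor]

theorem hor_eq_hlift (X : ∀ q : P, TangentSpace 𝓘(ℝ, EP) q) (q : P) :
    A.hor X q = A.hlift q (B.dProj q (X q)) := by
  refine A.eq_of_dProj_eq ?_ ?_
  · rw [A.dProj_hlift, A.dProj_hor]
  · rw [A.form_hlift, A.form_hor]

end Connection

end PrincipalBundle

end Horizontal

/-! ### Pointwise algebra of an exact Courant algebroid -/

section Algebroid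

variable {EP : Type*} [NormedAddCommGroup EP] [NormedSpace ℝ EP]
  {P : Type*} [TopologicalSpace P] [ChartedSpace EP P] [IsManifold 𝓘(ℝ, EP) ∞ P]
  {F : Type*} [NormedAddCommGroup F] [NormedSpace ℝ F]
  {V : P → Type*} [TopologicalSpace (TotalSpace F V)]
  [∀ q, AddCommGroup (V q)] [∀ q, Module ℝ (V q)] [∀ q, TopologicalSpace (V q)]
  [FiberBundle F V] [VectorBundle ℝ F V]

namespace CourantAlgebroid

variable (C : CourantAlgebroid EP F V)

theorem eq_of_pairing_eq {q : P} {v v' : V q} (h : ∀ w, C.pairing q v w = C.pairing q v' w) :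
    v = v' :=
  sub_eq_zero.1 (C.pairing_nondegenerate q _ fun w => by simp [h w])

/-- Polarization of the normalization `[e,e] = ½π^*d⟨e,e⟩`: the symmetric part of the bracket is a
differential. -/
theorem pairing_bracket_swap (σ τ υ : Cₛ^∞⟮𝓘(ℝ, EP); F, V⟯) (q : P) :
    C.pairing q (C.bracket σ τ q) (υ q) = -C.pairing q (C.bracket τ σ q) (υ q) +
      dirDeriv (fun q' => C.anchor q' (υ q')) (fun q' => C.pairing q' (σ q') (τ q')) q := by
  have h := C.bracket_self (σ + τ) υ q
  have e : (fun q' => C.pairing q' ((σ + τ) q') ((σ + τ) q')) = fun q' =>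
      (C.pairing q' (σ q') (σ q') + C.pairing q' (τ q') (τ q')) +
        2 * C.pairing q' (σ q') (τ q') := by
    funext q'
    rw [ContMDiffSection.coe_add, Pi.add_apply, map_add, map_add, LinearMap.add_apply,
      LinearMap.add_apply, C.pairing_symm q' (τ q') (σ q')]
    ring
  have sσ := C.pairing_smooth σ σ
  have sτ := C.pairing_smooth τ τ
  have sm := C.pairing_smooth σ τ
  have s1 : ContMDiff 𝓘(ℝ, EP) 𝓘(ℝ, ℝ) ∞
      (fun q' => C.pairing q' (σ q') (σ q') + C.pairing q' (τ q') (τ q')) := sσ.add sτ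
  have s2 : ContMDiff 𝓘(ℝ, EP) 𝓘(ℝ, ℝ) ∞ (fun q' => 2 * C.pairing q' (σ q') (τ q')) :=
    contMDiff_const.mul sm
  rw [e, dirDeriv_add _ s1 s2, dirDeriv_add _ sσ sτ,
    dirDeriv_const_mul _ _ sm] at h
  simp only [map_add, LinearMap.add_apply, ContMDiffSection.coe_add, Pi.add_apply] at h
  rw [C.bracket_self σ υ q, C.bracket_self τ υ q] at h
  linarith

theorem pairing_bracket_comm (σ τ υ : Cₛ^∞⟮𝓘(ℝ, EP); F, V⟯) (q : P) :
    C.pairing q (C.bracket σ τ q) (υ q) =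
      dirDeriv (fun q' => C.anchor q' (σ q')) (fun q' => C.pairing q' (τ q') (υ q')) q -
        C.pairing q (C.bracket σ υ q) (τ q) := by
  rw [C.bracket_pairing σ τ υ q, C.pairing_symm q (τ q)]
  ring

variable [FiniteDimensional ℝ F]

theorem nondegenerate_pairing (q : P) : (C.pairing q).Nondegenerate :=
  ⟨C.pairing_nondegenerate q, fun v hv =>
    C.pairing_nondegenerate q v fun w => (C.pairing_symm q v w).trans (hv w)⟩

/-- The map `π^* : T^*P → V`. -/
def coanchor (q : P) : Module.Dual ℝ (TangentSpace 𝓘(ℝ, EP) q) →ₗ[ℝ] V q :=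
  haveI : FiniteDimensional ℝ (V q) := VectorBundle.finiteDimensional ℝ F V q
  (LinearMap.BilinForm.toDual (C.pairing q) (C.nondegenerate_pairing q)).symm.toLinearMap ∘ₗ
    (C.anchor q).dualMap

theorem pairing_coanchor (q : P) (α : Module.Dual ℝ (TangentSpace 𝓘(ℝ, EP) q)) (w : V q) :
    C.pairing q (C.coanchor q α) w = α (C.anchor q w) := by
  have : FiniteDimensional ℝ (V q) := VectorBundle.finiteDimensional ℝ F V q
  exact LinearMap.BilinForm.apply_toDual_symm_apply (hB := C.nondegenerate_pairing q) _ _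

theorem exists_coanchor_eq (hC : C.IsExact) {q : P} {v : V q} (hv : C.anchor q v = 0) :
    ∃ α, C.coanchor q α = v := by
  obtain ⟨α, hα⟩ := (hC q).2 v hv
  exact ⟨α, C.eq_of_pairing_eq fun w => (C.pairing_coanchor q α w).trans (hα w).symm⟩

/-- Exactness gives `π^*α - sπ(π^*α) = π^*β`. Pairing with the isotropic image of `s` shows `α = β`,
so `sπ(π^*α) = 0`, and applying `π` finishes. -/
theorem anchor_coanchor (hC : C.IsExact) {q : P} (s : TangentSpace 𝓘(ℝ, EP) q →ₗ[ℝ] V q)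
    (hs : ∀ v, C.anchor q (s v) = v) (hs' : ∀ v w, C.pairing q (s v) (s w) = 0)
    (α : Module.Dual ℝ (TangentSpace 𝓘(ℝ, EP) q)) : C.anchor q (C.coanchor q α) = 0 := by
  set v := C.coanchor q α with hv
  obtain ⟨β, hβ⟩ := C.exists_coanchor_eq hC (q := q) (v := v - s (C.anchor q v))
    (by rw [map_sub, hs, sub_self])
  have hαβ : α = β := by
    refine LinearMap.ext fun Y => ?_
    have h1 := C.pairing_coanchor q α (s Y)
    have h2 := C.pairing_coanchor q β (s Y)
    rw [hβ, map_sub, LinearMap.sub_apply, hs', hs, hv, sub_zero] at h2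
    rw [hs] at h1
    exact h1.symm.trans h2
  rw [← hαβ, ← hv] at hβ
  have h0 : s (C.anchor q v) = 0 := by simpa using hβ.symm
  rw [← hs (C.anchor q v), h0, map_zero]

end CourantAlgebroid

end Algebroid

/-! ### Adapted splittings and the isomorphism with the reduced bundle -/

section Reduction

variable {EG : Type*} [NormedAddCommGroup EG] [NormedSpace ℝ EG] [FiniteDimensional ℝ EG]
  {G : Type*} [TopologicalSpace G] [ChartedSpace EG G] [Group G] [LieGroup 𝓘(ℝ, EG) ∞ G]
  {EP : Type*} [NormedAddCommGroup EP] [NormedSpace ℝ EP] [FiniteDimensional ℝ EP]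
  {P : Type*} [TopologicalSpace P] [ChartedSpace EP P] [IsManifold 𝓘(ℝ, EP) ∞ P] [T2Space P]
  {EM : Type*} [NormedAddCommGroup EM] [NormedSpace ℝ EM] [FiniteDimensional ℝ EM]
  {M : Type*} [TopologicalSpace M] [ChartedSpace EM M] [IsManifold 𝓘(ℝ, EM) ∞ M] [T2Space M]
  {B : PrincipalBundle EG G EP P EM M}
  {F : Type*} [NormedAddCommGroup F] [NormedSpace ℝ F] [FiniteDimensional ℝ F]
  {V : P → Type*} [TopologicalSpace (TotalSpace F V)]
  [∀ q, AddCommGroup (V q)] [∀ q, Module ℝ (V q)] [∀ q, TopologicalSpace (V q)]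
  [FiberBundle F V] [VectorBundle ℝ F V] [ContMDiffVectorBundle ∞ F V 𝓘(ℝ, EP)]
  {C : CourantAlgebroid EP F V}

namespace LiftedAction

variable (L : LiftedAction B C) {c : LinearMap.BilinForm ℝ (GroupLieAlgebra 𝓘(ℝ, EG) G)}
  {A : B.Connection}

/-- The value of `ρ` at a point. -/
def rhoAt (q : P) : GroupLieAlgebra 𝓘(ℝ, EG) G →ₗ[ℝ] V q where
  toFun z := L.rho z q
  map_add' z w := by simp
  map_smul' r z := by simp

theorem pairing_rho_rho {L : LiftedAction B C} (hc : L.IsQuadraticForm c) (q : P)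
    (z w : GroupLieAlgebra 𝓘(ℝ, EG) G) :
    C.pairing q (L.rho z q) (L.rho w q) = -c z w := by
  have h := hc.2 (z + w) q
  have h1 := hc.2 z q
  have h2 := hc.2 w q
  simp only [map_add, LinearMap.add_apply, ContMDiffSection.coe_add, Pi.add_apply] at h
  rw [h1, h2, hc.1 w z, C.pairing_symm q (L.rho w q) (L.rho z q)] at h
  linarith

theorem lift_rho {L : LiftedAction B C} (hL : L.IsEquivariant) (g : G) (q : P)
    (z : GroupLieAlgebra 𝓘(ℝ, EG) G) :
    L.lift g q (L.rho z q) = L.rho (Ad EG g⁻¹ z) (B.act q g) := by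
  have h := hL g (Ad EG g⁻¹ z) q
  rw [Ad_Ad_inv] at h
  rw [h, LinearEquiv.apply_symm_apply]

theorem contMDiff_rho_form (A : B.Connection) {X : ∀ q : P, TangentSpace 𝓘(ℝ, EP) q}
    (hX : SmoothField X) :
    ContMDiff 𝓘(ℝ, EP) (𝓘(ℝ, EP).prod 𝓘(ℝ, F)) ∞
      (fun q => (⟨q, L.rho (A.form q (X q)) q⟩ : TotalSpace F V)) := by
  have h : ContMDiff 𝓘(ℝ, EP) (𝓘(ℝ, EP).prod 𝓘(ℝ, F)) ∞ (fun q =>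
      (⟨q, ∑ i, (Module.finBasis ℝ EG).repr (A.form q (X q)) i •
        L.rho (Module.finBasis ℝ EG i : EG) q⟩ : TotalSpace F V)) :=
    ContMDiff.sum_section fun i _ =>
      ContMDiff.smul_section (A.contMDiff_coord hX i) (L.rho _).contMDiff
  exact h.congr fun q => congrArg (TotalSpace.mk q) (A.map_form_eq_sum (L.rhoAt q) q (X q))

/-- Polarized, the pairing on `K` is `-c`, so `ρ(z) ⊥ K` makes `z` a null vector of `c`. -/
theorem inf_Kperp_eq_bot {L : LiftedAction B C} (hc : L.IsQuadraticForm c)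
    (hnd : ∀ z, (∀ w, c z w = 0) → z = 0) (q : P) : L.K q ⊓ L.Kperp q = ⊥ := by
  rw [eq_bot_iff]
  rintro v ⟨⟨z, rfl⟩, hz⟩
  have : z = 0 := hnd z fun w => by
    have := hz (L.rho w q) ⟨w, rfl⟩
    rw [pairing_rho_rho hc] at this
    linarith
  simp [this]

/-- Smooth equivariant splittings `TP → K^⊥` of the anchor for which the pairing is
`⟨λ v, λ w⟩ = c(A v, A w)`. -/
structure IsAdapted (c : LinearMap.BilinForm ℝ (GroupLieAlgebra 𝓘(ℝ, EG) G)) (A : B.Connection)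
    (lam : ∀ q, TangentSpace 𝓘(ℝ, EP) q →ₗ[ℝ] V q) : Prop where
  smooth : ∀ X : ∀ q : P, TangentSpace 𝓘(ℝ, EP) q, SmoothField X →
    ContMDiff 𝓘(ℝ, EP) (𝓘(ℝ, EP).prod 𝓘(ℝ, F)) ∞
      (fun q => (⟨q, lam q (X q)⟩ : TotalSpace F V))
  anchor : ∀ q v, C.anchor q (lam q v) = v
  rho : ∀ q v z, C.pairing q (lam q v) (L.rho z q) = 0
  pairing : ∀ q v w, C.pairing q (lam q v) (lam q w) = c (A.form q v) (A.form q w)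
  lift : ∀ g q v, L.lift g q (lam q v) = lam (B.act q g) (B.dAct g q v)

/-- The identity is the image under the anchor of the equivariance of `ρ`. -/
theorem dAct_fundamental {L : LiftedAction B C} (hL : L.IsEquivariant) (g : G) (q : P)
    (z : GroupLieAlgebra 𝓘(ℝ, EG) G) :
    B.dAct g q (B.fundamental q z) = B.fundamental (B.act q g) (Ad EG g⁻¹ z) := by
  rw [← L.anchor_rho, ← L.anchor_rho, ← L.lift_anchor, lift_rho hL]

/-- An adapted splitting, built from an equivariant isotropic splitting `s` and a connection. -/
theorem exists_isAdapted {L : LiftedAction B C} (hC : C.IsExact) (hL : L.IsEquivariant)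
    (hc : L.IsQuadraticForm c) {s : ∀ q, TangentSpace 𝓘(ℝ, EP) q →ₗ[ℝ] V q}
    (hs : L.IsEquivariantIsotropicSplitting s) (A : B.Connection) :
    ∃ lam, L.IsAdapted c A lam := by
  obtain ⟨hsm, hsa, hsi, hse⟩ := hs
  let h : ∀ q, TangentSpace 𝓘(ℝ, EP) q →ₗ[ℝ] TangentSpace 𝓘(ℝ, EP) q :=
    fun q => LinearMap.id - B.fundamentalₗ q ∘ₗ A.form q
  let u : ∀ q, TangentSpace 𝓘(ℝ, EP) q →ₗ[ℝ] V q :=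
    fun q => s q ∘ₗ h q + L.rhoAt q ∘ₗ A.form q
  have hu : ∀ q v, u q v = s q (h q v) + L.rho (A.form q v) q := fun q v => rfl
  have hh : ∀ q v, h q v = v - B.fundamental q (A.form q v) := fun q v => rfl
  have hua : ∀ q v, C.anchor q (u q v) = v := fun q v => by
    rw [hu, map_add, hsa, L.anchor_rho, hh, sub_add_cancel]
  have hue : ∀ g q v, L.lift g q (u q v) = u (B.act q g) (B.dAct g q v) := fun g q v => by
    rw [hu, hu, map_add, hse, lift_rho hL, A.equivariant, hh, hh, map_sub, dAct_fundamental hL,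
      A.equivariant]
  -- The map `u` splits the anchor equivariantly but does not land in `K^⊥`. The covector `w ↦ ⟨u v,
  -- ρ(A w)⟩` records its pairings with `K`, and subtracting its image under `π^*` removes them
  -- without changing the anchor.
  let lam : ∀ q, TangentSpace 𝓘(ℝ, EP) q →ₗ[ℝ] V q := fun q =>
    u q - C.coanchor q ∘ₗ (C.pairing q).compl₁₂ (u q) (L.rhoAt q ∘ₗ A.form q)
  have hlam : ∀ q v, lam q v =
      u q v - C.coanchor q ((C.pairing q).compl₁₂ (u q) (L.rhoAt q ∘ₗ A.form q) v) :=
    fun q v => rfl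
  have hp : ∀ q v w, C.pairing q (lam q v) w =
      C.pairing q (u q v) w - C.pairing q (u q v) (L.rho (A.form q (C.anchor q w)) q) :=
    fun q v w => by
      rw [hlam, map_sub, LinearMap.sub_apply, C.pairing_coanchor]
      rfl
  have ha : ∀ q v, C.anchor q (lam q v) = v := fun q v => by
    rw [hlam, map_sub, hua, C.anchor_coanchor hC (s q) (hsa q) (hsi q), sub_zero]
  refine ⟨lam, ⟨?_, ha, ?_, ?_, ?_⟩⟩
  · intro X hX
    have hh' : ContMDiff 𝓘(ℝ, EP) (𝓘(ℝ, EP).prod 𝓘(ℝ, F)) ∞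
        (fun q => (⟨q, u q (X q)⟩ : TotalSpace F V)) :=
      ContMDiff.add_section (hsm _ (A.smoothField_hor hX)) (L.contMDiff_rho_form A hX)
    -- The correction term is built from pointwise duals, so smoothness is tested by pairing with
    -- sections.
    refine C.contMDiff_of_pairing fun τ => ?_
    simp only [hp]
    exact (C.pairing_smooth ⟨_, hh'⟩ τ).sub
      (C.pairing_smooth ⟨_, hh'⟩ ⟨_, L.contMDiff_rho_form A (C.anchor_smooth τ)⟩)
  · intro q v z
    rw [hp, L.anchor_rho, A.form_fundamental, sub_self]
  · intro q v w
    -- Using `hp` in both slots gives `⟨uw, uv⟩ - ⟨uw, ρ(Av)⟩ - ⟨uv, ρ(Aw)⟩`. The mixed terms in `s`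
    -- and `ρ` cancel, and the remaining ones add up to `-c + c + c = c`.
    rw [hp, ha, C.pairing_symm q _ (lam q w), hp, hua, hu, hu]
    simp only [map_add, LinearMap.add_apply, hsi, pairing_rho_rho hc]
    rw [C.pairing_symm q (L.rho (A.form q w) q) (s q (h q v)), hc.1 (A.form q w)]
    ring
  · intro g q v
    refine C.eq_of_pairing_eq fun w => ?_
    obtain ⟨w, rfl⟩ := (L.lift g q).surjective w
    rw [L.lift_pairing, hp, hp, ← hue, L.lift_pairing, L.lift_anchor, A.equivariant,
      ← lift_rho hL, L.lift_pairing]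

/-- The differential of the projection at a point of the fibre over `x`. -/
def _root_.CourantReduction.PrincipalBundle.dProjFib (B : PrincipalBundle EG G EP P EM M) {x : M}
    (q : B.Fib x) : TangentSpace 𝓘(ℝ, EP) q.1 →ₗ[ℝ] TangentSpace 𝓘(ℝ, EM) x :=
  (B.dProj q.1).toLinearMap

/-- The inclusion `ξ ↦ ½ π^* p^* ξ` of `T^*M`. -/
def cot (C : CourantAlgebroid EP F V) {x : M} (q : B.Fib x) :
    Module.Dual ℝ (TangentSpace 𝓘(ℝ, EM) x) →ₗ[ℝ] V q.1 :=
  C.coanchor q.1 ∘ₗ ((1 / 2 : ℝ) • (B.dProjFib q).dualMap)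

/-- The factor `½` is that of the normal form, where `⟨ξ, Y⟩ = ½ξ(pY)`. -/
theorem pairing_cot (C : CourantAlgebroid EP F V) {x : M} (q : B.Fib x)
    (ξ : Module.Dual ℝ (TangentSpace 𝓘(ℝ, EM) x)) (w : V q.1) :
    C.pairing q.1 (cot C q ξ) w = (1 / 2 : ℝ) * ξ (B.dProjFib q (C.anchor q.1 w)) :=
  C.pairing_coanchor q.1 _ w

theorem dProjFib_surjective {x : M} (q : B.Fib x) : Function.Surjective (B.dProjFib q) :=
  B.dProj_surjective q.1

theorem dProjFib_actFib {x : M} (q : B.Fib x) (g : G) (v : TangentSpace 𝓘(ℝ, EP) q.1) :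
    B.dProjFib (B.actFib q g) (B.dAct g q.1 v) = B.dProjFib q v :=
  B.dProj_dAct g q.1 v

theorem lift_cot {x : M} (q : B.Fib x) (g : G) (ξ : Module.Dual ℝ (TangentSpace 𝓘(ℝ, EM) x)) :
    cot C (B.actFib q g) ξ = L.lift g q.1 (cot C q ξ) := by
  refine C.eq_of_pairing_eq fun w => ?_
  obtain ⟨w, rfl⟩ := (L.lift g q.1).surjective w
  refine (pairing_cot C (B.actFib q g) ξ _).trans (Eq.trans (congrArg
    (fun v => (1 / 2 : ℝ) * ξ (B.dProjFib (B.actFib q g) v)) (L.lift_anchor g q.1 w)) ?_)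
  exact (congrArg (fun t => (1 / 2 : ℝ) * ξ t) (dProjFib_actFib q g _)).trans
    ((pairing_cot C q ξ w).symm.trans (L.lift_pairing g q.1 _ _).symm)

theorem cot_injective (hC : C.IsExact) {x : M} (q : B.Fib x) :
    Function.Injective (cot C q : Module.Dual ℝ (TangentSpace 𝓘(ℝ, EM) x) →ₗ[ℝ] V q.1) := by
  intro ξ η h
  refine LinearMap.ext fun v => ?_
  obtain ⟨v, rfl⟩ := dProjFib_surjective q v
  obtain ⟨w, rfl⟩ := (hC q.1).1 v
  have h1 := pairing_cot C q ξ w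
  rw [h, pairing_cot] at h1
  linarith

theorem contMDiff_cot {ξ : ∀ x : M, Module.Dual ℝ (TangentSpace 𝓘(ℝ, EM) x)}
    (hξ : SmoothCovector ξ) :
    ContMDiff 𝓘(ℝ, EP) (𝓘(ℝ, EP).prod 𝓘(ℝ, F)) ∞
      (fun q => (⟨q, cot C (⟨q, rfl⟩ : B.Fib (B.proj q)) (ξ (B.proj q))⟩ : TotalSpace F V)) :=
  C.contMDiff_of_pairing fun τ =>
    (contMDiff_const.mul (B.contMDiff_pullback hξ (C.anchor_smooth τ))).congr fun q =>
      pairing_cot C (⟨q, rfl⟩ : B.Fib (B.proj q)) (ξ (B.proj q)) (τ q)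

/-- `ππ^* = 0`. -/
def _root_.CourantReduction.CourantAlgebroid.AnchorCoanchor (C : CourantAlgebroid EP F V) : Prop :=
  ∀ q α, C.anchor q (C.coanchor q α) = 0

theorem anchor_cot (hπ : C.AnchorCoanchor) {x : M} (q : B.Fib x)
    (ξ : Module.Dual ℝ (TangentSpace 𝓘(ℝ, EM) x)) : C.anchor q.1 (cot C q ξ) = 0 :=
  hπ q.1 _

variable {L} {lam : ∀ q, TangentSpace 𝓘(ℝ, EP) q →ₗ[ℝ] V q}

theorem cot_mem_Kperp {x : M} (q : B.Fib x) (ξ : Module.Dual ℝ (TangentSpace 𝓘(ℝ, EM) x)) :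
    cot C q ξ ∈ L.Kperp q.1 := by
  rintro _ ⟨z, rfl⟩
  rw [pairing_cot, L.anchor_rho]
  have : B.dProjFib q (B.fundamental q.1 z) = 0 := B.dProj_fundamental q.1 z
  rw [this, map_zero, mul_zero]

/-- An element of `K^⊥` over the zero vector comes from `T^*M`. -/
theorem exists_cot_eq (hC : C.IsExact) {x : M} (q : B.Fib x) {v : V q.1}
    (hv : C.anchor q.1 v = 0) (hv' : v ∈ L.Kperp q.1) :
    ∃ ξ : Module.Dual ℝ (TangentSpace 𝓘(ℝ, EM) x), cot C q ξ = v := by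
  obtain ⟨α, rfl⟩ := C.exists_coanchor_eq hC hv
  -- Orthogonality to `ρ(z)` says `α(Y_z) = 0`, so `α` factors through `TM`. The scalar `2` below
  -- undoes the `½` in `cot`.
  have hker : LinearMap.ker (B.dProjFib q) ≤ LinearMap.ker α := by
    intro w hw
    obtain ⟨z, rfl⟩ := B.exists_fundamental_eq (q := q.1) (v := w) hw
    have := hv' (L.rho z q.1) ⟨z, rfl⟩
    rw [C.pairing_coanchor, L.anchor_rho] at this
    exact this
  obtain ⟨r, hr⟩ := (B.dProjFib q).exists_rightInverse_of_surjective
    (LinearMap.range_eq_top.2 (dProjFib_surjective q))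
  refine ⟨(2 : ℝ) • (α ∘ₗ r), C.eq_of_pairing_eq fun w => ?_⟩
  rw [pairing_cot, C.pairing_coanchor]
  have h0 : r (B.dProjFib q (C.anchor q.1 w)) - C.anchor q.1 w ∈ LinearMap.ker (B.dProjFib q) := by
    rw [LinearMap.mem_ker, map_sub, sub_eq_zero]
    exact LinearMap.congr_fun hr _
  have h1 := hker h0
  rw [LinearMap.mem_ker, map_sub, sub_eq_zero] at h1
  simp [h1]

namespace IsAdapted

/-- The map `X + ξ ↦ λ X + ½ π^* p^* ξ` to `K^⊥/G`. -/
def toKperp (h : L.IsAdapted c A lam) (x : M) :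
    (B.AtiyahFiber x × Module.Dual ℝ (TangentSpace 𝓘(ℝ, EM) x)) →ₗ[ℝ] L.quot L.Kperp x where
  toFun a := ⟨fun q => lam q.1 (a.1.1 q) + cot C q a.2, by
    refine ⟨fun q => (L.Kperp q.1).add_mem ?_ (cot_mem_Kperp q a.2), fun q g => ?_⟩
    · rintro _ ⟨z, rfl⟩
      exact h.rho q.1 _ z
    · exact (congrArg₂ (fun a b : V (B.act q.1 g) => a + b) ((congrArg (lam (B.act q.1 g)) (a.1.2 q g)).trans
        (h.lift g q.1 _).symm) (L.lift_cot q g a.2)).trans (map_add (L.lift g q.1) _ _).symm⟩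
  map_add' a a' := by
    refine Subtype.ext (funext fun q => ?_)
    have : (a + a').1.1 q = a.1.1 q + a'.1.1 q := rfl
    simp only [this, map_add, Prod.snd_add]
    exact add_add_add_comm _ _ _ _
  map_smul' r a := by
    refine Subtype.ext (funext fun q => ?_)
    have : (r • a).1.1 q = r • a.1.1 q := rfl
    simp only [this, map_smul, Prod.smul_snd]
    exact (smul_add _ _ _).symm

theorem toKperp_apply (h : L.IsAdapted c A lam) (x : M) (X : B.AtiyahFiber x)
    (ξ : Module.Dual ℝ (TangentSpace 𝓘(ℝ, EM) x)) (q : B.Fib x) :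
    (h.toKperp x (X, ξ)).1 q = lam q.1 (X.1 q) + cot C q ξ := rfl

/-- The anchor recovers `X`, and what remains after subtracting `λX` lies in `K^⊥` over zero, hence
in `T^*M`. It suffices to argue at one point of the fibre, since equivariance propagates equalities
along it. -/
theorem toKperp_bijective (h : L.IsAdapted c A lam) (hC : C.IsExact) (hπ : C.AnchorCoanchor)
    (x : M) : Function.Bijective (h.toKperp x) := by
  obtain ⟨q⟩ := B.nonempty_fib x
  constructor
  · rintro ⟨X, ξ⟩ ⟨Y, η⟩ e
    have e1 : lam q.1 (X.1 q) + cot C q ξ = lam q.1 (Y.1 q) + cot C q η :=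
      congrFun (congrArg Subtype.val e) q
    have e2 := congrArg (C.anchor q.1) e1
    simp only [map_add, h.anchor, anchor_cot hπ, add_zero] at e2
    rw [e2] at e1
    rw [B.atiyah_ext q e2, cot_injective hC q (add_left_cancel e1)]
  · intro u
    let X : B.AtiyahFiber x := ⟨fun q => C.anchor q.1 (u.1 q), fun q g => by
      exact (congrArg (C.anchor (B.act q.1 g)) (u.2.2 q g)).trans (L.lift_anchor g q.1 _)⟩
    have hX : ∀ q : B.Fib x, C.anchor q.1 (u.1 q - lam q.1 (X.1 q)) = 0 := fun q => by
      rw [map_sub, h.anchor, sub_self]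
    have hX' : ∀ q : B.Fib x, u.1 q - lam q.1 (X.1 q) ∈ L.Kperp q.1 := fun q => by
      refine (L.Kperp q.1).sub_mem (u.2.1 q) ?_
      rintro _ ⟨z, rfl⟩
      exact h.rho q.1 _ z
    obtain ⟨ξ, hξ⟩ := exists_cot_eq hC q (hX q) (hX' q)
    refine ⟨(X, ξ), Subtype.ext (funext fun q' => ?_)⟩
    obtain ⟨g, hg⟩ := B.exists_act_eq (q.2.trans q'.2.symm)
    obtain rfl : B.actFib q g = q' := Subtype.ext hg
    rw [(h.toKperp x (X, ξ)).2.2 q g, u.2.2 q g, toKperp_apply, hξ, add_sub_cancel]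

end IsAdapted

theorem submoduleOf_eq_bot (hc : L.IsQuadraticForm c) (hnd : ∀ z, (∀ w, c z w = 0) → z = 0)
    (x : M) :
    (L.quot (fun q => L.K q ⊓ L.Kperp q) x).submoduleOf (L.quot L.Kperp x) = ⊥ := by
  rw [eq_bot_iff]
  intro u hu
  refine Subtype.ext (funext fun q => ?_)
  have h1 : u.1 q ∈ L.K q.1 ⊓ L.Kperp q.1 := hu.1 q
  rw [inf_Kperp_eq_bot hc hnd] at h1
  exact h1

/-- The quotient is by zero, so representatives are unique and the bracket on `E` involves no
choice. -/
theorem cls_injective (hc : L.IsQuadraticForm c) (hnd : ∀ z, (∀ w, c z w = 0) → z = 0) {x : M}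
    {u u' : L.quot L.Kperp x} (h : L.cls u = L.cls u') : u = u' := by
  have := (Submodule.Quotient.eq _).1 h
  rw [submoduleOf_eq_bot hc hnd, Submodule.mem_bot] at this
  exact sub_eq_zero.1 this

namespace IsAdapted

/-- The isomorphism `TP/G ⊕ T^*M → E` defined by an adapted splitting. -/
def iso (h : L.IsAdapted c A lam) (hC : C.IsExact) (hπ : C.AnchorCoanchor)
    (hc : L.IsQuadraticForm c) (hnd : ∀ z, (∀ w, c z w = 0) → z = 0) (x : M) :
    (B.AtiyahFiber x × Module.Dual ℝ (TangentSpace 𝓘(ℝ, EM) x)) ≃ₗ[ℝ] L.RedFiber x :=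
  (LinearEquiv.ofBijective (h.toKperp x) (h.toKperp_bijective hC hπ x)).trans
    (Submodule.quotEquivOfEqBot _ (submoduleOf_eq_bot hc hnd x)).symm

theorem represents_iso_iff (h : L.IsAdapted c A lam) (hC : C.IsExact) (hπ : C.AnchorCoanchor)
    (hc : L.IsQuadraticForm c) (hnd : ∀ z, (∀ w, c z w = 0) → z = 0)
    (X : ∀ x, B.AtiyahFiber x) (ξ : ∀ x : M, Module.Dual ℝ (TangentSpace 𝓘(ℝ, EM) x))
    (σ : Cₛ^∞⟮𝓘(ℝ, EP); F, V⟯) :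
    L.Represents σ (fun x => h.iso hC hπ hc hnd x (X x, ξ x)) ↔
      ∀ q, σ q = lam q (B.field X q) + cot C (⟨q, rfl⟩ : B.Fib (B.proj q)) (ξ (B.proj q)) := by
  constructor
  · intro hr q
    obtain ⟨hm, e⟩ := hr (B.proj q)
    exact congrFun (congrArg Subtype.val (cls_injective hc hnd e).symm) ⟨q, rfl⟩
  · intro hσ x
    have e : (fun q : B.Fib x => σ q.1) = (h.toKperp x (X x, ξ x)).1 := by
      funext q
      obtain ⟨q, rfl⟩ := q
      exact hσ q
    refine ⟨e ▸ (h.toKperp x (X x, ξ x)).2, congrArg _ (Subtype.ext e.symm)⟩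

end IsAdapted

end LiftedAction

end Reduction

/-! ### Alternating forms from skew functions -/

section Alternating

variable {W : Type*} [AddCommGroup W] [Module ℝ W]

/-- The alternating form of a skew-symmetric function that is linear in its last argument. -/
def alternatingOfTri (f : W → W → W → ℝ) (hadd : ∀ u v w w', f u v (w + w') = f u v w + f u v w')
    (hsmul : ∀ u v (r : ℝ) w, f u v (r • w) = r * f u v w) (h12 : ∀ u v w, f u v w = -f v u w)
    (h23 : ∀ u v w, f u v w = -f u w v) : W [⋀^Fin 3]→ₗ[ℝ] ℝ where
  toFun m := f (m 0) (m 1) (m 2)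
  map_update_add' {inst} m i w w' := by
    obtain rfl : inst = instDecidableEqFin 3 := Subsingleton.elim _ _
    have hadd2 : ∀ u v w w', f u (w + w') v = f u w v + f u w' v := fun u v w w' => by
      rw [h23, hadd, h23 u w, h23 u w']
      ring
    fin_cases i
    · simp only [Fin.zero_eta, Function.update_self, ne_eq, Fin.reduceEq, not_false_eq_true,
        Function.update_of_ne]
      rw [h12, hadd2, h12 w, h12 w']
      ring
    · simp [hadd2]
    · simp [hadd]
  map_update_smul' {inst} m i r w := by
    obtain rfl : inst = instDecidableEqFin 3 := Subsingleton.elim _ _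
    have hsmul2 : ∀ u v (r : ℝ) w, f u (r • w) v = r * f u w v := fun u v r w => by
      rw [h23, hsmul, h23 u w]
      ring
    fin_cases i
    · simp only [Fin.zero_eta, Function.update_self, ne_eq, Fin.reduceEq, not_false_eq_true,
        Function.update_of_ne, smul_eq_mul]
      rw [h12, hsmul2, h12 w]
      ring
    · simp [hsmul2]
    · simp [hsmul]
  map_eq_zero_of_eq' m i j hij hne := by
    have e12 : ∀ u w, f u u w = 0 := fun u w => by linarith [h12 u u w]
    have e23 : ∀ u w, f u w w = 0 := fun u w => by linarith [h23 u w w]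
    have e13 : ∀ u w, f u w u = 0 := fun u w => by linarith [h12 u w u, e23 w u]
    clear h12 h23 hadd hsmul
    fin_cases i <;> fin_cases j <;> simp_all

/-- The alternating form of a skew-symmetric function that is linear in its last argument. -/
def alternatingOfBi (f : W → W → ℝ) (hadd : ∀ u w w', f u (w + w') = f u w + f u w')
    (hsmul : ∀ u (r : ℝ) w, f u (r • w) = r * f u w) (h12 : ∀ u v, f u v = -f v u) :
    W [⋀^Fin 2]→ₗ[ℝ] ℝ where
  toFun m := f (m 0) (m 1)
  map_update_add' {inst} m i w w' := by
    obtain rfl : inst = instDecidableEqFin 2 := Subsingleton.elim _ _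
    fin_cases i
    · simp only [Fin.zero_eta, Function.update_self, ne_eq, not_false_eq_true,
        Function.update_of_ne, one_ne_zero]
      rw [h12, hadd, h12 w, h12 w']
      ring
    · simp [hadd]
  map_update_smul' {inst} m i r w := by
    obtain rfl : inst = instDecidableEqFin 2 := Subsingleton.elim _ _
    fin_cases i
    · simp only [Fin.zero_eta, Function.update_self, ne_eq, not_false_eq_true,
        Function.update_of_ne, one_ne_zero, smul_eq_mul]
      rw [h12, hsmul, h12 w]
      ring
    · simp [hsmul]
  map_eq_zero_of_eq' m i j hij hne := by
    have e12 : ∀ u, f u u = 0 := fun u => by linarith [h12 u u]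
    clear h12 hadd hsmul
    fin_cases i <;> fin_cases j <;> simp_all

end Alternating

/-! ### Skew-symmetry of the bracket on orthogonal sections -/

section Brackets

variable {EP : Type*} [NormedAddCommGroup EP] [NormedSpace ℝ EP]
  {P : Type*} [TopologicalSpace P] [ChartedSpace EP P] [IsManifold 𝓘(ℝ, EP) ∞ P]
  {F : Type*} [NormedAddCommGroup F] [NormedSpace ℝ F]
  {V : P → Type*} [TopologicalSpace (TotalSpace F V)]
  [∀ q, AddCommGroup (V q)] [∀ q, Module ℝ (V q)] [∀ q, TopologicalSpace (V q)]
  [FiberBundle F V] [VectorBundle ℝ F V]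

namespace CourantAlgebroid

variable (C : CourantAlgebroid EP F V) {σ τ υ : Cₛ^∞⟮𝓘(ℝ, EP); F, V⟯}

theorem dirDeriv_pairing_eq_zero {r : ℝ} (h : ∀ q, C.pairing q (σ q) (τ q) = r)
    (X : ∀ q : P, TangentSpace 𝓘(ℝ, EP) q) (q : P) :
    dirDeriv X (fun q' => C.pairing q' (σ q') (τ q')) q = 0 := by
  rw [funext h, dirDeriv_const]

theorem pairing_bracket_swap_of_orthogonal (h : ∀ q, C.pairing q (σ q) (τ q) = 0) (q : P) :
    C.pairing q (C.bracket σ τ q) (υ q) = -C.pairing q (C.bracket τ σ q) (υ q) := by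
  rw [C.pairing_bracket_swap, C.dirDeriv_pairing_eq_zero h, add_zero]

theorem pairing_bracket_comm_of_orthogonal (h : ∀ q, C.pairing q (τ q) (υ q) = 0) (q : P) :
    C.pairing q (C.bracket σ τ q) (υ q) = -C.pairing q (C.bracket σ υ q) (τ q) := by
  rw [C.pairing_bracket_comm, C.dirDeriv_pairing_eq_zero h, zero_sub]

end CourantAlgebroid

end Brackets

/-! ### Brackets of invariant sections and the 3-form -/

section Reduction

variable {EG : Type*} [NormedAddCommGroup EG] [NormedSpace ℝ EG] [FiniteDimensional ℝ EG]
  {G : Type*} [TopologicalSpace G] [ChartedSpace EG G] [Group G] [LieGroup 𝓘(ℝ, EG) ∞ G]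
  {EP : Type*} [NormedAddCommGroup EP] [NormedSpace ℝ EP] [FiniteDimensional ℝ EP]
  {P : Type*} [TopologicalSpace P] [ChartedSpace EP P] [IsManifold 𝓘(ℝ, EP) ∞ P] [T2Space P]
  {EM : Type*} [NormedAddCommGroup EM] [NormedSpace ℝ EM] [FiniteDimensional ℝ EM]
  {M : Type*} [TopologicalSpace M] [ChartedSpace EM M] [IsManifold 𝓘(ℝ, EM) ∞ M] [T2Space M]
  {B : PrincipalBundle EG G EP P EM M}
  {F : Type*} [NormedAddCommGroup F] [NormedSpace ℝ F] [FiniteDimensional ℝ F]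
  {V : P → Type*} [TopologicalSpace (TotalSpace F V)]
  [∀ q, AddCommGroup (V q)] [∀ q, Module ℝ (V q)] [∀ q, TopologicalSpace (V q)]
  [FiberBundle F V] [VectorBundle ℝ F V] [ContMDiffVectorBundle ∞ F V 𝓘(ℝ, EP)]
  {C : CourantAlgebroid EP F V}

namespace LiftedAction

variable {L : LiftedAction B C} {c : LinearMap.BilinForm ℝ (GroupLieAlgebra 𝓘(ℝ, EG) G)}
  {A : B.Connection} {lam : ∀ q, TangentSpace 𝓘(ℝ, EP) q →ₗ[ℝ] V q}

variable (L) in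
/-- `G`-invariant sections of `K^⊥`. -/
def IsInvariantPerp (σ : Cₛ^∞⟮𝓘(ℝ, EP); F, V⟯) : Prop :=
  (∀ q z, C.pairing q (σ q) (L.rho z q) = 0) ∧ ∀ q g, σ (B.act q g) = L.lift g q (σ q)

theorem IsInvariantPerp.mem_quot {σ : Cₛ^∞⟮𝓘(ℝ, EP); F, V⟯} (hσ : L.IsInvariantPerp σ) (x : M) :
    (fun q : B.Fib x => σ q.1) ∈ L.quot L.Kperp x :=
  ⟨fun q => by
    rintro _ ⟨z, rfl⟩
    exact hσ.1 q.1 z, fun q g => hσ.2 q.1 g⟩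

/-- For invariant `σ` the function `g ↦ g⁻¹·σ(qg)` is constant, and the bracket is its derivative at
`1`. -/
theorem IsInvariantPerp.bracket_rho {σ : Cₛ^∞⟮𝓘(ℝ, EP); F, V⟯} (hσ : L.IsInvariantPerp σ)
    (z : GroupLieAlgebra 𝓘(ℝ, EG) G) (q : P) : C.bracket (L.rho z) σ q = 0 := by
  refine (Module.forall_dual_apply_eq_zero_iff ℝ _).1 fun ℓ => ?_
  rw [← L.integrates z σ q ℓ]
  simp only [hσ.2, LinearEquiv.symm_apply_apply, mvfderiv_const]
  rfl

/-- Orthogonality gives `⟨[σ,τ], ρ(z)⟩ = -⟨[σ,ρ(z)], τ⟩ = ⟨[ρ(z),σ], τ⟩ = 0`. Invariance holds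
because `G` acts by automorphisms of the bracket. -/
theorem IsInvariantPerp.bracket {σ τ : Cₛ^∞⟮𝓘(ℝ, EP); F, V⟯} (hσ : L.IsInvariantPerp σ)
    (hτ : L.IsInvariantPerp τ) : L.IsInvariantPerp (C.bracket σ τ) := by
  refine ⟨fun q z => ?_, fun q g => ?_⟩
  · rw [C.pairing_bracket_comm_of_orthogonal (fun q => hτ.1 q z),
      C.pairing_bracket_swap_of_orthogonal (fun q => hσ.1 q z), hσ.bracket_rho]
    simp
  · exact (L.lift_bracket g σ σ τ τ (fun q => (hσ.2 q g).symm) (fun q => (hτ.2 q g).symm) q).symm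

/-- The section `½ π^* p^* ξ`. -/
def cotSec (C : CourantAlgebroid EP F V) {ξ : ∀ x : M, Module.Dual ℝ (TangentSpace 𝓘(ℝ, EM) x)}
    (B : PrincipalBundle EG G EP P EM M) (hξ : SmoothCovector ξ) : Cₛ^∞⟮𝓘(ℝ, EP); F, V⟯ :=
  ⟨fun q => cot C (⟨q, rfl⟩ : B.Fib (B.proj q)) (ξ (B.proj q)), contMDiff_cot hξ⟩

theorem pairing_cotSec {ξ : ∀ x : M, Module.Dual ℝ (TangentSpace 𝓘(ℝ, EM) x)}
    (hξ : SmoothCovector ξ) (q : P) (w : V q) :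
    C.pairing q (cotSec C B hξ q) w = (1 / 2 : ℝ) * ξ (B.proj q) (B.dProj q (C.anchor q w)) :=
  pairing_cot C (⟨q, rfl⟩ : B.Fib (B.proj q)) (ξ (B.proj q)) w

theorem dProj_anchor_bracket {τ υ : Cₛ^∞⟮𝓘(ℝ, EP); F, V⟯} {Y Z : ∀ x : M, TangentSpace 𝓘(ℝ, EM) x}
    (hY : B.Projects (fun q => C.anchor q (τ q)) Y) (hZ : B.Projects (fun q => C.anchor q (υ q)) Z)
    (q : P) : B.dProj q (C.anchor q (C.bracket τ υ q)) =
      mlieBracket 𝓘(ℝ, EM) Y Z (B.proj q) := by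
  rw [C.anchor_bracket]
  exact mfderiv_mlieBracket_of_related B.contMDiff_proj (C.anchor_smooth τ) (C.anchor_smooth υ)
    (hY.smoothField B (C.anchor_smooth τ)) (hZ.smoothField B (C.anchor_smooth υ)) hY hZ q

theorem dirDeriv_pairing_cotSec {τ υ : Cₛ^∞⟮𝓘(ℝ, EP); F, V⟯}
    {Y Z : ∀ x : M, TangentSpace 𝓘(ℝ, EM) x}
    (hY : B.Projects (fun q => C.anchor q (τ q)) Y) (hZ : B.Projects (fun q => C.anchor q (υ q)) Z)
    {ξ : ∀ x : M, Module.Dual ℝ (TangentSpace 𝓘(ℝ, EM) x)} (hξ : SmoothCovector ξ) (q : P) :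
    dirDeriv (fun q' => C.anchor q' (τ q')) (fun q' => C.pairing q' (cotSec C B hξ q') (υ q')) q =
      (1 / 2 : ℝ) * dirDeriv Y (fun x => ξ x (Z x)) (B.proj q) := by
  have hs := hξ Z (hZ.smoothField B (C.anchor_smooth υ))
  have e : (fun q' => C.pairing q' (cotSec C B hξ q') (υ q')) =
      fun q' => (1 / 2 : ℝ) * ξ (B.proj q') (Z (B.proj q')) := by
    funext q'
    rw [pairing_cotSec, hZ q']
  have hs' : ContMDiff 𝓘(ℝ, EP) 𝓘(ℝ, ℝ) ∞ (fun q' => ξ (B.proj q') (Z (B.proj q'))) :=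
    hs.comp B.contMDiff_proj
  rw [e, dirDeriv_const_mul _ _ hs']
  congr 1
  exact dirDeriv_comp B.contMDiff_proj hs (hY q)

theorem pairing_bracket_cotSec_right {τ υ : Cₛ^∞⟮𝓘(ℝ, EP); F, V⟯}
    {Y Z : ∀ x : M, TangentSpace 𝓘(ℝ, EM) x}
    (hY : B.Projects (fun q => C.anchor q (τ q)) Y) (hZ : B.Projects (fun q => C.anchor q (υ q)) Z)
    {η : ∀ x : M, Module.Dual ℝ (TangentSpace 𝓘(ℝ, EM) x)} (hη : SmoothCovector η) (q : P) :
    C.pairing q (C.bracket τ (cotSec C B hη) q) (υ q) =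
      (1 / 2 : ℝ) * lieDerivOne Y η Z (B.proj q) := by
  rw [C.pairing_bracket_comm, dirDeriv_pairing_cotSec hY hZ, C.pairing_symm, pairing_cotSec,
    dProj_anchor_bracket hY hZ, lieDerivOne]
  ring

/-- Exchanging the arguments costs the differential of `⟨ξ, τ⟩`, which turns `-L_Y ξ` into `-i_Y dξ`
by Cartan's formula. -/
theorem pairing_bracket_cotSec_left {τ υ : Cₛ^∞⟮𝓘(ℝ, EP); F, V⟯}
    {Y Z : ∀ x : M, TangentSpace 𝓘(ℝ, EM) x}
    (hY : B.Projects (fun q => C.anchor q (τ q)) Y) (hZ : B.Projects (fun q => C.anchor q (υ q)) Z)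
    {ξ : ∀ x : M, Module.Dual ℝ (TangentSpace 𝓘(ℝ, EM) x)} (hξ : SmoothCovector ξ) (q : P) :
    C.pairing q (C.bracket (cotSec C B hξ) τ q) (υ q) =
      -(1 / 2 : ℝ) * extDerivOne ξ Y Z (B.proj q) := by
  rw [C.pairing_bracket_swap, pairing_bracket_cotSec_right hY hZ, dirDeriv_pairing_cotSec hZ hY,
    lieDerivOne, extDerivOne]
  ring

namespace IsAdapted

/-- The section `λ X`. -/
def sec (h : L.IsAdapted c A lam) {X : ∀ q : P, TangentSpace 𝓘(ℝ, EP) q} (hX : SmoothField X) :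
    Cₛ^∞⟮𝓘(ℝ, EP); F, V⟯ :=
  ⟨fun q => lam q (X q), h.smooth X hX⟩

theorem sec_apply (h : L.IsAdapted c A lam) {X : ∀ q : P, TangentSpace 𝓘(ℝ, EP) q}
    (hX : SmoothField X) (q : P) : h.sec hX q = lam q (X q) := rfl

theorem anchor_sec (h : L.IsAdapted c A lam) {X : ∀ q : P, TangentSpace 𝓘(ℝ, EP) q}
    (hX : SmoothField X) (q : P) : C.anchor q (h.sec hX q) = X q := h.anchor q _

theorem pairing_sec (h : L.IsAdapted c A lam) {X Y : ∀ q : P, TangentSpace 𝓘(ℝ, EP) q}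
    (hX : SmoothField X) (hY : SmoothField Y) (q : P) :
    C.pairing q (h.sec hX q) (h.sec hY q) = c (A.form q (X q)) (A.form q (Y q)) :=
  h.pairing q _ _

theorem anchor_bracket_sec (h : L.IsAdapted c A lam) {X Y : ∀ q : P, TangentSpace 𝓘(ℝ, EP) q}
    (hX : SmoothField X) (hY : SmoothField Y) (q : P) :
    C.anchor q (C.bracket (h.sec hX) (h.sec hY) q) = mlieBracket 𝓘(ℝ, EP) X Y q := by
  rw [C.anchor_bracket]
  simp only [anchor_sec]

theorem isInvariantPerp_sec (h : L.IsAdapted c A lam) {X : ∀ q : P, TangentSpace 𝓘(ℝ, EP) q}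
    (hX : SmoothField X) (hX' : ∀ q g, X (B.act q g) = B.dAct g q (X q)) :
    L.IsInvariantPerp (h.sec hX) :=
  ⟨fun q z => h.rho q _ z, fun q g => by rw [sec_apply, sec_apply, h.lift, hX']⟩

theorem isInvariantPerp_cotSec {ξ : ∀ x : M, Module.Dual ℝ (TangentSpace 𝓘(ℝ, EM) x)}
    (hξ : SmoothCovector ξ) : L.IsInvariantPerp (cotSec C B hξ) := by
  refine ⟨fun q z => cot_mem_Kperp (⟨q, rfl⟩ : B.Fib (B.proj q)) _ _ ⟨z, rfl⟩, fun q g => ?_⟩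
  have key : ∀ (x : M) (hx : B.proj (B.act q g) = x),
      cotSec C B hξ (B.act q g) = cot C (⟨B.act q g, hx⟩ : B.Fib x) (ξ x) := by
    rintro _ rfl
    rfl
  exact (key _ (B.proj_act q g)).trans (L.lift_cot ⟨q, rfl⟩ g _)

theorem isInvariantPerp_add {σ τ : Cₛ^∞⟮𝓘(ℝ, EP); F, V⟯} (hσ : L.IsInvariantPerp σ)
    (hτ : L.IsInvariantPerp τ) : L.IsInvariantPerp (σ + τ) :=
  ⟨fun q z => by simp [hσ.1, hτ.1], fun q g => by simp [hσ.2, hτ.2]⟩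

/-- The pairing of `λ v`, for `v` vertical, with elements of `K^⊥`. -/
theorem pairing_vertical (h : L.IsAdapted c A lam) (hC : C.IsExact) {q : P}
    {v : TangentSpace 𝓘(ℝ, EP) q} (hv : B.dProj q v = 0) {u : V q}
    (hu : ∀ z, C.pairing q u (L.rho z q) = 0) :
    C.pairing q u (lam q v) = c (A.form q v) (A.form q (C.anchor q u)) := by
  obtain ⟨z, rfl⟩ := B.exists_fundamental_eq hv
  -- The difference `u - λπ(u)` is `π^*α`. It is orthogonal to `ρ(z)`, so `α(Y_z) = 0`, and hence it
  -- is also orthogonal to `λ(Y_z)`.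
  obtain ⟨α, hα⟩ := C.exists_coanchor_eq hC (q := q) (v := u - lam q (C.anchor q u))
    (by rw [map_sub, h.anchor, sub_self])
  have h1 := C.pairing_coanchor q α (L.rho z q)
  have h2 := C.pairing_coanchor q α (lam q (B.fundamental q z))
  rw [hα, map_sub, LinearMap.sub_apply, hu, h.rho, L.anchor_rho, sub_zero] at h1
  rw [hα, h.anchor, ← h1, map_sub, LinearMap.sub_apply,
    C.pairing_symm q (lam q (C.anchor q u)), h.pairing] at h2
  linarith

/-- The bracket stays in `K^⊥`, where pairing with `λ` of a vertical vector sees only the anchor,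
here the Lie bracket `[X, Y]`. -/
theorem pairing_bracket_sec_vertical (h : L.IsAdapted c A lam) (hC : C.IsExact)
    {X Y S : ∀ q : P, TangentSpace 𝓘(ℝ, EP) q} (hX : SmoothField X) (hY : SmoothField Y)
    (hS : SmoothField S) (hX' : ∀ q g, X (B.act q g) = B.dAct g q (X q))
    (hY' : ∀ q g, Y (B.act q g) = B.dAct g q (Y q)) (hS' : ∀ q, B.dProj q (S q) = 0) (q : P) :
    C.pairing q (C.bracket (h.sec hX) (h.sec hY) q) (h.sec hS q) =
      c (A.form q (S q)) (A.form q (mlieBracket 𝓘(ℝ, EP) X Y q)) := by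
  rw [sec_apply h hS, h.pairing_vertical hC (hS' q), h.anchor_bracket_sec]
  exact ((h.isInvariantPerp_sec hX hX').bracket (h.isInvariantPerp_sec hY hY')).1 q

theorem ver_act {L : LiftedAction B C} (hL : L.IsEquivariant)
    {X : ∀ q : P, TangentSpace 𝓘(ℝ, EP) q} (hX' : ∀ q g, X (B.act q g) = B.dAct g q (X q))
    (q : P) (g : G) : A.ver X (B.act q g) = B.dAct g q (A.ver X q) := by
  rw [PrincipalBundle.Connection.ver, PrincipalBundle.Connection.ver, dAct_fundamental hL, hX',
    A.equivariant]

theorem hor_act {L : LiftedAction B C} (hL : L.IsEquivariant)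
    {X : ∀ q : P, TangentSpace 𝓘(ℝ, EP) q} (hX' : ∀ q g, X (B.act q g) = B.dAct g q (X q))
    (q : P) (g : G) : A.hor X (B.act q g) = B.dAct g q (A.hor X q) := by
  rw [PrincipalBundle.Connection.hor, PrincipalBundle.Connection.hor, ver_act hL hX', hX', map_sub]

theorem sec_eq_add (h : L.IsAdapted c A lam) {X : ∀ q : P, TangentSpace 𝓘(ℝ, EP) q}
    (hX : SmoothField X) :
    h.sec hX = h.sec (A.smoothField_hor hX) + h.sec (A.smoothField_ver hX) := by
  ext q
  rw [ContMDiffSection.coe_add, Pi.add_apply, sec_apply, sec_apply, sec_apply, ← map_add,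
    PrincipalBundle.Connection.hor, sub_add_cancel]

/-- The part of the Dorfman bracket that involves the connection. -/
theorem pairing_bracket_sec (h : L.IsAdapted c A lam) (hC : C.IsExact) (hL : L.IsEquivariant)
    (hc : L.IsQuadraticForm c)
    {X Y Z : ∀ q : P, TangentSpace 𝓘(ℝ, EP) q} (hX : SmoothField X) (hY : SmoothField Y)
    (hZ : SmoothField Z) (hX' : ∀ q g, X (B.act q g) = B.dAct g q (X q))
    (hY' : ∀ q g, Y (B.act q g) = B.dAct g q (Y q))
    (hZ' : ∀ q g, Z (B.act q g) = B.dAct g q (Z q)) (hZh : ∀ q, A.form q (Z q) = 0) (q : P) :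
    C.pairing q (C.bracket (h.sec hX) (h.sec hY) q) (h.sec hZ q) =
      C.pairing q (C.bracket (h.sec (A.smoothField_hor hX)) (h.sec (A.smoothField_hor hY)) q)
        (h.sec hZ q) + c (A.covDeriv Z X q) (A.form q (Y q)) + c (A.curv X Z q) (A.form q (Y q))
        - c (A.curv Y Z q) (A.form q (X q)) := by
  have hhZ : A.hor Z = Z := by
    funext q
    rw [PrincipalBundle.Connection.hor, PrincipalBundle.Connection.ver, hZh,
      ← B.fundamentalₗ_apply, map_zero, sub_zero]
  have sXh := A.smoothField_hor hX
  have sXv := A.smoothField_ver hX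
  have sYh := A.smoothField_hor hY
  have sYv := A.smoothField_ver hY
  -- Horizontal and vertical fields stay orthogonal under `λ`. This licenses the exchanges that
  -- bring a vertical field to the last slot in each of the terms `vh`, `hv` and `vv`.
  have o1 : ∀ q, C.pairing q (h.sec sXv q) (h.sec sYh q) = 0 := fun q => by
    rw [h.pairing_sec, A.form_hor, map_zero]
  have o2 : ∀ q, C.pairing q (h.sec sXv q) (h.sec hZ q) = 0 := fun q => by
    rw [h.pairing_sec, hZh, map_zero]
  have o3 : ∀ q, C.pairing q (h.sec sYv q) (h.sec hZ q) = 0 := fun q => by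
    rw [h.pairing_sec, hZh, map_zero]
  have vh : C.pairing q (C.bracket (h.sec sXv) (h.sec sYh) q) (h.sec hZ q) =
      -c (A.curv Y Z q) (A.form q (X q)) := by
    rw [C.pairing_bracket_swap_of_orthogonal o1, C.pairing_bracket_comm_of_orthogonal o2,
      h.pairing_bracket_sec_vertical hC sYh hZ sXv (hor_act hL hY') hZ' (A.dProj_ver X),
      A.form_ver, hc.1, PrincipalBundle.Connection.curv, hhZ]
    simp
  have hv : C.pairing q (C.bracket (h.sec sXh) (h.sec sYv) q) (h.sec hZ q) =
      c (A.curv X Z q) (A.form q (Y q)) := by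
    rw [C.pairing_bracket_comm_of_orthogonal o3,
      h.pairing_bracket_sec_vertical hC sXh hZ sYv (hor_act hL hX') hZ' (A.dProj_ver Y),
      A.form_ver, hc.1, PrincipalBundle.Connection.curv, hhZ]
    simp
  have vv : C.pairing q (C.bracket (h.sec sXv) (h.sec sYv) q) (h.sec hZ q) =
      c (A.covDeriv Z X q) (A.form q (Y q)) := by
    rw [C.pairing_bracket_comm_of_orthogonal o3, C.pairing_bracket_swap_of_orthogonal o2,
      h.pairing_bracket_sec_vertical hC hZ sXv sYv hZ' (ver_act hL hX') (A.dProj_ver Y),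
      A.form_ver, hc.1, PrincipalBundle.Connection.covDeriv]
    simp
  rw [h.sec_eq_add hX, h.sec_eq_add hY]
  simp only [map_add, LinearMap.add_apply, ContMDiffSection.coe_add, Pi.add_apply]
  rw [vh, hv, vv]
  ring

/-- The section `λ (A^⊥ Z)` for a smooth vector field `Z` on the base. -/
def horSec (h : L.IsAdapted c A lam) :
    Cₛ^∞⟮𝓘(ℝ, EM); EM, (TangentSpace 𝓘(ℝ, EM) : M → Type _)⟯ →ₗ[ℝ] Cₛ^∞⟮𝓘(ℝ, EP); F, V⟯ where
  toFun Z := h.sec (A.smoothField_hlift Z.contMDiff)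
  map_add' Z Z' := by
    ext q
    change lam q (A.hlift q (Z (B.proj q) + Z' (B.proj q))) =
      lam q (A.hlift q (Z (B.proj q))) + lam q (A.hlift q (Z' (B.proj q)))
    rw [map_add, map_add]
  map_smul' r Z := by
    ext q
    change lam q (A.hlift q (r • Z (B.proj q))) = r • lam q (A.hlift q (Z (B.proj q)))
    rw [map_smul, map_smul]

theorem horSec_apply (h : L.IsAdapted c A lam)
    (Z : Cₛ^∞⟮𝓘(ℝ, EM); EM, (TangentSpace 𝓘(ℝ, EM) : M → Type _)⟯) (q : P) :
    h.horSec Z q = lam q (A.hlift q (Z (B.proj q))) := rfl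

theorem isInvariantPerp_horSec (h : L.IsAdapted c A lam)
    (Z : Cₛ^∞⟮𝓘(ℝ, EM); EM, (TangentSpace 𝓘(ℝ, EM) : M → Type _)⟯) :
    L.IsInvariantPerp (h.horSec Z) :=
  h.isInvariantPerp_sec (A.smoothField_hlift Z.contMDiff) fun q g =>
    B.field_act (fun x => A.atiyahLift x (Z x)) q g

theorem pairing_horSec (h : L.IsAdapted c A lam)
    (Y Z : Cₛ^∞⟮𝓘(ℝ, EM); EM, (TangentSpace 𝓘(ℝ, EM) : M → Type _)⟯) (q : P) :
    C.pairing q (h.horSec Y q) (h.horSec Z q) = 0 := by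
  rw [horSec_apply, horSec_apply, h.pairing, A.form_hlift, A.form_hlift, map_zero]

/-- The function `2⟨[λ X, λ Y], λ Z⟩` for horizontal lifts. -/
def tri (h : L.IsAdapted c A lam) (q : P)
    (X Y Z : Cₛ^∞⟮𝓘(ℝ, EM); EM, (TangentSpace 𝓘(ℝ, EM) : M → Type _)⟯) : ℝ :=
  2 * C.pairing q (C.bracket (h.horSec X) (h.horSec Y) q) (h.horSec Z q)

theorem tri_swap (h : L.IsAdapted c A lam) (q : P)
    (X Y Z : Cₛ^∞⟮𝓘(ℝ, EM); EM, (TangentSpace 𝓘(ℝ, EM) : M → Type _)⟯) :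
    h.tri q X Y Z = -h.tri q Y X Z := by
  rw [tri, tri, C.pairing_bracket_swap_of_orthogonal (h.pairing_horSec X Y)]
  ring

theorem tri_comm (h : L.IsAdapted c A lam) (q : P)
    (X Y Z : Cₛ^∞⟮𝓘(ℝ, EM); EM, (TangentSpace 𝓘(ℝ, EM) : M → Type _)⟯) :
    h.tri q X Y Z = -h.tri q X Z Y := by
  rw [tri, tri, C.pairing_bracket_comm_of_orthogonal (h.pairing_horSec Y Z)]
  ring

theorem tri_congr_right (h : L.IsAdapted c A lam) (q : P)
    (X Y : Cₛ^∞⟮𝓘(ℝ, EM); EM, (TangentSpace 𝓘(ℝ, EM) : M → Type _)⟯)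
    {Z Z' : Cₛ^∞⟮𝓘(ℝ, EM); EM, (TangentSpace 𝓘(ℝ, EM) : M → Type _)⟯}
    (hZ : Z (B.proj q) = Z' (B.proj q)) : h.tri q X Y Z = h.tri q X Y Z' := by
  rw [tri, tri, h.horSec_apply Z', h.horSec_apply Z, hZ]

/-- `tri` depends only on the values of the vector fields at the point. -/
theorem tri_congr (h : L.IsAdapted c A lam) (q : P)
    {X Y Z X' Y' Z' : Cₛ^∞⟮𝓘(ℝ, EM); EM, (TangentSpace 𝓘(ℝ, EM) : M → Type _)⟯}
    (hX : X (B.proj q) = X' (B.proj q)) (hY : Y (B.proj q) = Y' (B.proj q))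
    (hZ : Z (B.proj q) = Z' (B.proj q)) : h.tri q X Y Z = h.tri q X' Y' Z' := by
  -- Dependence on the last argument is visibly pointwise; skew-symmetry brings each argument there
  -- in turn, in place of a computation with the Leibniz rule.
  rw [h.tri_congr_right q X Y hZ, h.tri_comm, h.tri_congr_right q X Z' hY, h.tri_swap,
    h.tri_comm, h.tri_congr_right q Z' Y' hX, h.tri_comm q Z', h.tri_swap q Z', h.tri_comm q X']
  simp only [neg_neg]

/-- All sections involved are invariant and the action preserves the pairing; this lets the form
descend to `M`. -/
theorem tri_act (h : L.IsAdapted c A lam) (q : P) (g : G)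
    (X Y Z : Cₛ^∞⟮𝓘(ℝ, EM); EM, (TangentSpace 𝓘(ℝ, EM) : M → Type _)⟯) :
    h.tri (B.act q g) X Y Z = h.tri q X Y Z := by
  rw [tri, tri, ((h.isInvariantPerp_horSec X).bracket (h.isInvariantPerp_horSec Y)).2,
    (h.isInvariantPerp_horSec Z).2, L.lift_pairing]

theorem tri_eq_of_proj_eq (h : L.IsAdapted c A lam) {q q' : P} (hq : B.proj q = B.proj q')
    (X Y Z : Cₛ^∞⟮𝓘(ℝ, EM); EM, (TangentSpace 𝓘(ℝ, EM) : M → Type _)⟯) :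
    h.tri q X Y Z = h.tri q' X Y Z := by
  obtain ⟨g, rfl⟩ := B.exists_act_eq hq
  rw [h.tri_act]

variable (EM) in
/-- A linear choice of smooth vector fields with given values at a point. -/
def _root_.CourantReduction.extendField (x : M) : TangentSpace 𝓘(ℝ, EM) x →ₗ[ℝ]
    Cₛ^∞⟮𝓘(ℝ, EM); EM, (TangentSpace 𝓘(ℝ, EM) : M → Type _)⟯ :=
  (LinearMap.exists_rightInverse_of_surjective
    ({ toFun := fun Z => Z x
       map_add' := fun _ _ => rfl
       map_smul' := fun _ _ => rfl } :
      Cₛ^∞⟮𝓘(ℝ, EM); EM, (TangentSpace 𝓘(ℝ, EM) : M → Type _)⟯ →ₗ[ℝ] TangentSpace 𝓘(ℝ, EM) x)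
    (LinearMap.range_eq_top.2 fun v => exists_section_apply_eq (E := EM) (F := EM) v)).choose

theorem _root_.CourantReduction.extendField_apply (x : M) (v : TangentSpace 𝓘(ℝ, EM) x) :
    extendField EM x v x = v :=
  LinearMap.congr_fun (LinearMap.exists_rightInverse_of_surjective
    ({ toFun := fun Z => Z x
       map_add' := fun _ _ => rfl
       map_smul' := fun _ _ => rfl } :
      Cₛ^∞⟮𝓘(ℝ, EM); EM, (TangentSpace 𝓘(ℝ, EM) : M → Type _)⟯ →ₗ[ℝ] TangentSpace 𝓘(ℝ, EM) x)
    (LinearMap.range_eq_top.2 fun v => exists_section_apply_eq (E := EM) (F := EM) v)).choose_spec v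

/-- The `3`-form of an adapted splitting, at a point. -/
def formAt (h : L.IsAdapted c A lam) (x : M) : (TangentSpace 𝓘(ℝ, EM) x) [⋀^Fin 3]→ₗ[ℝ] ℝ :=
  alternatingOfTri
    (fun u v w => h.tri (B.nonempty_fib x).some.1 (extendField EM x u) (extendField EM x v)
      (extendField EM x w))
    (fun u v w w' => by simp only [tri, map_add, ContMDiffSection.coe_add, Pi.add_apply]; ring)
    (fun u v r w => by
      simp only [tri, map_smul, ContMDiffSection.coe_smul, Pi.smul_apply, smul_eq_mul]; ring)
    (fun _ _ _ => h.tri_swap _ _ _ _) (fun _ _ _ => h.tri_comm _ _ _ _)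

/-- The chosen fibre point and the chosen extensions are immaterial, by invariance and pointwise
dependence of `tri`. -/
theorem formAt_apply (h : L.IsAdapted c A lam) (q : P)
    (X Y Z : Cₛ^∞⟮𝓘(ℝ, EM); EM, (TangentSpace 𝓘(ℝ, EM) : M → Type _)⟯) :
    h.formAt (B.proj q) ![X (B.proj q), Y (B.proj q), Z (B.proj q)] = h.tri q X Y Z := by
  refine (h.tri_eq_of_proj_eq (B.nonempty_fib (B.proj q)).some.2 _ _ _).trans ?_
  exact h.tri_congr q (extendField_apply _ _) (extendField_apply _ _) (extendField_apply _ _)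

/-- The `3`-form of an adapted splitting. -/
def threeForm (h : L.IsAdapted c A lam) : SmoothForm EM M 3 where
  toFun := h.formAt
  smooth X hX := by
    refine B.contMDiff_of_comp_proj ?_
    let Y : Fin 3 → Cₛ^∞⟮𝓘(ℝ, EM); EM, (TangentSpace 𝓘(ℝ, EM) : M → Type _)⟯ :=
      fun i => ⟨X i, hX i⟩
    have hs : ContMDiff 𝓘(ℝ, EP) 𝓘(ℝ, ℝ) ∞ (fun q => h.tri q (Y 0) (Y 1) (Y 2)) :=
      contMDiff_const.mul (C.pairing_smooth _ _)
    refine hs.congr fun q => Eq.trans ?_ (h.formAt_apply q (Y 0) (Y 1) (Y 2))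
    congr 1
    funext i
    fin_cases i <;> rfl

end IsAdapted

end LiftedAction

end Reduction

/-! ### Existence of a presentation -/

section Reduction

variable {EG : Type*} [NormedAddCommGroup EG] [NormedSpace ℝ EG] [FiniteDimensional ℝ EG]
  {G : Type*} [TopologicalSpace G] [ChartedSpace EG G] [Group G] [LieGroup 𝓘(ℝ, EG) ∞ G]
  {EP : Type*} [NormedAddCommGroup EP] [NormedSpace ℝ EP] [FiniteDimensional ℝ EP]
  {P : Type*} [TopologicalSpace P] [ChartedSpace EP P] [IsManifold 𝓘(ℝ, EP) ∞ P] [T2Space P]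
  {EM : Type*} [NormedAddCommGroup EM] [NormedSpace ℝ EM] [FiniteDimensional ℝ EM]
  {M : Type*} [TopologicalSpace M] [ChartedSpace EM M] [IsManifold 𝓘(ℝ, EM) ∞ M] [T2Space M]
  {B : PrincipalBundle EG G EP P EM M}
  {F : Type*} [NormedAddCommGroup F] [NormedSpace ℝ F] [FiniteDimensional ℝ F]
  {V : P → Type*} [TopologicalSpace (TotalSpace F V)]
  [∀ q, AddCommGroup (V q)] [∀ q, Module ℝ (V q)] [∀ q, TopologicalSpace (V q)]
  [FiberBundle F V] [VectorBundle ℝ F V] [ContMDiffVectorBundle ∞ F V 𝓘(ℝ, EP)]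
  {C : CourantAlgebroid EP F V}

namespace LiftedAction

variable {L : LiftedAction B C} {c : LinearMap.BilinForm ℝ (GroupLieAlgebra 𝓘(ℝ, EG) G)}
  {A : B.Connection} {lam : ∀ q, TangentSpace 𝓘(ℝ, EP) q →ₗ[ℝ] V q}

namespace IsAdapted

/-- Since `A` vanishes on horizontal vectors, `λ(A^⊥u)` is orthogonal to the image of `λ`. Pairing
with it thus extracts the covector component. -/
theorem two_mul_pairing_hlift (h : L.IsAdapted c A lam) (q : P) (v : TangentSpace 𝓘(ℝ, EP) q)
    (ξ : Module.Dual ℝ (TangentSpace 𝓘(ℝ, EM) (B.proj q)))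
    (u : TangentSpace 𝓘(ℝ, EM) (B.proj q)) :
    2 * C.pairing q (lam q v + cot C (⟨q, rfl⟩ : B.Fib (B.proj q)) ξ) (lam q (A.hlift q u)) =
      ξ u := by
  have h1 := pairing_cot C (⟨q, rfl⟩ : B.Fib (B.proj q)) ξ (lam q (A.hlift q u))
  have h2 : B.dProjFib (⟨q, rfl⟩ : B.Fib (B.proj q)) (A.hlift q u) = u := A.dProj_hlift q u
  rw [h.anchor, h2] at h1
  rw [map_add, LinearMap.add_apply, h.pairing, A.form_hlift, map_zero]
  change 2 * (0 + C.pairing q (cot C (⟨q, rfl⟩ : B.Fib (B.proj q)) ξ) (lam q (A.hlift q u))) = ξ u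
  linarith

/-- Every invariant section of `K^⊥` induces a section of `TP/G ⊕ T^*M`. -/
theorem exists_represents (h : L.IsAdapted c A lam) (hC : C.IsExact) (hπ : C.AnchorCoanchor)
    (hc : L.IsQuadraticForm c) (hnd : ∀ z, (∀ w, c z w = 0) → z = 0)
    {σ : Cₛ^∞⟮𝓘(ℝ, EP); F, V⟯} (hσ : L.IsInvariantPerp σ) :
    ∃ (X : ∀ x, B.AtiyahFiber x) (ξ : ∀ x : M, Module.Dual ℝ (TangentSpace 𝓘(ℝ, EM) x)),
      L.Represents σ (fun x => h.iso hC hπ hc hnd x (X x, ξ x)) := by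
  choose a ha using fun x => (h.toKperp_bijective hC hπ x).2 ⟨_, hσ.mem_quot x⟩
  exact ⟨fun x => (a x).1, fun x => (a x).2, fun x => ⟨hσ.mem_quot x, congrArg L.cls (ha x)⟩⟩

theorem horSec_eq_sec_hor (h : L.IsAdapted c A lam) {X : ∀ q : P, TangentSpace 𝓘(ℝ, EP) q}
    (hX : SmoothField X) {Xm : ∀ x : M, TangentSpace 𝓘(ℝ, EM) x} (hXm : B.Projects X Xm) :
    h.horSec ⟨Xm, hXm.smoothField B hX⟩ = h.sec (A.smoothField_hor hX) := by
  ext q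
  rw [sec_apply, A.hor_eq_hlift, hXm q]
  rfl

/-- The presentation of the reduced Courant algebroid defined by an adapted splitting. -/
theorem isPresentation (h : L.IsAdapted c A lam) (hC : C.IsExact) (hπ : C.AnchorCoanchor)
    (hL : L.IsEquivariant) (hc : L.IsQuadraticForm c) (hnd : ∀ z, (∀ w, c z w = 0) → z = 0) :
    L.IsPresentation c A (h.iso hC hπ hc hnd) h.threeForm where
  smooth_iff X ξ := by
    constructor
    · rintro ⟨σ, hσ⟩
      rw [h.represents_iso_iff hC hπ hc hnd] at hσ
      have e : (fun q => C.anchor q (σ q)) = B.field X := funext fun q => by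
        rw [hσ q, map_add, h.anchor]
        exact (congrArg (B.field X q + ·)
        (anchor_cot hπ (⟨q, rfl⟩ : B.Fib (B.proj q)) (ξ (B.proj q)))).trans (add_zero _)
      refine ⟨e ▸ C.anchor_smooth σ, fun Z hZ => B.contMDiff_of_comp_proj ?_⟩
      have hs : ContMDiff 𝓘(ℝ, EP) 𝓘(ℝ, ℝ) ∞
          (fun q => 2 * C.pairing q (σ q) (h.sec (A.smoothField_hlift hZ) q)) :=
        contMDiff_const.mul (C.pairing_smooth _ _)
      refine hs.congr fun q => ?_
      rw [hσ q, sec_apply]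
      exact (h.two_mul_pairing_hlift q _ _ _).symm
    · rintro ⟨hX, hξ⟩
      exact ⟨h.sec hX + cotSec C B hξ, (h.represents_iso_iff hC hπ hc hnd _ _ _).2 fun q => rfl⟩
  proj x X ξ u hu q := by
    have e : h.toKperp x (X, ξ) = u := cls_injective hc hnd hu
    rw [← e, toKperp_apply, map_add, h.anchor, anchor_cot hπ, add_zero]
  pairing_eq q X Y ξ η := by
    have h1 : ∀ (ξ : Module.Dual ℝ (TangentSpace 𝓘(ℝ, EM) (B.proj q))) v,
        C.pairing q (cot C (⟨q, rfl⟩ : B.Fib (B.proj q)) ξ) (lam q v) =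
          (1 / 2 : ℝ) * ξ (B.dProj q v) := fun ξ v =>
      (pairing_cot C (⟨q, rfl⟩ : B.Fib (B.proj q)) ξ (lam q v)).trans (by rw [h.anchor]; rfl)
    have h2 : C.pairing q (cot C (⟨q, rfl⟩ : B.Fib (B.proj q)) ξ)
        (cot C (⟨q, rfl⟩ : B.Fib (B.proj q)) η) = 0 :=
      (pairing_cot C (⟨q, rfl⟩ : B.Fib (B.proj q)) ξ _).trans (by
        rw [anchor_cot hπ, map_zero, map_zero, mul_zero])
    change C.pairing q (lam q (X.1 ⟨q, rfl⟩) + cot C (⟨q, rfl⟩ : B.Fib (B.proj q)) ξ)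
      (lam q (Y.1 ⟨q, rfl⟩) + cot C (⟨q, rfl⟩ : B.Fib (B.proj q)) η) = _
    refine (LinearMap.BilinForm.add_left _ _ _).trans ?_
    refine (congrArg₂ (· + ·) (LinearMap.BilinForm.add_right _ _ _)
      (LinearMap.BilinForm.add_right _ _ _)).trans ?_
    refine (congrArg₂ (· + ·) (congrArg₂ (· + ·) (h.pairing _ _ _)
      ((C.pairing_symm _ _ _).trans (h1 _ _))) (congrArg₂ (· + ·) (h1 _ _) h2)).trans ?_
    ring
  bracket_eq X Y ξ η hX hY hξ hη := by
    have pX := h.isInvariantPerp_sec hX (B.field_act X)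
    have pY := h.isInvariantPerp_sec hY (B.field_act Y)
    have pσ : L.IsInvariantPerp (h.sec hX + cotSec C B hξ) :=
      isInvariantPerp_add pX (isInvariantPerp_cotSec hξ)
    have pτ : L.IsInvariantPerp (h.sec hY + cotSec C B hη) :=
      isInvariantPerp_add pY (isInvariantPerp_cotSec hη)
    have aσ : ∀ (X : ∀ x, B.AtiyahFiber x) (hX : SmoothField (B.field X))
        (ξ : ∀ x : M, Module.Dual ℝ (TangentSpace 𝓘(ℝ, EM) x)) (hξ : SmoothCovector ξ) (q : P),
        C.anchor q ((h.sec hX + cotSec C B hξ) q) = B.field X q := fun X hX ξ hξ q => by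
      rw [ContMDiffSection.coe_add, Pi.add_apply, map_add, h.anchor_sec]
      exact (congrArg (B.field X q + ·)
        (anchor_cot hπ (⟨q, rfl⟩ : B.Fib (B.proj q)) (ξ (B.proj q)))).trans (add_zero _)
    -- The components `W` and `ζ` are those of the bracket upstairs; it remains to compute `W` by
    -- the anchor and `ζ` by pairing with horizontal lifts.
    obtain ⟨W, ζ, hr⟩ := h.exists_represents hC hπ hc hnd (pσ.bracket pτ)
    have hr' := (h.represents_iso_iff hC hπ hc hnd _ _ _).1 hr
    refine ⟨W, ζ, fun q => ?_, fun Xm Ym Z Zh hXm hYm hZ hZh q => ?_,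
      ⟨h.sec hX + cotSec C B hξ, (h.represents_iso_iff hC hπ hc hnd _ _ _).2 fun q => rfl⟩,
      ⟨h.sec hY + cotSec C B hη, (h.represents_iso_iff hC hπ hc hnd _ _ _).2 fun q => rfl⟩, fun σ τ hσ hτ => ?_⟩
    · have e := C.anchor_bracket (h.sec hX + cotSec C B hξ) (h.sec hY + cotSec C B hη) q
      simp only [aσ] at e
      rw [← e, hr' q, map_add, h.anchor]
      exact ((congrArg (B.field W q + ·)
        (anchor_cot hπ (⟨q, rfl⟩ : B.Fib (B.proj q)) (ζ (B.proj q)))).trans (add_zero _)).symm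
    · obtain rfl := hZh.eq_hlift
      have sZ := A.smoothField_hlift hZ
      have e := h.two_mul_pairing_hlift q (B.field W q) (ζ (B.proj q)) (Z (B.proj q))
      rw [← hr' q] at e
      have jX : B.Projects (fun q => C.anchor q (h.sec hX q)) Xm := fun q =>
        (congrArg (B.dProj q) (h.anchor_sec hX q)).trans (hXm q)
      have jY : B.Projects (fun q => C.anchor q ((h.sec hY + cotSec C B hη) q)) Ym := fun q =>
        (congrArg (B.dProj q) (aσ Y hY η hη q)).trans (hYm q)
      have jZ : B.Projects (fun q => C.anchor q (h.sec sZ q)) Z := fun q =>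
        (congrArg (B.dProj q) (h.anchor_sec sZ q)).trans (A.dProj_hlift q _)
      have e1 := pairing_bracket_cotSec_right jX jZ hη q
      have e2 := pairing_bracket_cotSec_left jY jZ hξ q
      have e3 := h.pairing_bracket_sec hC hL hc hX hY sZ (B.field_act X) (B.field_act Y)
        (fun q g => B.field_act (fun x => A.atiyahLift x (Z x)) q g)
        (fun q => A.form_hlift q _) q
      have e4 := h.formAt_apply q ⟨Xm, hXm.smoothField B hX⟩ ⟨Ym, hYm.smoothField B hY⟩ ⟨Z, hZ⟩
      rw [tri, h.horSec_eq_sec_hor hX hXm, h.horSec_eq_sec_hor hY hYm] at e4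
      -- The last summand keeps `λY + η` whole: `e2` depends on it only through its projection, so
      -- the bracket of `ξ` with `η` needs no separate treatment.
      have e5 : C.bracket (h.sec hX + cotSec C B hξ) (h.sec hY + cotSec C B hη) q =
          C.bracket (h.sec hX) (h.sec hY) q + C.bracket (h.sec hX) (cotSec C B hη) q +
            C.bracket (cotSec C B hξ) (h.sec hY + cotSec C B hη) q := by
        rw [map_add C.bracket, LinearMap.add_apply, map_add (C.bracket (h.sec hX))]
        rfl
      rw [e5, map_add, map_add, LinearMap.add_apply, LinearMap.add_apply] at e
      change 2 * (C.pairing q _ (h.sec sZ q) + C.pairing q _ (h.sec sZ q) +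
        C.pairing q _ (h.sec sZ q)) = _ at e
      rw [e1, e2, e3] at e
      change h.formAt (B.proj q) ![Xm (B.proj q), Ym (B.proj q), Z (B.proj q)] =
        2 * C.pairing q _ (h.sec sZ q) at e4
      rw [← e, dorfmanForm]
      change _ = _ - _ + h.formAt (B.proj q) ![Xm (B.proj q), Ym (B.proj q), Z (B.proj q)]
        + _ + _ - _
      rw [e4]
      ring
    · have e1 : σ = h.sec hX + cotSec C B hξ :=
        ContMDiffSection.ext ((h.represents_iso_iff hC hπ hc hnd _ _ _).1 hσ)
      have e2 : τ = h.sec hY + cotSec C B hη :=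
        ContMDiffSection.ext ((h.represents_iso_iff hC hπ hc hnd _ _ _).1 hτ)
      rw [e1, e2]
      exact hr

end IsAdapted

end LiftedAction

end Reduction

/-! ### Contraction of 2-forms and Cartan calculus -/

section Contraction

variable {E : Type*} [NormedAddCommGroup E] [NormedSpace ℝ E]
  {M : Type*} [TopologicalSpace M] [ChartedSpace E M]

theorem lieDerivOne_zero (X Z : ∀ x : M, TangentSpace 𝓘(ℝ, E) x) (x : M) :
    lieDerivOne X (fun _ => 0) Z x = 0 := by
  simp only [lieDerivOne, LinearMap.zero_apply, dirDeriv_const, sub_zero]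

theorem extDerivOne_zero (X Z : ∀ x : M, TangentSpace 𝓘(ℝ, E) x) (x : M) :
    extDerivOne (fun _ => 0) X Z x = 0 := by
  simp only [extDerivOne, LinearMap.zero_apply, dirDeriv_const, sub_zero]

variable [IsManifold 𝓘(ℝ, E) ∞ M]

theorem SmoothCovector.add {ξ η : ∀ x : M, Module.Dual ℝ (TangentSpace 𝓘(ℝ, E) x)}
    (hξ : SmoothCovector ξ) (hη : SmoothCovector η) : SmoothCovector (fun x => ξ x + η x) :=
  fun X hX => (hξ X hX).add (hη X hX)

theorem SmoothCovector.sub {ξ η : ∀ x : M, Module.Dual ℝ (TangentSpace 𝓘(ℝ, E) x)}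
    (hξ : SmoothCovector ξ) (hη : SmoothCovector η) : SmoothCovector (fun x => ξ x - η x) :=
  fun X hX => (hξ X hX).sub (hη X hX)

theorem lieDerivOne_add {ξ η : ∀ x : M, Module.Dual ℝ (TangentSpace 𝓘(ℝ, E) x)}
    (hξ : SmoothCovector ξ) (hη : SmoothCovector η) (X : ∀ x : M, TangentSpace 𝓘(ℝ, E) x)
    {Z : ∀ x : M, TangentSpace 𝓘(ℝ, E) x} (hZ : SmoothField Z) (x : M) :
    lieDerivOne X (fun y => ξ y + η y) Z x = lieDerivOne X ξ Z x + lieDerivOne X η Z x := by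
  simp only [lieDerivOne, LinearMap.add_apply]
  rw [dirDeriv_add X (hξ Z hZ) (hη Z hZ)]
  ring

theorem extDerivOne_add {ξ η : ∀ x : M, Module.Dual ℝ (TangentSpace 𝓘(ℝ, E) x)}
    (hξ : SmoothCovector ξ) (hη : SmoothCovector η) {Y Z : ∀ x : M, TangentSpace 𝓘(ℝ, E) x}
    (hY : SmoothField Y) (hZ : SmoothField Z) (x : M) :
    extDerivOne (fun y => ξ y + η y) Y Z x = extDerivOne ξ Y Z x + extDerivOne η Y Z x := by
  simp only [extDerivOne, LinearMap.add_apply]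
  rw [dirDeriv_add Y (hξ Z hZ) (hη Z hZ), dirDeriv_add Z (hξ Y hY) (hη Y hY)]
  ring

namespace SmoothForm

variable (b : SmoothForm E M 2)

/-- The contraction `u ↦ i_u b` of a `2`-form. -/
def contract (x : M) :
    TangentSpace 𝓘(ℝ, E) x →ₗ[ℝ] Module.Dual ℝ (TangentSpace 𝓘(ℝ, E) x) :=
  LinearMap.mk₂ ℝ (fun u v => ((b.toFun x).curryLeft u).curryLeft v ![])
    (by intro u u' v; simp) (by intro r u v; simp) (by intro u v v'; simp) (by intro r u v; simp)

theorem contract_apply (x : M) (u v : TangentSpace 𝓘(ℝ, E) x) :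
    b.contract x u v = b.toFun x ![u, v] := rfl

theorem contract_swap (x : M) (u v : TangentSpace 𝓘(ℝ, E) x) :
    b.contract x u v = -b.contract x v u := by
  have h : ∀ w, b.contract x w w = 0 := fun w =>
    (b.toFun x).map_eq_zero_of_eq ![w, w] (i := 0) (j := 1) rfl (by simp)
  have h1 := h (u + v)
  simp only [map_add, LinearMap.add_apply, h] at h1
  linarith

theorem smoothCovector_contract {X : ∀ x : M, TangentSpace 𝓘(ℝ, E) x} (hX : SmoothField X) :
    SmoothCovector (fun x => b.contract x (X x)) := fun Z hZ => by
  refine (b.smooth ![X, Z] fun i => ?_).congr fun x => ?_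
  · fin_cases i
    · exact hX
    · exact hZ
  · rw [contract_apply]
    congr 1
    funext i
    fin_cases i <;> rfl

/-- `L_X i_Y b - i_Y d i_X b = i_Y i_X db + i_{[X,Y]} b`. -/
theorem lieDerivOne_contract_sub (X Y Z : ∀ x : M, TangentSpace 𝓘(ℝ, E) x) (x : M) :
    lieDerivOne X (fun y => b.contract y (Y y)) Z x
      - extDerivOne (fun y => b.contract y (X y)) Y Z x =
    extDerivTwo b X Y Z x + b.contract x (mlieBracket 𝓘(ℝ, E) X Y x) (Z x) := by
  have h1 := b.contract_swap x (Y x) (mlieBracket 𝓘(ℝ, E) X Z x)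
  have h2 := b.contract_swap x (X x) (mlieBracket 𝓘(ℝ, E) Y Z x)
  simp only [contract_apply] at h1 h2
  simp only [lieDerivOne, extDerivOne, extDerivTwo, contract_apply, h1, h2]
  ring

end SmoothForm

end Contraction

/-! ### B-transforms and comparison of presentations -/

section Reduction

variable {EG : Type*} [NormedAddCommGroup EG] [NormedSpace ℝ EG] [FiniteDimensional ℝ EG]
  {G : Type*} [TopologicalSpace G] [ChartedSpace EG G] [Group G] [LieGroup 𝓘(ℝ, EG) ∞ G]
  {EP : Type*} [NormedAddCommGroup EP] [NormedSpace ℝ EP] [FiniteDimensional ℝ EP]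
  {P : Type*} [TopologicalSpace P] [ChartedSpace EP P] [IsManifold 𝓘(ℝ, EP) ∞ P] [T2Space P]
  {EM : Type*} [NormedAddCommGroup EM] [NormedSpace ℝ EM] [FiniteDimensional ℝ EM]
  {M : Type*} [TopologicalSpace M] [ChartedSpace EM M] [IsManifold 𝓘(ℝ, EM) ∞ M] [T2Space M]
  {B : PrincipalBundle EG G EP P EM M}
  {F : Type*} [NormedAddCommGroup F] [NormedSpace ℝ F] [FiniteDimensional ℝ F]
  {V : P → Type*} [TopologicalSpace (TotalSpace F V)]
  [∀ q, AddCommGroup (V q)] [∀ q, Module ℝ (V q)] [∀ q, TopologicalSpace (V q)]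
  [FiberBundle F V] [VectorBundle ℝ F V] [ContMDiffVectorBundle ∞ F V 𝓘(ℝ, EP)]
  {C : CourantAlgebroid EP F V}

namespace LiftedAction

variable {L : LiftedAction B C} {c : LinearMap.BilinForm ℝ (GroupLieAlgebra 𝓘(ℝ, EG) G)}
  {A : B.Connection}
  {Φ Φ' : ∀ x, (B.AtiyahFiber x × Module.Dual ℝ (TangentSpace 𝓘(ℝ, EM) x)) ≃ₗ[ℝ] L.RedFiber x}
  {H H' : SmoothForm EM M 3} {b : SmoothForm EM M 2}

theorem Represents.eq {σ : Cₛ^∞⟮𝓘(ℝ, EP); F, V⟯} {s s' : ∀ x, L.RedFiber x}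
    (h : L.Represents σ s) (h' : L.Represents σ s') : s = s' := by
  funext x
  obtain ⟨_, e⟩ := h x
  obtain ⟨_, e'⟩ := h' x
  rw [e, e']

/-- The smoothness built into `IsBracket` supplies representatives, without which its last condition
would be vacuous. -/
theorem IsBracket.eq {s t r r' : ∀ x, L.RedFiber x} (h : L.IsBracket s t r)
    (h' : L.IsBracket s t r') : r = r' := by
  obtain ⟨⟨σ, hσ⟩, ⟨τ, hτ⟩, hr⟩ := h
  exact (hr σ τ hσ hτ).eq (h'.2.2 σ τ hσ hτ)

theorem atiyahProj_eq_mlieBracket {X Y W : ∀ x, B.AtiyahFiber x} (hX : SmoothField (B.field X))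
    (hY : SmoothField (B.field Y)) {Xm Ym : ∀ x : M, TangentSpace 𝓘(ℝ, EM) x}
    (hXm : B.Projects (B.field X) Xm) (hYm : B.Projects (B.field Y) Ym)
    (hW : ∀ q, B.field W q = mlieBracket 𝓘(ℝ, EP) (B.field X) (B.field Y) q) (x : M) :
    B.atiyahProj x (W x) = mlieBracket 𝓘(ℝ, EM) Xm Ym x := by
  obtain ⟨q, rfl⟩ := B.proj_surjective x
  refine (B.projects_atiyahProj W q).symm.trans ?_
  rw [hW]
  exact mfderiv_mlieBracket_of_related B.contMDiff_proj hX hY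
    (hXm.smoothField B hX) (hYm.smoothField B hY) hXm hYm q

/-- The composition of `Φ` with `X + ξ ↦ X + ξ + i_{pX} b`. -/
def bTransform (b : SmoothForm EM M 2)
    (Φ : ∀ x, (B.AtiyahFiber x × Module.Dual ℝ (TangentSpace 𝓘(ℝ, EM) x)) ≃ₗ[ℝ] L.RedFiber x)
    (x : M) : (B.AtiyahFiber x × Module.Dual ℝ (TangentSpace 𝓘(ℝ, EM) x)) ≃ₗ[ℝ] L.RedFiber x :=
  (LinearEquiv.skewProd (LinearEquiv.refl ℝ _) (LinearEquiv.refl ℝ _)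
    (b.contract x ∘ₗ B.atiyahProj x)).trans (Φ x)

theorem bTransform_apply (x : M) (X : B.AtiyahFiber x)
    (ξ : Module.Dual ℝ (TangentSpace 𝓘(ℝ, EM) x)) :
    bTransform b Φ x (X, ξ) = Φ x (X, ξ + b.contract x (B.atiyahProj x X)) := rfl

theorem isBTransform_bTransform : L.IsBTransform (bTransform b Φ) Φ b := by
  intro q X ξ ξ' h
  rw [bTransform_apply]
  congr 2
  refine LinearMap.ext fun v => ?_
  have e : B.dProj q (X.1 ⟨q, rfl⟩) = B.atiyahProj (B.proj q) X :=
    B.dProj_eq_atiyahProj X ⟨q, rfl⟩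
  rw [h v, e]
  rfl

/-- The shear preserves the pairing because `b` is skew, and the bracket changes by exactly the `db`
absorbed into `H'`. -/
theorem IsPresentation.bTransform (h : L.IsPresentation c A Φ H) (hH : EqAddExact H' H b) :
    L.IsPresentation c A (bTransform b Φ) H' where
  smooth_iff X ξ := by
    refine (h.smooth_iff X fun x => ξ x + b.contract x (B.atiyahProj x (X x))).trans
      (and_congr_right fun hX => ?_)
    have hb := b.smoothCovector_contract ((B.projects_atiyahProj X).smoothField B hX)
    refine ⟨fun hs => ?_, fun hξ => hξ.add hb⟩
    have := hs.sub hb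
    simpa only [add_sub_cancel_right] using this
  proj x X ξ u hu q := h.proj x X _ u hu q
  pairing_eq q X Y ξ η := by
    have eX : B.dProj q (X.1 ⟨q, rfl⟩) = B.atiyahProj (B.proj q) X :=
      B.dProj_eq_atiyahProj X ⟨q, rfl⟩
    have eY : B.dProj q (Y.1 ⟨q, rfl⟩) = B.atiyahProj (B.proj q) Y :=
      B.dProj_eq_atiyahProj Y ⟨q, rfl⟩
    rw [bTransform_apply, bTransform_apply, h.pairing_eq, LinearMap.add_apply, LinearMap.add_apply,
      eX, eY, b.contract_swap _ (B.atiyahProj (B.proj q) Y)]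
    ring
  bracket_eq X Y ξ η hX hY hξ hη := by
    have hXm := B.projects_atiyahProj X
    have hYm := B.projects_atiyahProj Y
    have sX := hXm.smoothField B hX
    have sY := hYm.smoothField B hY
    have bX := b.smoothCovector_contract sX
    have bY := b.smoothCovector_contract sY
    obtain ⟨W, ζ, hW, hζ, hbr⟩ := h.bracket_eq X Y _ _ hX hY (hξ.add bX) (hη.add bY)
    -- Subtracting `i_{pW}b` makes the shear of the new pair equal to `W + ζ`, so the bracket in `E`
    -- is unchanged.
    refine ⟨W, fun x => ζ x - b.contract x (B.atiyahProj x (W x)), hW,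
      fun Xm Ym Z Zh jX jY hZ hZh q => ?_, ?_⟩
    · obtain rfl := PrincipalBundle.Projects.eq B hXm jX
      obtain rfl := PrincipalBundle.Projects.eq B hYm jY
      rw [LinearMap.sub_apply, hζ _ _ Z Zh jX jY hZ hZh q, dorfmanForm, dorfmanForm,
        lieDerivOne_add hη bY _ hZ, extDerivOne_add hξ bX sY hZ, hH _ _ _ sX sY hZ,
        atiyahProj_eq_mlieBracket hX hY jX jY hW]
      linear_combination b.lieDerivOne_contract_sub (fun x => B.atiyahProj x (X x))
        (fun x => B.atiyahProj x (Y x)) Z (B.proj q)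
    · have e : (fun x => LiftedAction.bTransform b Φ x
          (W x, ζ x - b.contract x (B.atiyahProj x (W x)))) = fun x => Φ x (W x, ζ x) := by
        funext x
        rw [bTransform_apply, sub_add_cancel]
      rw [e]
      exact hbr

namespace IsPresentation

/-- Both isomorphisms have the anchor of a common representative as their component in `TP/G`. -/
theorem fst_symm (h : L.IsPresentation c A Φ H) (h' : L.IsPresentation c A Φ' H') (x : M)
    (X : B.AtiyahFiber x) (ξ : Module.Dual ℝ (TangentSpace 𝓘(ℝ, EM) x)) :
    ((Φ x).symm (Φ' x (X, ξ))).1 = X := by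
  obtain ⟨u, hu⟩ := Submodule.Quotient.mk_surjective _ (Φ' x (X, ξ))
  obtain ⟨q⟩ := B.nonempty_fib x
  refine B.atiyah_ext q ?_
  rw [← h'.proj x X ξ u hu.symm q]
  refine (h.proj x _ ((Φ x).symm (Φ' x (X, ξ))).2 u ?_ q).symm
  rw [Prod.mk.eta, LinearEquiv.apply_symm_apply]
  exact hu.symm

variable (Φ') in
variable (Φ) in
/-- The cotangent component of `Φ⁻¹ ∘ Φ'`. -/
def transition (x : M) : (B.AtiyahFiber x × Module.Dual ℝ (TangentSpace 𝓘(ℝ, EM) x)) →ₗ[ℝ]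
    Module.Dual ℝ (TangentSpace 𝓘(ℝ, EM) x) :=
  LinearMap.snd ℝ _ _ ∘ₗ ((Φ' x).trans (Φ x).symm).toLinearMap

theorem apply_eq (h : L.IsPresentation c A Φ H) (h' : L.IsPresentation c A Φ' H') (x : M)
    (X : B.AtiyahFiber x) (ξ : Module.Dual ℝ (TangentSpace 𝓘(ℝ, EM) x)) :
    Φ' x (X, ξ) = Φ x (X, transition Φ Φ' x (X, ξ)) := by
  have e : (X, transition Φ Φ' x (X, ξ)) = (Φ x).symm (Φ' x (X, ξ)) :=
    Prod.ext (h.fst_symm h' x X ξ).symm rfl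
  rw [e, LinearEquiv.apply_symm_apply]

/-- The two formulas for the same pairing are compared; the terms in `c` agree because the
components in `TP/G` do. -/
theorem transition_pairing (h : L.IsPresentation c A Φ H) (h' : L.IsPresentation c A Φ' H') (x : M)
    (X Y : B.AtiyahFiber x) (ξ η : Module.Dual ℝ (TangentSpace 𝓘(ℝ, EM) x)) :
    transition Φ Φ' x (Y, η) (B.atiyahProj x X) + transition Φ Φ' x (X, ξ) (B.atiyahProj x Y) =
      η (B.atiyahProj x X) + ξ (B.atiyahProj x Y) := by
  obtain ⟨q, rfl⟩ := B.proj_surjective x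
  have eX : B.dProj q (X.1 ⟨q, rfl⟩) = B.atiyahProj (B.proj q) X :=
    B.dProj_eq_atiyahProj X ⟨q, rfl⟩
  have eY : B.dProj q (Y.1 ⟨q, rfl⟩) = B.atiyahProj (B.proj q) Y :=
    B.dProj_eq_atiyahProj Y ⟨q, rfl⟩
  have e := h'.pairing_eq q X Y ξ η
  rw [h.apply_eq h', h.apply_eq h', h.pairing_eq, eX, eY] at e
  linarith

/-- Pairing `0 + ξ` with horizontal lifts, which reach every tangent vector of `M`, shows that `ξ`
is fixed; linearity does the rest. -/
theorem transition_eq_add (h : L.IsPresentation c A Φ H) (h' : L.IsPresentation c A Φ' H') (x : M)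
    (X : B.AtiyahFiber x) (ξ : Module.Dual ℝ (TangentSpace 𝓘(ℝ, EM) x)) :
    transition Φ Φ' x (X, ξ) = ξ + transition Φ Φ' x (X, 0) := by
  have e0 : transition Φ Φ' x (0, ξ) = ξ := by
    refine LinearMap.ext fun v => ?_
    have e := h.transition_pairing h' x 0 (A.atiyahLift x v) ξ 0
    simpa only [map_zero, zero_add, LinearMap.zero_apply, A.atiyahProj_atiyahLift] using e
  have e1 : ((X, ξ) : B.AtiyahFiber x × Module.Dual ℝ (TangentSpace 𝓘(ℝ, EM) x)) =
      (0, ξ) + (X, 0) := by simp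
  rw [e1, map_add, e0]

theorem transition_swap (h : L.IsPresentation c A Φ H) (h' : L.IsPresentation c A Φ' H') (x : M)
    (X Y : B.AtiyahFiber x) :
    transition Φ Φ' x (X, 0) (B.atiyahProj x Y) = -transition Φ Φ' x (Y, 0) (B.atiyahProj x X) := by
  have e := h.transition_pairing h' x X Y 0 0
  simp only [LinearMap.zero_apply, add_zero] at e
  linarith

theorem transition_lift_swap (h : L.IsPresentation c A Φ H) (h' : L.IsPresentation c A Φ' H')
    (x : M) (u v : TangentSpace 𝓘(ℝ, EM) x) :
    transition Φ Φ' x (A.atiyahLift x u, 0) v = -transition Φ Φ' x (A.atiyahLift x v, 0) u := by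
  have e := h.transition_swap h' x (A.atiyahLift x u) (A.atiyahLift x v)
  rwa [A.atiyahProj_atiyahLift, A.atiyahProj_atiyahLift] at e

/-- By skew-symmetry the value on a vector `v` sees `X` only through `pX`, so the cotangent
component descends to a bilinear form on `TM`. -/
theorem transition_eq_lift (h : L.IsPresentation c A Φ H) (h' : L.IsPresentation c A Φ' H') (x : M)
    (X : B.AtiyahFiber x) :
    transition Φ Φ' x (X, 0) = transition Φ Φ' x (A.atiyahLift x (B.atiyahProj x X), 0) := by
  refine LinearMap.ext fun v => ?_
  have e := h.transition_swap h' x X (A.atiyahLift x v)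
  rw [A.atiyahProj_atiyahLift] at e
  rw [e, h.transition_lift_swap h']
  exact neg_neg _

/-- The `2`-form relating two presentations. -/
def twoForm (h : L.IsPresentation c A Φ H) (h' : L.IsPresentation c A Φ' H') :
    SmoothForm EM M 2 where
  toFun x := alternatingOfBi (fun u v => transition Φ Φ' x (A.atiyahLift x u, 0) v)
    (fun _ _ _ => map_add _ _ _) (fun _ _ _ => map_smul _ _ _) (h.transition_lift_swap h' x)
  smooth X hX := by
    have h0 : SmoothField (B.field fun x => A.atiyahLift x (X 0 x)) := A.smoothField_hlift (hX 0)
    -- `Φ'` takes the horizontal lift to a smooth section; its cotangent component under `Φ` is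
    -- `i_{X₀}b`, smooth by the other direction of `smooth_iff`.
    have hs := (h'.smooth_iff (fun x => A.atiyahLift x (X 0 x)) fun _ => 0).2
      ⟨h0, fun _ _ => contMDiff_const⟩
    simp only [h.apply_eq h'] at hs
    exact ((h.smooth_iff _ _).1 hs).2 (X 1) (hX 1)

theorem twoForm_contract (h : L.IsPresentation c A Φ H) (h' : L.IsPresentation c A Φ' H') (x : M)
    (u : TangentSpace 𝓘(ℝ, EM) x) :
    (h.twoForm h').contract x u = transition Φ Φ' x (A.atiyahLift x u, 0) := rfl

theorem apply_eq_contract (h : L.IsPresentation c A Φ H) (h' : L.IsPresentation c A Φ' H') (x : M)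
    (X : B.AtiyahFiber x) (ξ : Module.Dual ℝ (TangentSpace 𝓘(ℝ, EM) x)) :
    Φ' x (X, ξ) = Φ x (X, ξ + (h.twoForm h').contract x (B.atiyahProj x X)) := by
  rw [h.apply_eq h', h.transition_eq_add h', h.transition_eq_lift h', twoForm_contract]

theorem isBTransform_twoForm (h : L.IsPresentation c A Φ H) (h' : L.IsPresentation c A Φ' H') :
    L.IsBTransform Φ' Φ (h.twoForm h') := by
  intro q X ξ ξ' hξ
  rw [h.apply_eq_contract h', ← bTransform_apply]
  exact isBTransform_bTransform q X ξ ξ' hξ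

theorem dorfmanForm_of_horizontal {X Y : ∀ q : P, TangentSpace 𝓘(ℝ, EP) q} {q : P}
    (hX : A.form q (X q) = 0) (hY : A.form q (Y q) = 0) (H : SmoothForm EM M 3)
    (Zh : ∀ q : P, TangentSpace 𝓘(ℝ, EP) q) (Xm Ym Z : ∀ x : M, TangentSpace 𝓘(ℝ, EM) x)
    (ξ η : ∀ x : M, Module.Dual ℝ (TangentSpace 𝓘(ℝ, EM) x)) :
    dorfmanForm c A H X Y Zh Xm Ym Z ξ η q =
      lieDerivOne Xm η Z (B.proj q) - extDerivOne ξ Ym Z (B.proj q)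
        + H.toFun (B.proj q) ![Xm (B.proj q), Ym (B.proj q), Z (B.proj q)] := by
  simp only [dorfmanForm, hX, hY, map_zero, mul_zero, add_zero, sub_zero]

/-- On horizontal lifts with zero 1-forms the connection terms of the bracket drop out, so the
primed bracket has cotangent component `H'` alone, while the unprimed one sees `H` together with the
contractions of `b`. -/
theorem eqAddExact_twoForm (h : L.IsPresentation c A Φ H) (h' : L.IsPresentation c A Φ' H') :
    EqAddExact H' H (h.twoForm h') := by
  intro X Y Z hX hY hZ x
  obtain ⟨q, rfl⟩ := B.proj_surjective x
  let Xl : ∀ x, B.AtiyahFiber x := fun x => A.atiyahLift x (X x)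
  let Yl : ∀ x, B.AtiyahFiber x := fun x => A.atiyahLift x (Y x)
  have sX : SmoothField (B.field Xl) := A.smoothField_hlift hX
  have sY : SmoothField (B.field Yl) := A.smoothField_hlift hY
  have jX : B.Projects (B.field Xl) X := fun q => A.dProj_hlift q _
  have jY : B.Projects (B.field Yl) Y := fun q => A.dProj_hlift q _
  have fX : A.form q (B.field Xl q) = 0 := A.form_hlift q _
  have fY : A.form q (B.field Yl q) = 0 := A.form_hlift q _
  have jZ := A.isHorLift_hlift Z
  obtain ⟨W', ζ', hW', hζ', hbr'⟩ := h'.bracket_eq Xl Yl (fun _ => 0) (fun _ => 0) sX sY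
    (fun _ _ => contMDiff_const) (fun _ _ => contMDiff_const)
  obtain ⟨W, ζ, hW, hζ, hbr⟩ := h.bracket_eq Xl Yl _ _ sX sY
    ((h.twoForm h').smoothCovector_contract hX) ((h.twoForm h').smoothCovector_contract hY)
  simp only [h.apply_eq_contract h', zero_add, Xl, Yl, A.atiyahProj_atiyahLift] at hbr'
  -- Both presentations compute the bracket of the same sections of `E`, so the components under `Φ`
  -- can be equated.
  have e := congrFun (hbr.eq hbr') (B.proj q)
  have e2 := congrArg Prod.snd ((Φ (B.proj q)).injective e)
  have e3 := LinearMap.congr_fun e2 (Z (B.proj q))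
  simp only [LinearMap.add_apply] at e3
  rw [hζ X Y Z _ jX jY hZ jZ q, hζ' X Y Z _ jX jY hZ jZ q, dorfmanForm_of_horizontal fX fY,
    dorfmanForm_of_horizontal fX fY, lieDerivOne_zero, extDerivOne_zero,
    atiyahProj_eq_mlieBracket sX sY jX jY hW'] at e3
  linear_combination (h.twoForm h').lieDerivOne_contract_sub X Y Z (B.proj q) - e3

end IsPresentation

end LiftedAction

end Reduction

end CourantReduction

end

/-! ### The classification of presentations -/

theorem mainTheorem6
    {EG : Type*} [NormedAddCommGroup EG] [NormedSpace ℝ EG] [FiniteDimensional ℝ EG]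
    {G : Type*} [TopologicalSpace G] [ChartedSpace EG G] [Group G] [LieGroup 𝓘(ℝ, EG) ∞ G]
    [T2Space G] [SecondCountableTopology G]
    {EP : Type*} [NormedAddCommGroup EP] [NormedSpace ℝ EP] [FiniteDimensional ℝ EP]
    {P : Type*} [TopologicalSpace P] [ChartedSpace EP P] [IsManifold 𝓘(ℝ, EP) ∞ P]
    [T2Space P] [SecondCountableTopology P]
    {EM : Type*} [NormedAddCommGroup EM] [NormedSpace ℝ EM] [FiniteDimensional ℝ EM]
    {M : Type*} [TopologicalSpace M] [ChartedSpace EM M] [IsManifold 𝓘(ℝ, EM) ∞ M]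
    [T2Space M] [SecondCountableTopology M]
    (B : PrincipalBundle EG G EP P EM M)
    {F : Type*} [NormedAddCommGroup F] [NormedSpace ℝ F] [FiniteDimensional ℝ F]
    {V : P → Type*} [TopologicalSpace (TotalSpace F V)]
    [∀ q, AddCommGroup (V q)] [∀ q, Module ℝ (V q)] [∀ q, TopologicalSpace (V q)]
    [FiberBundle F V] [VectorBundle ℝ F V] [ContMDiffVectorBundle ∞ F V 𝓘(ℝ, EP)]
    (C : CourantAlgebroid EP F V) (hC : C.IsExact)
    (L : LiftedAction B C) (hL : L.IsEquivariant)
    (hs : ∃ s, L.IsEquivariantIsotropicSplitting s)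
    (c : LinearMap.BilinForm ℝ (GroupLieAlgebra 𝓘(ℝ, EG) G)) (hc : L.IsQuadraticForm c)
    (hnd : ∀ z, (∀ w, c z w = 0) → z = 0)
    (A : B.Connection) :
    (∃ Φ H, L.IsPresentation c A Φ H) ∧
    (∀ Φ H Φ' H', L.IsPresentation c A Φ H → L.IsPresentation c A Φ' H' →
      ∃ b : SmoothForm EM M 2, L.IsBTransform Φ' Φ b ∧ EqAddExact H' H b) ∧
    (∀ Φ H H' (b : SmoothForm EM M 2), L.IsPresentation c A Φ H → EqAddExact H' H b →
      ∃ Φ', L.IsBTransform Φ' Φ b ∧ L.IsPresentation c A Φ' H') := by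
  obtain ⟨s, hs⟩ := hs
  have hπ : C.AnchorCoanchor := fun q => C.anchor_coanchor hC (s q) (hs.2.1 q) (hs.2.2.1 q)
  obtain ⟨lam, h⟩ := LiftedAction.exists_isAdapted hC hL hc hs A
  exact ⟨⟨_, _, h.isPresentation hC hπ hL hc hnd⟩,
    fun _ _ _ _ h h' => ⟨h.twoForm h', h.isBTransform_twoForm h', h.eqAddExact_twoForm h'⟩,
    fun _ _ _ _ h hH => ⟨_, LiftedAction.isBTransform_bTransform, h.bTransform hH⟩⟩
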